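/- Let $k\ge 2$ and $M\ge 4k+1$ be integers, and let $d_k\ge\dots\ge d_1\ge 2$ be integers with $d_1+\dots+d_k=M+k$. Put $\mathbb P=\mathbb P^{M+k}_{\mathbb C}$, and let $\mathcal F\subset\prod_{i=1}^k\mathbb P(H^0(\mathbb P,\mathcal O_{\mathbb P}(d_i)))$ be the set of tuples $(f_1,\dots,f_k)$ for which $F=\{f_1=\dots=f_k=0\}$ is an irreducible reduced complete intersection of codimension $k$ in $\mathbb P$. For a point $x\in F$ take a standard affine chart $\mathbb C^{M+k}\subset\mathbb P$ containing $x$ with linear coordinates $z_1,\dots,z_{M+k}$ centred at $x$, and write $f_i=q_{i,1}+\dots+q_{i,d_i}$ with $q_{i,j}$ homogeneous of degree $j$ in $z_*$; put $T=\{q_{1,1}=\dots=q_{k,1}=0\}$. A smooth point $x\in F$ is *regular* if the polynomials $q_{i,j}$, $1\le i\le k$, $1\le j\le d_i$, $(i,j)\ne(k,d_k)$, make a regular sequence in $\mathcal O_{x,\mathbb P}$. A singular point $x\in F$ is *regular* if it is a non-degenerate quadratic singularity and the system $\{q_{i,j}=0 \mid (i,j)\neq(k,d_k)\}$ defines a closed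 set of dimension two in $\mathbb C^{M+k}$, the linear span of each irreducible component of which is $T$. Let $\mathcal F_{\rm reg}\subset\mathcal F$ be the set of those $F$ all of whose points are regular. A smooth point $x\in F$ satisfies the *stronger regularity condition* $(R^+)$ if for every linear form $l(z_*)$ that does not vanish identically on the tangent space $T_xF=T$ the polynomials $$\{l\}\cup\{q_{i,j}\mid 1\le i\le k,\ 1\le j\le d_i,\ (i,j)\notin E\}$$ make a regular sequence in $\mathcal O_{x,\mathbb P}$, where $E=\{(k,d_k),(k-1,d_{k-1})\}$ if $d_{k-1}=d_k$, and $E=\{(k,d_k),(k,d_k-1)\}$ if $d_{k-1}\le d_k-1$. Then there exists a non-empty Zariski open subset $\mathcal F^+_{\rm reg}$ of $\prod_{i=1}^k\mathbb P(H^0(\mathbb P,\mathcal O_{\mathbb P}(d_i)))$, contained in $\mathcal F_{\rm reg}$, such that every $F\in\mathcal F^+_{\rm reg}$ is smooth and satisfies $(R^+)$ at every point $x\in F$. -/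

import Mathlib

open MvPolynomial

noncomputable section

namespace FanoCI

/-! ### The parameter space -/

/-- The product `∏ᵢ ℙ(H⁰(ℙⁿ, 𝒪(dᵢ)))`, where `H⁰(ℙⁿ, 𝒪(e))` is the space of forms of degree `e`
in the homogeneous coordinates `x₀, …, xₙ`. -/
abbrev ParamSpace (n : ℕ) {k : ℕ} (d : Fin k → ℕ) : Type :=
  (i : Fin k) → Projectivization ℂ (homogeneousSubmodule (Fin (n + 1)) ℂ (d i))

/-- Defining equations `f₁, …, f_k` of a member of the parameter space, each determined up to a
nonzero constant. -/
def eqns {n k : ℕ} {d : Fin k → ℕ} (F : ParamSpace n d) (i : Fin k) :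
    MvPolynomial (Fin (n + 1)) ℂ :=
  ((F i).rep : MvPolynomial (Fin (n + 1)) ℂ)

/-- Zariski open subsets of `∏ᵢ ℙ(Vᵢ)`, `Vᵢ = H⁰(ℙⁿ, 𝒪(dᵢ))`: the preimage in `∏ᵢ (Vᵢ ∖ {0})` is
Zariski open, that is, it is the complement of the common zero set of some set `S` of polynomials
in the coefficients of the forms (the variable `(i, m)` is the coefficient of the monomial `m`
in the `i`-th form). -/
def IsZariskiOpen {n k : ℕ} {d : Fin k → ℕ} (U : Set (ParamSpace n d)) : Prop :=
  ∃ S : Set (MvPolynomial (Fin k × (Fin (n + 1) →₀ ℕ)) ℂ),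
    ∀ (f : (i : Fin k) → homogeneousSubmodule (Fin (n + 1)) ℂ (d i)) (hf : ∀ i, f i ≠ 0),
      (fun i => Projectivization.mk ℂ (f i) (hf i)) ∈ U ↔
        ∃ G ∈ S, eval (fun im => coeff im.2 (f im.1 : MvPolynomial (Fin (n + 1)) ℂ)) G ≠ 0

/-! ### Points, affine charts and Taylor components -/

/-- Complex projective space of dimension `n`. -/
abbrev PSpace (n : ℕ) : Type := Projectivization ℂ (Fin (n + 1) → ℂ)

/-- The closed algebraic set `{f₁ = ⋯ = f_k = 0} ⊆ ℙⁿ`. -/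
def points {n k : ℕ} {d : Fin k → ℕ} (F : ParamSpace n d) : Set (PSpace n) :=
  {x | ∀ i, eval x.rep (eqns F i) = 0}

/-- The polynomial obtained from `f` in the affine chart `{x_c ≠ 0}`, in the linear coordinates
on the chart whose origin is the point with affine coordinates `a`. -/
def dehom {n : ℕ} (c : Fin (n + 1)) (a : Fin n → ℂ) (f : MvPolynomial (Fin (n + 1)) ℂ) :
    MvPolynomial (Fin n) ℂ :=
  aeval (Fin.insertNth (α := fun _ => MvPolynomial (Fin n) ℂ) c 1 (fun m => X m + C (a m))) f

/-- The affine coordinates of `x` in the chart `{x_c ≠ 0}`. -/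
def affineCoords {n : ℕ} (x : PSpace n) (c : Fin (n + 1)) (m : Fin n) : ℂ :=
  x.rep (c.succAbove m) / x.rep c

/-- The homogeneous component `q_{i,j}` of degree `j` of the `i`-th equation, in the chart
`{x_c ≠ 0}` with coordinates centred at `x`. -/
def q {n k : ℕ} {d : Fin k → ℕ} (F : ParamSpace n d) (x : PSpace n) (c : Fin (n + 1))
    (i : Fin k) (j : ℕ) : MvPolynomial (Fin n) ℂ :=
  homogeneousComponent j (dehom c (affineCoords x c) (eqns F i))

/-- The linear subspace `{q_{1,1} = ⋯ = q_{k,1} = 0}` of `ℂⁿ`. -/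
def tangentSpace {n k : ℕ} {d : Fin k → ℕ} (F : ParamSpace n d) (x : PSpace n)
    (c : Fin (n + 1)) : Set (Fin n → ℂ) :=
  {v | ∀ i, eval v (q F x c i 1) = 0}

/-! ### Fano complete intersections and smoothness -/

/-- Irreducible reduced complete intersections of codimension `k` in `ℙⁿ`: the homogeneous ideal
`(f₁, …, f_k)` has prime radical (irreducibility), its affine cone has dimension `n + 1 - k`
(codimension `k`), and in every standard affine chart the dehomogenized equations generate a
radical ideal (the scheme is reduced). -/
def IsCompleteIntersection {n k : ℕ} {d : Fin k → ℕ} (F : ParamSpace n d) : Prop :=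
  (Ideal.span (Set.range (eqns F))).radical.IsPrime ∧
  ringKrullDim (MvPolynomial (Fin (n + 1)) ℂ ⧸ Ideal.span (Set.range (eqns F))) + (k : ℕ)
    = ((n + 1 : ℕ) : WithBot ℕ∞) ∧
  ∀ c : Fin (n + 1), (Ideal.span (Set.range fun i => dehom c 0 (eqns F i))).IsRadical

/-- Smoothness of the complete intersection at `x` (Jacobian criterion): the linear terms of the
`k` equations at `x` are linearly independent. -/
def IsSmoothPoint {n k : ℕ} {d : Fin k → ℕ} (F : ParamSpace n d) (x : PSpace n) : Prop :=
  ∀ c : Fin (n + 1), x.rep c ≠ 0 → LinearIndependent ℂ fun i => q F x c i 1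

/-- Smooth members. -/
def IsSmooth {n k : ℕ} {d : Fin k → ℕ} (F : ParamSpace n d) : Prop :=
  ∀ x ∈ points F, IsSmoothPoint F x

/-! ### Regular sequences in the local ring -/

/-- The maximal ideal of the origin of `ℂⁿ`. -/
def originIdeal (n : ℕ) : Ideal (MvPolynomial (Fin n) ℂ) :=
  RingHom.ker (constantCoeff : MvPolynomial (Fin n) ℂ →+* ℂ)

instance (n : ℕ) : (originIdeal n).IsPrime := RingHom.ker_isPrime _

/-- The local ring `𝒪_{x,ℙ}` in affine coordinates centred at `x`. -/
abbrev LocalRingAtOrigin (n : ℕ) : Type := Localization.AtPrime (originIdeal n)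

/-- A finite family (multiset) of polynomials makes a regular sequence in the local ring at the
origin, in whatever order it is listed. -/
def MakesRegularSequence {n : ℕ} (Q : Multiset (MvPolynomial (Fin n) ℂ)) : Prop :=
  ∀ L : List (MvPolynomial (Fin n) ℂ), (L : Multiset (MvPolynomial (Fin n) ℂ)) = Q →
    RingTheory.Sequence.IsRegular (LocalRingAtOrigin n)
      (L.map (algebraMap (MvPolynomial (Fin n) ℂ) (LocalRingAtOrigin n)))

/-! ### The regularity conditions -/

/-- The index `k` of the last equation. -/
def lastIdx {k : ℕ} (hk : 2 ≤ k) : Fin k := ⟨k - 1, by omega⟩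

/-- The index `k - 1` of the last but one equation. -/
def prevIdx {k : ℕ} (hk : 2 ≤ k) : Fin k := ⟨k - 2, by omega⟩

/-- All pairs `(i, j)` with `1 ≤ i ≤ k`, `1 ≤ j ≤ dᵢ`. -/
def allIdx {k : ℕ} (d : Fin k → ℕ) : Finset (Σ _ : Fin k, ℕ) :=
  Finset.univ.sigma fun i => Finset.Icc 1 (d i)

/-- All pairs except `(k, d_k)`. -/
def regIdx {k : ℕ} (hk : 2 ≤ k) (d : Fin k → ℕ) : Finset (Σ _ : Fin k, ℕ) :=
  (allIdx d).erase ⟨lastIdx hk, d (lastIdx hk)⟩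

/-- All pairs except `(k, d_k)` and `(k-1, d_{k-1})` if `d_{k-1} = d_k`; all pairs except
`(k, d_k)` and `(k, d_k - 1)` otherwise. -/
def strongIdx {k : ℕ} (hk : 2 ≤ k) (d : Fin k → ℕ) : Finset (Σ _ : Fin k, ℕ) :=
  if d (prevIdx hk) = d (lastIdx hk) then
    (regIdx hk d).erase ⟨prevIdx hk, d (prevIdx hk)⟩
  else
    (regIdx hk d).erase ⟨lastIdx hk, d (lastIdx hk) - 1⟩

/-- The regularity condition at a smooth point. -/
def IsRegularSmoothPoint {n k : ℕ} (hk : 2 ≤ k) {d : Fin k → ℕ} (F : ParamSpace n d)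
    (x : PSpace n) : Prop :=
  IsSmoothPoint F x ∧
  ∀ c : Fin (n + 1), x.rep c ≠ 0 →
    MakesRegularSequence ((regIdx hk d).val.map fun e => q F x c e.1 e.2)

/-- Non-degenerate quadratic singularity of a complete intersection: the linear terms of the
equations span a space of dimension `k - 1`, and for their (unique up to a constant) linear
relation `∑ λᵢ q_{i,1} = 0` the quadratic form `∑ λᵢ q_{i,2}` is non-degenerate on
`T = {q_{1,1} = ⋯ = q_{k,1} = 0}`. -/
def IsNondegenerateQuadraticSingularity {n k : ℕ} {d : Fin k → ℕ} (F : ParamSpace n d)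
    (x : PSpace n) (c : Fin (n + 1)) : Prop :=
  Module.finrank ℂ (Submodule.span ℂ (Set.range fun i => q F x c i 1)) + 1 = k ∧
  ∃ r : Fin k → ℂ, r ≠ 0 ∧ ∑ i, r i • q F x c i 1 = 0 ∧
    ∀ u ∈ tangentSpace F x c,
      (∀ v ∈ tangentSpace F x c,
        eval (u + v) (∑ i, r i • q F x c i 2) = eval u (∑ i, r i • q F x c i 2) +
          eval v (∑ i, r i • q F x c i 2)) → u = 0

/-- The ideal of the system of equations `q_{i,j} = 0`, `(i, j) ≠ (k, d_k)`. -/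
def regIdeal {n k : ℕ} (hk : 2 ≤ k) {d : Fin k → ℕ} (F : ParamSpace n d) (x : PSpace n)
    (c : Fin (n + 1)) : Ideal (MvPolynomial (Fin n) ℂ) :=
  Ideal.span {g | ∃ e ∈ regIdx hk d, g = q F x c e.1 e.2}

/-- The regularity condition at a singular point: `x` is a non-degenerate quadratic singularity,
and the system `q_{i,j} = 0`, `(i, j) ≠ (k, d_k)`, defines a closed set of dimension two in `ℂⁿ`,
each irreducible component of which (the zero set of a minimal prime) has linear span `T`. -/
def IsRegularSingularPoint {n k : ℕ} (hk : 2 ≤ k) {d : Fin k → ℕ} (F : ParamSpace n d)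
    (x : PSpace n) : Prop :=
  ¬ IsSmoothPoint F x ∧
  ∀ c : Fin (n + 1), x.rep c ≠ 0 →
    IsNondegenerateQuadraticSingularity F x c ∧
    ringKrullDim (MvPolynomial (Fin n) ℂ ⧸ regIdeal hk F x c) = 2 ∧
    ∀ P ∈ (regIdeal hk F x c).minimalPrimes,
      (Submodule.span ℂ {v : Fin n → ℂ | ∀ g ∈ P, eval v g = 0} : Set (Fin n → ℂ)) =
        tangentSpace F x c

/-- `𝓕_reg`: the irreducible reduced complete intersections that satisfy the regularity condition
at every point, smooth or singular. -/
def Freg {n k : ℕ} (hk : 2 ≤ k) (d : Fin k → ℕ) : Set (ParamSpace n d) :=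
  {F | IsCompleteIntersection F ∧
    ∀ x ∈ points F, IsRegularSmoothPoint hk F x ∨ IsRegularSingularPoint hk F x}

/-- The stronger regularity condition `(R⁺)` at a smooth point: for every linear form `l` that
does not vanish identically on the tangent space, `l` together with the `q_{i,j}`, all pairs
except the two excluded ones, makes a regular sequence. -/
def StrongRegularAt {n k : ℕ} (hk : 2 ≤ k) {d : Fin k → ℕ} (F : ParamSpace n d)
    (x : PSpace n) : Prop :=
  IsSmoothPoint F x ∧
  ∀ c : Fin (n + 1), x.rep c ≠ 0 →
    ∀ l : MvPolynomial (Fin n) ℂ, l.IsHomogeneous 1 →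
      (∃ v ∈ tangentSpace F x c, eval v l ≠ 0) →
        MakesRegularSequence (l ::ₘ (strongIdx hk d).val.map fun e => q F x c e.1 e.2)

end FanoCI

end

namespace FanoCI

/-! ### Products of subspaces of a field -/

/-! Put n = M + k. The conditions gathered in `IsGeneral` suffice. At no point of F are the linear
parts dependent. At no point does the system of the smooth regularity condition, or that of (R⁺)
including `l`, have a non-zero zero on every hyperplane. The equations have no common zero on a
fixed coordinate subspace of projective dimension k - 1. Both systems consist of n - 1 equations, so
a hyperplane meeting their zero set only at the origin completes them to a system of parameters of
the local ring. That ring is Cohen–Macaulay, so the system is regular in every order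
(`makesRegularSequence_of_zeros`). The other two conditions make F smooth of the right dimension.
The affine cone is then smooth off its vertex and has depth at least two, so a connectedness
argument (`isPrime_of_connected`) gives irreducibility. The singular alternative in `Freg` never
occurs.

Each degeneration has to be confined to a hypersurface in the space of coefficients. If the
degenerate tuples were dense, a suitable quotient of the ring of functions on them would be an
algebraically closed field K in which the tautological tuple has independent coefficients
(`exists_generic_point`), and the degeneration would persist over K
(`exists_polynomial_of_transfer`). It remains to contradict the degeneration of one tuple with
independent coefficients, and dimension counts become counts of transcendence degree.

In the main count, a system with non-zero zeros on every hyperplane has a zero p not defined over K,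
the generic point of a projective variety of positive dimension (`exists_nonconstant_zero`). Let r
be the dimension of its linear span. A form of degree j vanishing at p satisfies at least jr + 1
conditions by Hopf's lemma (`finrank_add_finrank_le_finrank_mul`), unless adjoining its coefficients
lowers the transcendence degree of p, which happens at most r - 1 times (`exists_sublist_chain`).
Against this stand n parameters for the point of F and (r + 1)(n - r - 1) for the linear span of p.
With M ≥ 4k + 1 this excludes r ≤ M - 2 for the system of (R⁺) without `l`, and r = M - 1 for the
larger system. The independent linear equations give r ≤ M - 2 when `l` is present and r ≤ M - 1
otherwise, a contradiction in both cases. -/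

theorem finrank_map_mulLeft {E Ω : Type*} [Field E] [Field Ω] [Algebra E Ω] (A : Submodule E Ω)
    {c : Ω} (hc : c ≠ 0) :
    Module.finrank E (A.map (LinearMap.mulLeft E c)) = Module.finrank E A :=
  (Submodule.equivMapOfInjective _ (fun _ _ h => mul_left_cancel₀ hc h) A).finrank_eq.symm

/-- Hopf's lemma: in a field extension of an algebraically closed field the product of two
subspaces has dimension at least the sum of the dimensions minus one. -/
theorem finrank_add_finrank_le_finrank_mul {E Ω : Type*} [Field E] [IsAlgClosed E] [Field Ω]
    [Algebra E Ω] (A B : Submodule E Ω) [FiniteDimensional E A] [FiniteDimensional E B]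
    (hA : A ≠ ⊥) (hB : B ≠ ⊥) :
    Module.finrank E A + Module.finrank E B ≤ Module.finrank E (A * B : Submodule E Ω) + 1 := by
  induction hn : Module.finrank E A using Nat.strong_induction_on generalizing A B with
  | _ n ih =>
  subst hn
  have hfin : FiniteDimensional E (A * B : Submodule E Ω) :=
    Module.Finite.iff_fg.mpr ((Module.Finite.iff_fg.mp ‹FiniteDimensional E A›).mul
      (Module.Finite.iff_fg.mp ‹FiniteDimensional E B›))
  obtain ⟨a, haA, ha⟩ := Submodule.exists_mem_ne_zero_of_ne_bot hA
  obtain ⟨b₀, hb₀B, hb₀⟩ := Submodule.exists_mem_ne_zero_of_ne_bot hB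
  by_cases hst : ∀ b ∈ B, b ≠ 0 → A ≤ B.map (LinearMap.mulLeft E (a * b⁻¹))
  · -- every element of `a⁻¹ A` stabilises `B`, hence is a scalar
    have hscal : A ≤ Submodule.span E {a} := by
      intro x hx
      have hstab : ∀ b ∈ B, x * a⁻¹ * b ∈ B := by
        intro b hb
        rcases eq_or_ne b 0 with rfl | hb0
        · simp
        obtain ⟨y, hy, hxy⟩ := hst b hb hb0 hx
        rw [LinearMap.mulLeft_apply] at hxy
        have : x * a⁻¹ * b = y := by
          rw [← hxy]; field_simp
        rwa [this]
      let φ : Module.End E B := (LinearMap.mulLeft E (x * a⁻¹)).restrict hstab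
      have : Nontrivial B := Submodule.nontrivial_iff_ne_bot.mpr hB
      obtain ⟨c, hc⟩ := Module.End.exists_eigenvalue φ
      obtain ⟨v, hv⟩ := hc.exists_hasEigenvector
      have hv1 := congrArg Subtype.val hv.apply_eq_smul
      have hv0 : (v : Ω) ≠ 0 := fun h => hv.2 (Subtype.ext h)
      simp only [φ, Submodule.coe_smul, Algebra.smul_def] at hv1
      have hx' := mul_right_cancel₀ hv0 hv1
      refine Submodule.mem_span_singleton.mpr ⟨c, ?_⟩
      rw [Algebra.smul_def, ← hx']; field_simp
    have h1 : Module.finrank E A ≤ 1 :=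
      (Submodule.finrank_mono hscal).trans (finrank_span_singleton ha).le
    have h2 : B.map (LinearMap.mulLeft E a) ≤ A * B := by
      rintro _ ⟨b, hb, rfl⟩
      exact Submodule.mul_mem_mul haA hb
    have h3 := Submodule.finrank_mono h2
    rw [finrank_map_mulLeft B ha] at h3
    omega
  · push Not at hst
    obtain ⟨b, hb, hb0, hnle⟩ := hst
    -- Dyson's transform: passing from (A, B) to (A ∩ cB, A + cB) keeps the sum of the dimensions,
    -- and the new product lies in c·AB. The choice of c puts a into the intersection, which is
    -- still strictly smaller than A.
    set c := a * b⁻¹ with hc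
    have hc0 : c ≠ 0 := mul_ne_zero ha (inv_ne_zero hb0)
    set B' := B.map (LinearMap.mulLeft E c) with hB'
    have haB' : a ∈ B' := ⟨b, hb, by simp [hc, hb0]⟩
    have hlt : Module.finrank E (A ⊓ B' : Submodule E Ω) < Module.finrank E A :=
      Submodule.finrank_lt_finrank_of_lt (lt_of_le_of_ne inf_le_left fun h => hnle (inf_eq_left.mp h))
    have hne : A ⊓ B' ≠ ⊥ := fun h => ha ((Submodule.eq_bot_iff _).mp h a ⟨haA, haB'⟩)
    have hne' : A ⊔ B' ≠ ⊥ := fun h => hA (eq_bot_iff.mpr (h ▸ le_sup_left))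
    have key := ih _ hlt (A ⊓ B') (A ⊔ B') hne hne' rfl
    have hle : (A ⊓ B') * (A ⊔ B') ≤ (A * B).map (LinearMap.mulLeft E c) := by
      have hAB' : A * B' ≤ (A * B).map (LinearMap.mulLeft E c) := by
        rw [Submodule.mul_le]
        rintro x hx _ ⟨y, hy, rfl⟩
        exact ⟨x * y, Submodule.mul_mem_mul hx hy, by simp; ring⟩
      rw [Submodule.mul_sup]
      refine sup_le ?_ ((mul_le_mul' inf_le_left le_rfl).trans hAB')
      rw [mul_comm]
      exact (mul_le_mul' le_rfl inf_le_right).trans hAB'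
    have h1 := Submodule.finrank_mono hle
    rw [finrank_map_mulLeft _ hc0] at h1
    have h2 := Submodule.finrank_sup_add_finrank_inf_eq A B'
    rw [hB', finrank_map_mulLeft _ hc0, ← hB'] at h2
    omega

theorem finrank_pow_ge {E Ω : Type*} [Field E] [IsAlgClosed E] [Field Ω]
    [Algebra E Ω] (A : Submodule E Ω) [FiniteDimensional E A] {r : ℕ}
    (hA : r + 1 ≤ Module.finrank E A) (m : ℕ) :
    m * r + 1 ≤ Module.finrank E (A ^ m : Submodule E Ω) := by
  have hA0 : A ≠ ⊥ := by rintro rfl; simp at hA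
  obtain ⟨a, haA, ha⟩ := Submodule.exists_mem_ne_zero_of_ne_bot hA0
  induction m with
  | zero =>
    rw [pow_zero, Submodule.one_eq_span, finrank_span_singleton one_ne_zero]; simp
  | succ m ih =>
    have : FiniteDimensional E (A ^ m : Submodule E Ω) :=
      Module.Finite.iff_fg.mpr ((Module.Finite.iff_fg.mp ‹FiniteDimensional E A›).pow m)
    have hne : A ^ m ≠ ⊥ := fun h =>
      pow_ne_zero m ha ((Submodule.eq_bot_iff _).mp h _ (Submodule.pow_mem_pow A haA m))
    have := finrank_add_finrank_le_finrank_mul (A ^ m) A hne hA0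
    rw [pow_succ]
    linarith [this, ih, hA, (by ring : (m + 1) * r = m * r + r)]

/-! ### Linear disjointness over an algebraically closed field -/

/-- Nullstellensatz: in a Jacobson domain a non-zero element avoids some maximal ideal, and the
residue field there is finite over E, hence equal to E. -/
theorem exists_algHom_ne_zero {E A : Type*} [Field E] [IsAlgClosed E] [CommRing A] [IsDomain A]
    [Algebra E A] [Algebra.FiniteType E A] {a : A} (ha : a ≠ 0) : ∃ φ : A →ₐ[E] E, φ a ≠ 0 := by
  have hj : IsJacobsonRing A := isJacobsonRing_of_finiteType (A := E)
  have h0 : a ∉ (⊥ : Ideal A).jacobson := by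
    rw [← Ideal.radical_eq_jacobson, (Ideal.isPrime_bot).radical]; simpa using ha
  rw [Ideal.jacobson, Submodule.mem_sInf] at h0
  push Not at h0
  obtain ⟨m, ⟨-, hm⟩, ham⟩ := h0
  let : Field (A ⧸ m) := Ideal.Quotient.field m
  have : Algebra.FiniteType E (A ⧸ m) :=
    Algebra.FiniteType.of_surjective (Ideal.Quotient.mkₐ E m) Ideal.Quotient.mk_surjective
  have : Module.Finite E (A ⧸ m) := finite_of_finite_type_of_isJacobsonRing E (A ⧸ m)
  let e : (A ⧸ m) ≃ₐ[E] E :=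
    (AlgEquiv.ofBijective (Algebra.ofId E (A ⧸ m))
      IsAlgClosed.algebraMap_bijective_of_isIntegral).symm
  refine ⟨(e : (A ⧸ m) →ₐ[E] E).comp (Ideal.Quotient.mkₐ E m), fun h => ham ?_⟩
  have h' : e (Ideal.Quotient.mk m a) = 0 := h
  rwa [map_eq_zero_iff e e.injective, Ideal.Quotient.eq_zero_iff_mem] at h'

/-- A linear relation with coefficients in `A` between elements algebraic over `E(t)`, where `t` is
algebraically independent over `A`, can be specialised along any homomorphism `A → E`. -/
theorem sum_specialization_eq_zero {E A Ω τ ι : Type*} [Field E]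
    [CommRing A] [Field Ω] [Algebra E A] [Algebra A Ω] [Algebra E Ω] [IsScalarTower E A Ω]
    {t : τ → Ω} (htA : AlgebraicIndependent A t) (htE : AlgebraicIndependent E t) {w : ι → Ω}
    (hw : ∀ i, IsAlgebraic (Algebra.adjoin E (Set.range t)) (w i)) (φ : A →ₐ[E] E)
    (s : Finset ι) (c : ι → A) (hsum : ∑ i ∈ s, c i • w i = 0) : ∑ i ∈ s, φ (c i) • w i = 0 := by
  classical
  by_contra hne
  let algEA : Algebra (MvPolynomial τ E) (MvPolynomial τ A) :=
    (MvPolynomial.map (algebraMap E A)).toAlgebra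
  let algE : Algebra (MvPolynomial τ E) Ω := (aeval t : MvPolynomial τ E →ₐ[E] Ω).toRingHom.toAlgebra
  let algA : Algebra (MvPolynomial τ A) Ω :=
    (aeval t : MvPolynomial τ A →ₐ[A] Ω).toRingHom.toAlgebra
  have hmapE : ∀ p : MvPolynomial τ E, algebraMap (MvPolynomial τ E) Ω p = aeval t p := fun _ => rfl
  have hmapA : ∀ p : MvPolynomial τ A, algebraMap (MvPolynomial τ A) Ω p = aeval t p :=
    fun _ => rfl
  have htower : IsScalarTower (MvPolynomial τ E) (MvPolynomial τ A) Ω :=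
    IsScalarTower.of_algebraMap_eq fun p => (aeval_map_algebraMap A t p).symm
  have hw' : ∀ i, IsAlgebraic (MvPolynomial τ E) (w i) := fun i => by
    refine IsAlgebraic.of_ringHom_of_comp_eq htE.aevalEquiv.toAlgHom.toRingHom (RingHom.id Ω)
      (hw i) htE.aevalEquiv.surjective Function.injective_id ?_
    ext p <;> simp [hmapE]
  -- A common denominator Y makes every Y·wᵢ integral over E[t].
  choose y hy hyint using fun i => (hw' i).exists_integral_multiple
  let Y : MvPolynomial τ E := ∏ i ∈ s, y i
  have hY : Y ≠ 0 := Finset.prod_ne_zero_iff.mpr fun i _ => hy i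
  have hYint : ∀ i ∈ s, IsIntegral (MvPolynomial τ E) (aeval t Y * w i) := by
    intro i hi
    rw [← hmapE, ← Algebra.smul_def,
      show Y = (∏ j ∈ s.erase i, y j) * y i from (Finset.prod_erase_mul _ _ hi).symm, mul_smul]
    exact (hyint i).smul _
  have hYΩ : aeval t Y ≠ 0 := fun h => hY ((map_eq_zero_iff _ htE).mp h)
  -- The specialised sum times Y: supposed non-zero, and integral over E[t]. It will be shown to
  -- reduce to zero along `φ`.
  let z : Ω := ∑ i ∈ s, algebraMap E Ω (φ (c i)) * (aeval t Y * w i)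
  have hz : z ≠ 0 := by
    intro h
    have h1 : aeval t Y * ∑ i ∈ s, φ (c i) • w i = 0 := by
      rw [← h, Finset.mul_sum]
      refine Finset.sum_congr rfl fun i _ => ?_
      rw [Algebra.smul_def]; ring
    exact hne ((mul_eq_zero.mp h1).resolve_left hYΩ)
  have hzint : IsIntegral (MvPolynomial τ E) z := by
    refine IsIntegral.sum _ fun i hi => ?_
    have : algebraMap E Ω (φ (c i)) = algebraMap (MvPolynomial τ E) Ω (C (φ (c i))) := by
      rw [hmapE, aeval_C]
    rw [this]
    exact isIntegral_algebraMap.mul (hYint i hi)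
  let D := integralClosure (MvPolynomial τ A) Ω
  -- Modulo a prime Q over the kernel 𝔭 of A[t] → E[t], each cᵢ agrees with φ(cᵢ), so the given
  -- relation forces z ∈ Q.
  let 𝔭 : Ideal (MvPolynomial τ A) := RingHom.ker (MvPolynomial.map (φ : A →+* E))
  have h𝔭 : 𝔭.IsPrime := RingHom.ker_isPrime _
  have hbot : Ideal.comap (algebraMap (MvPolynomial τ A) D) ⊥ ≤ 𝔭 := by
    intro p hp
    have h1 : algebraMap (MvPolynomial τ A) D p = 0 := hp
    have h2 : aeval t p = 0 := congrArg Subtype.val h1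
    rw [(map_eq_zero_iff _ htA).mp h2]
    exact 𝔭.zero_mem
  obtain ⟨Q, -, hQ, hQ𝔭⟩ := Ideal.exists_ideal_over_prime_of_isIntegral 𝔭 (⊥ : Ideal D) hbot
  have hzD : IsIntegral (MvPolynomial τ A) z := hzint.tower_top
  have hzQ : (⟨z, hzD⟩ : D) ∈ Q := by
    have hzsum : z = ∑ i ∈ s, (algebraMap E Ω (φ (c i)) - algebraMap A Ω (c i)) *
        (aeval t Y * w i) := by
      have h0 : ∑ i ∈ s, algebraMap A Ω (c i) * (aeval t Y * w i) = 0 := by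
        have : ∑ i ∈ s, algebraMap A Ω (c i) * (aeval t Y * w i) =
            aeval t Y * ∑ i ∈ s, c i • w i := by
          rw [Finset.mul_sum]
          refine Finset.sum_congr rfl fun i _ => ?_
          rw [Algebra.smul_def (c i)]; ring
        rw [this, hsum, mul_zero]
      simp only [sub_mul, Finset.sum_sub_distrib, h0, sub_zero, z]
    have key : (⟨z, hzD⟩ : D) = ∑ i ∈ s.attach,
        algebraMap (MvPolynomial τ A) D (C (algebraMap E A (φ (c i)) - c i)) *
          ⟨aeval t Y * w i, (hYint i i.2).tower_top⟩ := by
      apply Subtype.ext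
      rw [show ((⟨z, hzD⟩ : D) : Ω) = z from rfl, hzsum, ← Finset.sum_attach]
      rw [AddSubmonoidClass.coe_finsetSum]
      refine Finset.sum_congr rfl fun i _ => ?_
      rw [MulMemClass.coe_mul]
      congr 1
      change _ = aeval t (C (algebraMap E A (φ (c i)) - c i))
      rw [aeval_C, map_sub, ← IsScalarTower.algebraMap_apply]
    rw [key]
    refine Q.sum_mem fun i _ => Q.mul_mem_right _ ?_
    rw [← Ideal.mem_comap, hQ𝔭, RingHom.mem_ker, map_C, map_sub]
    simp
  let DE := integralClosure (MvPolynomial τ E) Ω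
  -- Being integral and non-zero, z divides a non-zero e ∈ E[t]. Then e lies in 𝔭, although the
  -- reduction is the identity on E[t].
  obtain ⟨e, he, u, hu⟩ := (Algebra.IsAlgebraic.isAlgebraic (R := MvPolynomial τ E)
    (⟨z, hzint⟩ : DE)).exists_nonzero_dvd
      (mem_nonZeroDivisors_of_ne_zero fun h => hz (congrArg Subtype.val h))
  have hu' : aeval t e = z * u := congrArg Subtype.val hu
  have hue : algebraMap (MvPolynomial τ A) D (MvPolynomial.map (algebraMap E A) e) =
      (⟨z, hzD⟩ : D) * ⟨u, IsIntegral.tower_top u.2⟩ := by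
    apply Subtype.ext
    change aeval t (MvPolynomial.map (algebraMap E A) e) = z * u
    rw [aeval_map_algebraMap, hu']
  have hmem : MvPolynomial.map (algebraMap E A) e ∈ 𝔭 := by
    rw [← hQ𝔭, Ideal.mem_comap, hue]
    exact Q.mul_mem_right _ hzQ
  rw [RingHom.mem_ker, MvPolynomial.map_map] at hmem
  apply he
  rw [← hmem, show (φ : A →+* E).comp (algebraMap E A) = RingHom.id E from by ext; simp,
    MvPolynomial.map_id]

/-- Elements algebraic over `E(t)` that are linearly independent over the algebraically closed
field `E` stay so over any extension `E'` over which `t` is algebraically independent. -/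
theorem linearIndependent_of_algebraicIndependent {E E' Ω τ ι : Type*} [Field E] [IsAlgClosed E]
    [Field E'] [Field Ω] [Algebra E E'] [Algebra E' Ω] [Algebra E Ω] [IsScalarTower E E' Ω]
    {t : τ → Ω} (ht : AlgebraicIndependent E' t) {w : ι → Ω}
    (hw : ∀ i, IsAlgebraic (Algebra.adjoin E (Set.range t)) (w i))
    (hlin : LinearIndependent E w) : LinearIndependent E' w := by
  classical
  rw [linearIndependent_iff']
  intro s c hsum i₀ hi₀
  by_contra hne
  -- Only the finitely many coefficients matter. They generate a finitely generated domain, which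
  -- has an E-point where the chosen coefficient survives, and specialising there contradicts
  -- independence over E.
  let A' : Subalgebra E E' := Algebra.adjoin E (s.image c : Finset E')
  have hcA : ∀ i ∈ s, c i ∈ A' := fun i hi =>
    Algebra.subset_adjoin (Finset.mem_coe.mpr (Finset.mem_image_of_mem c hi))
  have : Algebra.FiniteType E A' :=
    (Subalgebra.fg_iff_finiteType _).mp (Subalgebra.fg_adjoin_finset _)
  let c' : ι → A' := fun i => if h : c i ∈ A' then ⟨c i, h⟩ else 0
  have hc' : ∀ i ∈ s, (c' i : E') = c i := fun i hi => by simp only [c', dif_pos (hcA i hi)]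
  obtain ⟨φ, hφ⟩ := exists_algHom_ne_zero (E := E) (A := A') (a := c' i₀)
    (fun h => hne (by rw [← hc' i₀ hi₀, h]; rfl))
  refine hφ (linearIndependent_iff'.mp hlin s _ (sum_specialization_eq_zero (A := A')
    (ht.restrictScalars (R := A') (K := E') Subtype.val_injective)
    (ht.restrictScalars (algebraMap E E').injective) hw φ s c' ?_) i₀ hi₀)
  rw [← hsum]
  refine Finset.sum_congr rfl fun i hi => ?_
  rw [← hc' i hi]
  rfl

/-! ### Transcendence ranks of finite sets -/

section Rank

variable (F : Type*) {Ω : Type*} [Field F] [Field Ω] [Algebra F Ω]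

/-- The elements of `Ω` algebraic over `F(S)`. -/
def acl (S : Set Ω) : IntermediateField F Ω :=
  (algebraicClosure (IntermediateField.adjoin F S) Ω).restrictScalars F

/-- The transcendence degree of `F(S)` over `F` for a finite set `S`. -/
noncomputable def trk (S : Set Ω) : ℕ := ((AlgebraicIndependent.matroid F Ω).eRk S).toNat

variable {F}

/-- Identifies `acl` with the closure operator of the algebraic independence matroid, so that rank
inequalities for matroids apply to transcendence degrees. -/
theorem mem_acl_iff {S : Set Ω} {x : Ω} :
    x ∈ acl F S ↔ x ∈ (AlgebraicIndependent.matroid F Ω).closure S := by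
  rw [AlgebraicIndependent.matroid_closure_eq, SetLike.mem_coe, Subalgebra.mem_algebraicClosure,
    ← IntermediateField.isAlgebraic_adjoin_iff]
  exact mem_algebraicClosure_iff

theorem coe_acl (S : Set Ω) :
    (acl F S : Set Ω) = (AlgebraicIndependent.matroid F Ω).closure S :=
  Set.ext fun _ => mem_acl_iff

theorem subset_acl (S : Set Ω) : S ⊆ acl F S := by
  rw [coe_acl]; exact Matroid.subset_closure _ _ (Set.subset_univ _)

theorem acl_mono {S T : Set Ω} (h : S ⊆ T) : acl F S ≤ acl F T := by
  rw [← SetLike.coe_subset_coe, coe_acl, coe_acl]; exact Matroid.closure_subset_closure _ h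

theorem acl_le_acl_of_subset {S T : Set Ω} (h : S ⊆ acl F T) : acl F S ≤ acl F T := by
  rw [← SetLike.coe_subset_coe, coe_acl, coe_acl]
  rw [coe_acl] at h
  exact Matroid.closure_subset_closure_of_subset_closure h

theorem mem_acl_of_isAlgebraic {S : Set Ω} {x : Ω} (h : IsAlgebraic (acl F S) x) : x ∈ acl F S := by
  have h' : IsAlgebraic (algebraicClosure (IntermediateField.adjoin F S) Ω) x := h
  exact mem_algebraicClosure_iff.mpr (h'.restrictScalars _)

theorem eRk_eq_trk {S : Set Ω} (hS : S.Finite) :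
    (AlgebraicIndependent.matroid F Ω).eRk S = trk F S := by
  rw [trk, ENat.natCast_toNat]
  exact ((Matroid.eRk_le_encard _ S).trans_lt hS.encard_lt_top).ne

theorem trk_le_of_subset_acl {S T : Set Ω} (hS : S.Finite) (hT : T.Finite) (h : S ⊆ acl F T) :
    trk F S ≤ trk F T := by
  rw [← Nat.cast_le (α := ℕ∞), ← eRk_eq_trk hS, ← eRk_eq_trk hT, ← Matroid.eRk_closure_eq _ T,
    ← coe_acl]
  exact Matroid.eRk_mono _ h

theorem trk_mono {S T : Set Ω} (hT : T.Finite) (h : S ⊆ T) : trk F S ≤ trk F T :=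
  trk_le_of_subset_acl (hT.subset h) hT (h.trans (subset_acl T))

theorem trk_union_le {S T : Set Ω} (hS : S.Finite) (hT : T.Finite) :
    trk F (S ∪ T) ≤ trk F S + T.ncard := by
  rw [← Nat.cast_le (α := ℕ∞), Nat.cast_add, ← eRk_eq_trk (hS.union hT), ← eRk_eq_trk hS,
    hT.cast_ncard_eq]
  exact Matroid.eRk_union_le_eRk_add_encard _ S T

/-- Subtraction-free form of the principle that the transcendence degree of T over a base can only
drop when the base grows. -/
theorem trk_submodular {S S' T : Set Ω} (h : S ⊆ S') (hS' : S'.Finite) (hT : T.Finite) :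
    trk F (S' ∪ T) + trk F S ≤ trk F S' + trk F (S ∪ T) := by
  have hST : (S ∪ T).Finite := (hS'.subset h).union hT
  rw [← Nat.cast_le (α := ℕ∞), Nat.cast_add, Nat.cast_add, ← eRk_eq_trk (hS'.union hT),
    ← eRk_eq_trk (hS'.subset h), ← eRk_eq_trk hS', ← eRk_eq_trk hST, add_comm]
  have h1 := Matroid.eRk_inter_add_eRk_union_le (AlgebraicIndependent.matroid F Ω) S' (S ∪ T)
  have h2 : S' ∪ (S ∪ T) = S' ∪ T := by rw [← Set.union_assoc, Set.union_eq_left.mpr h]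
  rw [h2] at h1
  exact (add_le_add_left (Matroid.eRk_mono _ (Set.subset_inter h Set.subset_union_left)) _).trans h1

theorem trk_insert_of_notMem {S : Set Ω} (hS : S.Finite) {x : Ω} (hx : x ∉ acl F S) :
    trk F (insert x S) = trk F S + 1 := by
  have := Matroid.eRk_insert_eq_add_one (M := AlgebraicIndependent.matroid F Ω) (X := S) (e := x)
    ⟨Set.mem_univ _, by rwa [← mem_acl_iff]⟩
  rw [eRk_eq_trk hS, eRk_eq_trk (hS.insert x)] at this
  exact_mod_cast this

theorem trk_range_of_algebraicIndependent {ι : Type*} [Fintype ι] {v : ι → Ω}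
    (hv : AlgebraicIndependent F v) : trk F (Set.range v) = Fintype.card ι := by
  have h : (AlgebraicIndependent.matroid F Ω).Indep (Set.range v) :=
    AlgebraicIndependent.matroid_indep_iff.mpr hv.to_subtype_range
  rw [trk, h.eRk_eq_encard, ← (Set.finite_range v).cast_ncard_eq, ENat.toNat_natCast,
    ← Nat.card_coe_set_eq, Nat.card_range_of_injective hv.injective, Nat.card_eq_fintype_card]

theorem trk_range_le {ι : Type*} [Fintype ι] (v : ι → Ω) :
    trk F (Set.range v) ≤ Fintype.card ι := by
  have h := trk_union_le (F := F) (S := ∅) Set.finite_empty (Set.finite_range v)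
  have h0 : trk F (∅ : Set Ω) = 0 := by simp [trk]
  rw [Set.empty_union, h0, zero_add] at h
  exact h.trans ((Nat.card_coe_set_eq _ ▸ Finite.card_range_le v).trans Nat.card_eq_fintype_card.le)

theorem trk_union_range_le {ι : Type*} [Fintype ι] {S : Set Ω} (hS : S.Finite) (v : ι → Ω) :
    trk F (S ∪ Set.range v) ≤ trk F S + Fintype.card ι :=
  (trk_union_le hS (Set.finite_range v)).trans (Nat.add_le_add_left
    ((Nat.card_coe_set_eq _ ▸ Finite.card_range_le v).trans Nat.card_eq_fintype_card.le) _)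

theorem acl_le_of_isAlgClosed {K : IntermediateField F Ω} [IsAlgClosed K] {S : Set Ω}
    (hS : S ⊆ K) : acl F S ≤ K := by
  intro x hx
  have h1 : IsAlgebraic (IntermediateField.adjoin F S) x := mem_algebraicClosure_iff.mp hx
  have hle : IntermediateField.adjoin F S ≤ K := IntermediateField.adjoin_le_iff.mpr hS
  have h2 : IsIntegral K x := (h1.ringHom_of_comp_eq
    (IntermediateField.inclusion hle : _ →+* K) (RingHom.id Ω)
    (RingHom.injective _) rfl).isIntegral
  have h3 := IsAlgClosed.degree_eq_one_of_irreducible K (minpoly.irreducible h2)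
  obtain ⟨y, hy⟩ := minpoly.mem_range_of_degree_eq_one K x h3
  rw [← hy]
  exact y.2

/-- `acl` is only a relative closure in Ω, and Ω need not be algebraically closed. The roots are
found in K and are then algebraic over S. -/
theorem isAlgClosed_acl {K : IntermediateField F Ω} [IsAlgClosed K] {S : Set Ω}
    (hS : S ⊆ K) : IsAlgClosed (acl F S) := by
  refine IsAlgClosed.of_exists_root _ fun p hp hirr => ?_
  have hle : acl F S ≤ K := acl_le_of_isAlgClosed hS
  let i : acl F S →+* K := (IntermediateField.inclusion hle : _ →+* K)
  obtain ⟨x, hx⟩ := IsAlgClosed.exists_eval₂_eq_zero i p hirr.degree_pos.ne'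
  have hx' : Polynomial.aeval (algebraMap K Ω x) p = 0 := by
    have h1 := Polynomial.hom_eval₂ p i (algebraMap K Ω) x
    rw [hx, map_zero] at h1
    exact h1.symm
  have hmem : algebraMap K Ω x ∈ acl F S := mem_acl_of_isAlgebraic ⟨p, hp.ne_zero, hx'⟩
  refine ⟨⟨_, hmem⟩, ?_⟩
  apply Subtype.val_injective
  have h2 := Polynomial.aeval_algebraMap_apply (A := acl F S) Ω (⟨_, hmem⟩ : acl F S) p
  rw [Polynomial.coe_aeval_eq_eval] at h2
  exact h2.symm.trans hx'

/-- A relation `∑ vᵢ wᵢ = 0` imposes as many conditions on the `vᵢ` as there are linearly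
independent elements among the `wᵢ`. -/
theorem trk_union_range_add_card_le {S : Set Ω} (hS : S.Finite) {E' : IntermediateField F Ω}
    (hE : acl F S ≤ E') {ι κ : Type*} [Fintype ι] [Fintype κ] {v w : ι → Ω} (hv : ∀ i, v i ∈ E')
    {e : κ → ι} (he : Function.Injective e) (hlin : LinearIndependent E' (w ∘ e))
    (hspan : ∀ i, w i ∈ Submodule.span (acl F S) (Set.range (w ∘ e)))
    (hsum : ∑ i, v i * w i = 0) :
    trk F (S ∪ Set.range v) + Fintype.card κ ≤ trk F S + Fintype.card ι := by
  classical
  choose c hc using fun i => (Submodule.mem_span_range_iff_exists_fun _).mp (hspan i)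
  have hc1 : ∀ i, w i = ∑ s, (c i s : Ω) * w (e s) := fun i => by
    rw [← hc i]; rfl
  -- Coordinates in the basis `w ∘ e` are unique, so a basis element has the obvious ones.
  have hunit : ∀ s s', c (e s) s' = if s' = s then 1 else 0 := by
    intro s s'
    let x : κ → E' := fun s' => ⟨c (e s) s', hE (c (e s) s').2⟩ - if s' = s then 1 else 0
    have hx : ∑ s', x s' • (w ∘ e) s' = 0 := by
      have : ∀ s', x s' • (w ∘ e) s' = c (e s) s' * w (e s') - if s' = s then w (e s') else 0 := by
        intro s'
        rw [Algebra.smul_def]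
        simp only [x, map_sub, sub_mul, Function.comp]
        congr 1
        split_ifs <;> simp
      simp only [this, Finset.sum_sub_distrib, ← hc1, Finset.sum_ite_eq', Finset.mem_univ, if_true,
        sub_self]
    have h0 := Fintype.linearIndependent_iff.mp hlin x hx s'
    have h1 := congrArg (Subtype.val) (sub_eq_zero.mp h0)
    apply Subtype.val_injective
    refine h1.trans ?_
    split_ifs <;> rfl
  -- Expanding the relation in the basis splits it, by independence over E', into one linear
  -- relation on v for each basis element, with coefficients algebraic over S.
  have hrel : ∀ s, ∑ i, (c i s : Ω) * v i = 0 := by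
    intro s
    let x : κ → E' := fun s => ∑ i, ⟨c i s, hE (c i s).2⟩ * ⟨v i, hv i⟩
    have hxv : ∀ s, (x s : Ω) = ∑ i, (c i s : Ω) * v i := fun s => by
      simp [x]
    have hx : ∑ s, x s • (w ∘ e) s = 0 := by
      rw [← hsum]
      have : ∀ s, x s • (w ∘ e) s = ∑ i, v i * ((c i s : Ω) * w (e s)) := by
        intro s
        rw [Algebra.smul_def, show algebraMap E' Ω (x s) = (x s : Ω) from rfl, hxv, Finset.sum_mul]
        exact Finset.sum_congr rfl fun i _ => by simp only [Function.comp]; ring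
      rw [Finset.sum_congr rfl fun s _ => this s, Finset.sum_comm]
      exact Finset.sum_congr rfl fun i _ => by rw [← Finset.mul_sum, ← hc1]
    rw [← hxv, Fintype.linearIndependent_iff.mp hlin x hx s]
    rfl
  -- By `hunit` the relation for s contains v (e s) with coefficient 1 and no other v (e s'). Hence
  -- all of v is algebraic over S and the entries with index outside the image of e.
  let T : Finset ι := Finset.univ \ Finset.univ.image e
  have hsub : S ∪ Set.range v ⊆ acl F (S ∪ v '' T) := by
    have hT : ∀ i ∈ T, v i ∈ acl F (S ∪ v '' T) := fun i hi =>
      subset_acl _ (Or.inr ⟨i, hi, rfl⟩)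
    rintro x (hx | ⟨i, rfl⟩)
    · exact subset_acl _ (Or.inl hx)
    by_cases hi : i ∈ T
    · exact hT i hi
    · have : i ∈ Finset.univ.image e := by
        by_contra h; exact hi (Finset.mem_sdiff.mpr ⟨Finset.mem_univ _, h⟩)
      obtain ⟨s, -, rfl⟩ := Finset.mem_image.mp this
      have h1 := hrel s
      rw [← Finset.sum_sdiff (Finset.subset_univ (Finset.univ.image e)),
        Finset.sum_image (fun _ _ _ _ h => he h)] at h1
      have h2 : ∑ s', (c (e s') s : Ω) * v (e s') = v (e s) := by
        rw [Finset.sum_eq_single s]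
        · simp [hunit]
        · intro s' _ hne; simp [hunit, hne.symm]
        · simp
      rw [h2] at h1
      rw [eq_neg_of_add_eq_zero_right h1]
      refine neg_mem (sum_mem fun i hi => mul_mem ?_ (hT i hi))
      exact acl_mono Set.subset_union_left (c i s).2
  have hTcard : T.card + Fintype.card κ = Fintype.card ι := by
    have := Finset.card_image_of_injective Finset.univ he
    rw [Finset.card_univ] at this
    rw [← this, Finset.card_sdiff_add_card_eq_card (Finset.subset_univ _), Finset.card_univ]
  have h1 : trk F (S ∪ v '' T) ≤ trk F S + T.card := by
    refine (trk_union_le hS (T.finite_toSet.image v)).trans (Nat.add_le_add_left ?_ _)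
    exact (Set.ncard_image_le T.finite_toSet).trans (Set.ncard_coe_finset T).le
  have h2 := trk_le_of_subset_acl (hS.union (Set.finite_range v))
    (hS.union (T.finite_toSet.image v)) hsub
  omega

theorem algebraicIndependent_acl {S : Set Ω} {ι : Type*} {x : ι → Ω}
    (h : AlgebraicIndependent (Algebra.adjoin F S) x) : AlgebraicIndependent (acl F S) x :=
  (IntermediateField.algebraicIndependent_adjoin_iff.mpr h).algebraicClosure

attribute [irreducible] acl

/-- If a finite set `P` has the same transcendence degree over `S` and over `S ∪ V`, then there is
`J ⊆ P` algebraically independent over `acl (S ∪ V)` such that `P` is algebraic over `S ∪ J`. -/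
theorem exists_algebraicIndependent_of_free {S V P : Set Ω} (hS : S.Finite) (hV : V.Finite)
    (hP : P.Finite) (hfree : trk F (S ∪ V) + trk F (S ∪ P) ≤ trk F (S ∪ V ∪ P) + trk F S) :
    ∃ J ⊆ P, AlgebraicIndependent (acl F (S ∪ V)) ((↑) : J → Ω) ∧ P ⊆ acl F (S ∪ J) := by
  set M := AlgebraicIndependent.matroid F Ω with hM
  -- J is what extends a matroid basis of S ∪ V to one of S ∪ V ∪ P. Freeness says that J already
  -- accounts for the whole degree of P over S.
  obtain ⟨I, hI⟩ := M.exists_isBasis (S ∪ V)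
  obtain ⟨B, hB, hIB⟩ := hI.indep.subset_isBasis_of_subset
    (hI.subset.trans (Set.subset_union_left (t := P)))
  set J := B \ I with hJ
  have hBJ : B = I ∪ J := (Set.union_sdiff_cancel hIB).symm
  have hIS : I ⊆ acl F (S ∪ V) := hI.subset.trans (subset_acl _)
  have hJP : J ⊆ P := by
    rintro x ⟨hxB, hxI⟩
    rcases hB.subset hxB with hx | hx
    · exfalso
      have h1 : x ∈ M.closure I := by rw [hI.closure_eq_closure]; exact M.subset_closure _ (Set.subset_univ _) hx
      exact hI.indep.notMem_closure_iff (Set.mem_univ x) |>.mpr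
        ⟨hB.indep.subset (Set.insert_subset hxB hIB), hxI⟩ h1
    · exact hx
  have hJfin : J.Finite := hP.subset hJP
  have hIfin : I.Finite := (hS.union hV).subset hI.subset
  have hcard : trk F (S ∪ V ∪ P) = trk F (S ∪ V) + J.ncard := by
    rw [← Nat.cast_inj (R := ℕ∞), Nat.cast_add, ← eRk_eq_trk ((hS.union hV).union hP),
      ← eRk_eq_trk (hS.union hV), hJfin.cast_ncard_eq, ← hM, ← hB.encard_eq_eRk,
      ← hI.encard_eq_eRk, hBJ, Set.encard_union_eq Set.disjoint_sdiff_right]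
  refine ⟨J, hJP, ?_, ?_⟩
  · have h1 : AlgebraicIndependent F ((↑) : B → Ω) := hB.indep
    have h2 : AlgebraicIndependent (Algebra.adjoin F I) ((↑) : J → Ω) := by
      have h3 : AlgebraicIndependent F (Sum.elim ((↑) : J → Ω) ((↑) : I → Ω)) := by
        have := h1.comp (Sum.elim (fun x : J => (⟨x, x.2.1⟩ : B)) (fun x : I => (⟨x, hIB x.2⟩ : B)))
          (Function.Injective.sumElim (fun x y h => Subtype.ext (congrArg (fun z : B => (z : Ω)) h))
            (fun x y h => Subtype.ext (congrArg (fun z : B => (z : Ω)) h))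
            (fun x y h => x.2.2 (by
              have := congrArg (fun z : B => (z : Ω)) h
              simp only at this
              rw [this]; exact y.2)))
        convert this using 1
        ext (x | x) <;> rfl
      have h4 := (AlgebraicIndependent.sumElim_iff.mp h3).2
      rwa [Subtype.range_coe] at h4
    have h5 := algebraicIndependent_acl h2
    have h6 : acl F I = acl F (S ∪ V) := by
      apply SetLike.coe_injective
      rw [coe_acl, coe_acl, ← hM, hI.closure_eq_closure]
    rwa [h6] at h5
  · have hSJ : trk F (S ∪ J) = trk F S + J.ncard := by
      refine le_antisymm (trk_union_le hS hJfin) ?_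
      have h1 := trk_submodular (F := F) (T := J) (Set.subset_union_left (s := S) (t := V))
        (hS.union hV) hJfin
      have h2 : trk F (S ∪ V ∪ P) ≤ trk F (S ∪ V ∪ J) := by
        refine trk_le_of_subset_acl ((hS.union hV).union hP) ((hS.union hV).union hJfin) ?_
        rw [coe_acl, ← hM]
        have h3 : S ∪ V ∪ P ⊆ M.closure B := hB.subset_closure
        refine h3.trans (M.closure_subset_closure ?_)
        rw [hBJ]
        exact Set.union_subset_union_left _ hI.subset
      omega
    have h4 : M.closure (S ∪ J) = M.closure (S ∪ P) := by
      refine Matroid.IsRkFinite.closure_eq_closure_of_subset_of_eRk_ge_eRk ?_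
        (Set.union_subset_union_right _ hJP) ?_
      · exact Matroid.isRkFinite_of_finite _ (hS.union hJfin)
      · rw [hM, eRk_eq_trk (hS.union hJfin), eRk_eq_trk (hS.union hP), Nat.cast_le]
        omega
    rw [coe_acl, ← hM, h4]
    exact Set.subset_union_right.trans (M.subset_closure _ (Set.subset_univ _))

theorem isAlgebraic_adjoin_of_mem_acl {E : IntermediateField F Ω} {S J : Set Ω}
    (hS : S ⊆ E) {x : Ω} (hx : x ∈ acl F (S ∪ J)) : IsAlgebraic (Algebra.adjoin E J) x := by
  have h2 : IsAlgebraic (Algebra.adjoin F (S ∪ J)) x := by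
    rwa [mem_acl_iff, AlgebraicIndependent.matroid_closure_eq] at hx
  have h3 : Algebra.adjoin F (S ∪ J) ≤ (Algebra.adjoin E J).restrictScalars F := by
    refine Algebra.adjoin_le ?_
    rintro x (hx | hx)
    · have h := Subalgebra.algebraMap_mem (Algebra.adjoin E J) (⟨x, hS hx⟩ : E)
      exact h
    · exact (Algebra.subset_adjoin hx : x ∈ Algebra.adjoin E J)
  let f : Algebra.adjoin F (S ∪ J) →+* Algebra.adjoin E J :=
    (algebraMap (Algebra.adjoin F (S ∪ J)) Ω).codRestrict (Algebra.adjoin E J) fun y => h3 y.2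
  refine h2.ringHom_of_comp_eq f (RingHom.id Ω) (fun a b h => ?_) rfl
  exact Subtype.ext (congrArg (fun z : Algebra.adjoin E J => (z : Ω)) h)

theorem linearIndependent_of_le {E E' : IntermediateField F Ω} [IsAlgClosed E] (hle : E ≤ E')
    {J : Set Ω} (hJ : AlgebraicIndependent E' ((↑) : J → Ω)) {κ : Type*} {w : κ → Ω}
    (hw : ∀ i, IsAlgebraic (Algebra.adjoin E J) (w i)) (hlin : LinearIndependent E w) :
    LinearIndependent E' w := by
  let : Algebra E E' := (IntermediateField.inclusion hle).toAlgebra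
  have : IsScalarTower E E' Ω := IsScalarTower.of_algebraMap_eq fun _ => rfl
  refine linearIndependent_of_algebraicIndependent (E := E) (t := ((↑) : J → Ω)) hJ ?_ hlin
  rwa [Subtype.range_coe]

/-- If `P` has the same transcendence degree over `S` as over `S ∪ {vᵢ}`, a relation
`∑ vᵢ wᵢ = 0` with `wᵢ` algebraic over `S ∪ P` imposes on the `vᵢ` as many conditions as the
dimension of the space spanned by the `wᵢ` over the algebraic closure of `S`. -/
theorem trk_union_range_add_finrank_le {S P : Set Ω} (hS : S.Finite) (hP : P.Finite)
    [IsAlgClosed (acl F S)] {ι : Type*} [Fintype ι] {v w : ι → Ω}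
    (hw : ∀ i, w i ∈ acl F (S ∪ P)) (hsum : ∑ i, v i * w i = 0)
    (hfree : trk F (S ∪ Set.range v) + trk F (S ∪ P) ≤ trk F (S ∪ Set.range v ∪ P) + trk F S) :
    trk F (S ∪ Set.range v) + Module.finrank (acl F S) (Submodule.span (acl F S) (Set.range w)) ≤
      trk F S + Fintype.card ι := by
  classical
  obtain ⟨J, hJP, hJ, hPJ⟩ := exists_algebraicIndependent_of_free hS (Set.finite_range v) hP hfree
  obtain ⟨κ, e, he, hspan, hlin⟩ := exists_linearIndependent' (acl F S) w
  have : Finite κ := Finite.of_injective e he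
  have : Fintype κ := Fintype.ofFinite κ
  have hcard : Module.finrank (acl F S) (Submodule.span (acl F S) (Set.range w)) =
      Fintype.card κ := by
    rw [← hspan, finrank_span_eq_card hlin]
  have hle : acl F S ≤ acl F (S ∪ Set.range v) := acl_mono Set.subset_union_left
  rw [hcard]
  refine trk_union_range_add_card_le hS hle
    (fun i => subset_acl _ (Or.inr ⟨i, rfl⟩)) he ?_ ?_ hsum
  · refine linearIndependent_of_le hle hJ (fun s => ?_) hlin
    have h1 : w (e s) ∈ acl F (S ∪ J) :=
      acl_le_acl_of_subset (Set.union_subset (Set.subset_union_left.trans (subset_acl _)) hPJ)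
        (hw (e s))
    exact isAlgebraic_adjoin_of_mem_acl (subset_acl S) h1
  · intro i
    rw [hspan]
    exact Submodule.subset_span ⟨i, rfl⟩

end Rank

/-! ### Monomials of a given degree -/

/-- Exponents of the monomials of degree `j`. -/
abbrev Mon (σ : Type*) (j : ℕ) : Type _ := {m : σ →₀ ℕ // m.degree = j}

section Mon

variable {σ : Type*}

instance [Finite σ] (j : ℕ) : Finite (Mon σ j) := by
  have := Fintype.ofFinite σ
  exact (Finsupp.finite_of_degree_le (σ := σ) j).subset (fun m hm => le_of_eq hm)

noncomputable instance [Finite σ] (j : ℕ) : Fintype (Mon σ j) := Fintype.ofFinite _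

theorem card_mon [Fintype σ] (j : ℕ) :
    Fintype.card (Mon σ j) = (Fintype.card σ).multichoose j := by
  classical
  rw [← Sym.card_sym_eq_multichoose]
  refine (Fintype.card_congr ((Sym.equivNatSum σ j).trans (Equiv.subtypeEquivRight fun m => ?_))).symm
  rw [Finsupp.degree_eq_sum, Finsupp.sum_fintype _ _ fun _ => rfl]
  rfl

/-- The value of a monomial. -/
def monVal {R : Type*} [CommSemiring R] (p : σ → R) (m : σ →₀ ℕ) : R := m.prod fun i a => p i ^ a

theorem eval_eq_sum_mon {R : Type*} [CommSemiring R] [Finite σ] {q : MvPolynomial σ R} {j : ℕ}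
    (hq : q.IsHomogeneous j) (p : σ → R) :
    eval p q = ∑ m : Mon σ j, coeff m.1 q * monVal p m.1 := by
  classical
  have h1 : ∑ m : Mon σ j, coeff m.1 q * monVal p m.1 =
      ∑ m ∈ Finset.univ.map (Function.Embedding.subtype fun m : σ →₀ ℕ => m.degree = j),
        coeff m q * monVal p m := by
    rw [Finset.sum_map]; rfl
  rw [h1, eval_eq]
  refine Finset.sum_subset (fun m hm => ?_) fun m _ hm => ?_
  · refine Finset.mem_map.mpr ⟨⟨m, ?_⟩, Finset.mem_univ _, rfl⟩
    rw [Finsupp.degree_eq_weight_one]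
    exact hq (mem_support_iff.mp hm)
  · rw [notMem_support_iff.mp hm, zero_mul]

theorem card_le_finrank_of_mem {E V ι : Type*} [Field E] [AddCommGroup V] [Module E V] [Fintype ι]
    {W : Submodule E V} [FiniteDimensional E W] {w : ι → V} (hlin : LinearIndependent E w)
    (hmem : ∀ i, w i ∈ W) : Fintype.card ι ≤ Module.finrank E W :=
  LinearIndependent.fintype_card_le_finrank (b := fun i => (⟨w i, hmem i⟩ : W))
    (LinearIndependent.of_comp W.subtype hlin)

variable {E Ω : Type*} [Field E] [Field Ω] [Algebra E Ω]

theorem span_pow_le_span_monVal (p : σ → Ω) (j : ℕ) :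
    (Submodule.span E (Set.range p)) ^ j ≤
      Submodule.span E (Set.range fun m : Mon σ j => monVal p m.1) := by
  induction j with
  | zero =>
    rw [pow_zero, Submodule.one_eq_span, Submodule.span_singleton_le_iff_mem]
    exact Submodule.subset_span ⟨⟨0, by simp⟩, by simp [monVal]⟩
  | succ j ih =>
    rw [pow_succ]
    refine (mul_le_mul' ih le_rfl).trans ?_
    rw [Submodule.span_mul_span, Submodule.span_le]
    rintro _ ⟨_, ⟨m, rfl⟩, _, ⟨i, rfl⟩, rfl⟩
    refine Submodule.subset_span ⟨⟨m.1 + Finsupp.single i 1, ?_⟩, ?_⟩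
    · rw [map_add, m.2, Finsupp.degree_single]
    · classical
      simp only [monVal]
      rw [Finsupp.prod_add_index' (by simp) (by intros; rw [pow_add]),
        Finsupp.prod_single_index (by simp), pow_one]

/-- Iterated Hopf bound. Geometrically, forms of degree j restricted to a variety spanning a
projective space of dimension r form a space of dimension at least jr + 1. -/
theorem finrank_span_monVal_ge [Finite σ] [IsAlgClosed E] (p : σ → Ω) {r : ℕ}
    (hr : r + 1 ≤ Module.finrank E (Submodule.span E (Set.range p))) (j : ℕ) :
    j * r + 1 ≤
      Module.finrank E (Submodule.span E (Set.range fun m : Mon σ j => monVal p m.1)) := by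
  have : FiniteDimensional E (Submodule.span E (Set.range p)) :=
    FiniteDimensional.span_of_finite E (Set.finite_range p)
  have : FiniteDimensional E (Submodule.span E (Set.range fun m : Mon σ j => monVal p m.1)) :=
    FiniteDimensional.span_of_finite E (Set.finite_range _)
  exact (finrank_pow_ge _ hr j).trans (Submodule.finrank_mono (span_pow_le_span_monVal p j))

/-- If `1` and the algebraically independent `x a` are among the `p i`, the quadratic monomials in
`p` span a space of dimension at least the number of monomials of degree two in `b + 1` variables. -/
theorem finrank_span_monVal_two_ge [Finite σ] (p : σ → Ω) {J : Type*} [Fintype J] {x : J → Ω}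
    (hx : AlgebraicIndependent E x) {i₀ : σ} (h0 : p i₀ = 1) {g : J → σ} (hg : ∀ a, p (g a) = x a) :
    (Fintype.card J + 2).choose 2 ≤
      Module.finrank E (Submodule.span E (Set.range fun m : Mon σ 2 => monVal p m.1)) := by
  classical
  have : FiniteDimensional E (Submodule.span E (Set.range fun m : Mon σ 2 => monVal p m.1)) :=
    FiniteDimensional.span_of_finite E (Set.finite_range _)
  have hlin : LinearIndependent E fun m : J →₀ ℕ => monVal x m := by
    have h1 := (MvPolynomial.basisMonomials J E).linearIndependent.map' (aeval x).toLinearMap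
      (LinearMap.ker_eq_bot.mpr hx)
    have h2 : ⇑(aeval x).toLinearMap ∘ ⇑(basisMonomials J E) = fun m : J →₀ ℕ => monVal x m := by
      funext m; simp [monVal, aeval_monomial]
    rwa [h2] at h1
  -- Dehomogenisation: the exponent of the extra variable, which stands for the coordinate 1, is
  -- recovered from the total degree.
  let f : Mon (Option J) 2 → (J →₀ ℕ) := fun m => m.1.some
  have hf : Function.Injective f := by
    intro m m' h
    apply Subtype.ext
    have hs : ∀ a, m.1 (Option.some a) = m'.1 (Option.some a) := fun a => DFunLike.congr_fun h a
    have h1 := m.2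
    have h2 := m'.2
    rw [Finsupp.degree_eq_sum, Fintype.sum_option] at h1 h2
    ext a
    cases a with
    | none => 
      have : ∑ i, m.1 (Option.some i) = ∑ i, m'.1 (Option.some i) := Finset.sum_congr rfl fun i _ => hs i
      omega
    | some a => exact hs a
  have hlin2 := hlin.comp f hf
  let G : Option J → σ := fun a => a.elim i₀ g
  have hmem : ∀ m : Mon (Option J) 2, monVal x (f m) ∈
      Submodule.span E (Set.range fun m : Mon σ 2 => monVal p m.1) := by
    intro m
    refine Submodule.subset_span ⟨⟨m.1.mapDomain G, ?_⟩, ?_⟩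
    · rw [Finsupp.degree_mapDomain, m.2]
    · simp only [monVal]
      rw [Finsupp.prod_mapDomain_index (by simp) (by intros; rw [pow_add]),
        Finsupp.prod_fintype _ _ (by simp), Finsupp.prod_fintype _ _ (by simp), Fintype.prod_option]
      simp [G, h0, hg, f]
  refine le_trans (le_of_eq ?_) (card_le_finrank_of_mem hlin2 hmem)
  rw [card_mon, Fintype.card_option, Nat.multichoose_eq]
  rfl

end Mon

/-! ### Adding blocks of coefficients one by one -/

section Entries

variable {Ω σ : Type*}

/-- The set of all entries of a list of coefficient families. -/
def entries (L : List (Σ j : ℕ, Mon σ j → Ω)) : Set Ω := {x | ∃ B ∈ L, x ∈ Set.range B.2}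

theorem entries_cons (B : Σ j : ℕ, Mon σ j → Ω) (L : List (Σ j : ℕ, Mon σ j → Ω)) :
    entries (B :: L) = Set.range B.2 ∪ entries L := by
  ext x; simp [entries]

theorem entries_append (L L' : List (Σ j : ℕ, Mon σ j → Ω)) :
    entries (L ++ L') = entries L ∪ entries L' := by
  induction L with
  | nil => simp [entries]
  | cons B L ih => rw [List.cons_append, entries_cons, ih, entries_cons, Set.union_assoc]

theorem entries_finite [Finite σ] (L : List (Σ j : ℕ, Mon σ j → Ω)) : (entries L).Finite := by
  induction L with
  | nil => simp [entries]
  | cons B L ih => rw [entries_cons]; exact (Set.finite_range _).union ih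

end Entries

section Chain

variable {F Ω : Type*} [Field F] [Field Ω] [Algebra F Ω] {σ : Type*} [Finite σ]

theorem trk_union_entries_le {S : Set Ω} (hS : S.Finite) (L : List (Σ j : ℕ, Mon σ j → Ω)) :
    trk F (S ∪ entries L) ≤ trk F S + (L.map fun B => Fintype.card (Mon σ B.1)).sum := by
  induction L generalizing S with
  | nil => simp [entries]
  | cons B L ih =>
    have h1 := ih (hS.union (Set.finite_range B.2))
    have h2 := trk_union_range_le (F := F) hS B.2
    rw [entries_cons, ← Set.union_assoc, List.map_cons, List.sum_cons]
    omega

/-- Adding families of coefficients of forms that vanish at `p`: whenever the transcendence degree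
of `p` does not drop, the form satisfies as many conditions as there are linearly independent
monomials in `p`. -/
theorem exists_sublist_chain {K : IntermediateField F Ω} [IsAlgClosed K] (p : σ → Ω) (c : ℕ → ℕ)
    (L : List (Σ j : ℕ, Mon σ j → Ω)) {S : Set Ω} (hS : S.Finite) (hSK : S ⊆ K)
    (hLK : entries L ⊆ K) (hrel : ∀ B ∈ L, ∑ m, B.2 m * monVal p m.1 = 0)
    (hc : ∀ B ∈ L, ∀ T : Set Ω, S ⊆ T → T ⊆ S ∪ entries L →
      c B.1 ≤ Module.finrank (acl F T)
        (Submodule.span (acl F T) (Set.range fun m : Mon σ B.1 => monVal p m.1))) :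
    ∃ N : List (Σ j : ℕ, Mon σ j → Ω), N.Sublist L ∧
      L.length + trk F (S ∪ entries L ∪ Set.range p) + trk F S ≤
        N.length + trk F (S ∪ Set.range p) + trk F (S ∪ entries L) ∧
      trk F (S ∪ entries L) + (N.map fun B => c B.1).sum ≤
        trk F S + (L.map fun B => Fintype.card (Mon σ B.1)).sum := by
  induction L generalizing S with
  | nil => exact ⟨[], List.Sublist.slnil, by simp [entries], by simp [entries]⟩
  | cons B L ih =>
    have hP : (Set.range p).Finite := Set.finite_range p
    rw [entries_cons] at hLK hc
    have hS' : (S ∪ Set.range B.2).Finite := hS.union (Set.finite_range _)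
    obtain ⟨N, hN, h1, h2⟩ := ih hS' (Set.union_subset hSK (Set.subset_union_left.trans hLK))
      (Set.subset_union_right.trans hLK) (fun B' hB' => hrel B' (List.mem_cons_of_mem _ hB'))
      (fun B' hB' T hT hT' => hc B' (List.mem_cons_of_mem _ hB') T
        (Set.subset_union_left.trans hT) (by rwa [← Set.union_assoc]))
    have hsub := trk_submodular (F := F) (Set.subset_union_left (s := S) (t := Set.range B.2)) hS' hP
    rw [entries_cons, ← Set.union_assoc]
    simp only [List.map_cons, List.sum_cons, List.length_cons]
    -- If p keeps its transcendence degree when B is adjoined, B is retained and pays its full cost.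
    -- Otherwise B is discarded, and the degree of p has dropped by at least one.
    by_cases hfree : trk F (S ∪ Set.range B.2) + trk F (S ∪ Set.range p) ≤
        trk F (S ∪ Set.range B.2 ∪ Set.range p) + trk F S
    · have := isAlgClosed_acl hSK
      have hcost := trk_union_range_add_finrank_le hS hP (v := B.2)
        (w := fun m : Mon σ B.1 => monVal p m.1) (fun m => ?_) (hrel B List.mem_cons_self) hfree
      · have hcB := hc B List.mem_cons_self S subset_rfl Set.subset_union_left
        refine ⟨B :: N, hN.cons_cons B, ?_, ?_⟩
        · simp only [List.length_cons]; omega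
        · simp only [List.map_cons, List.sum_cons]; omega
      · have hp : ∀ i, p i ∈ acl F (S ∪ Set.range p) := fun i => subset_acl _ (Or.inr ⟨i, rfl⟩)
        exact prod_mem fun i _ => pow_mem (hp i) _
    · refine ⟨N, hN.cons B, by omega, ?_⟩
      have h3 := trk_union_range_le (F := F) hS B.2
      omega

end Chain

/-! ### Generic points of dense sets -/

/-- A Zariski dense set `B ⊆ k^ι` has a point over an algebraically closed quotient of the product
ring `k^B` whose coordinates are algebraically independent. -/
theorem exists_generic_point {k ι : Type} [Field k] [IsAlgClosed k] (B : Set (ι → k))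
    (hB : ∀ G : MvPolynomial ι k, G ≠ 0 → ∃ b ∈ B, eval b G ≠ 0) :
    ∃ (K : Type) (_ : Field K) (_ : Algebra k K) (_ : IsAlgClosed K) (π : (B → k) →ₐ[k] K),
      Function.Surjective π ∧ AlgebraicIndependent k fun i => π fun b => b.1 i := by
  classical
  let ev : MvPolynomial ι k →ₐ[k] (B → k) := aeval fun i b => b.1 i
  have hev : ∀ G b, ev G b = eval b.1 G := by
    intro G b
    have h : (Pi.evalAlgHom k (fun _ : B => k) b).comp ev = aeval b.1 := by
      ext i; simp [ev]
    have h' := DFunLike.congr_fun h G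
    rw [aeval_eq_eval] at h'
    exact h'
  let S : Submonoid (B → k) := (nonZeroDivisors (MvPolynomial ι k)).map ev
  have hdisj : Disjoint ((⊥ : Ideal (B → k)) : Set (B → k)) S := by
    rw [Set.disjoint_left]
    rintro x hx ⟨G, hG, rfl⟩
    obtain ⟨b, hb, hne⟩ := hB G (nonZeroDivisors.ne_zero hG)
    have hx' : ev G = 0 := hx
    exact hne (by rw [← hev G ⟨b, hb⟩, hx']; rfl)
  obtain ⟨P, hP, -, hPS⟩ := Ideal.exists_le_prime_disjoint ⊥ S hdisj
  have hmax : P.IsMaximal := by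
    refine Ideal.isMaximal_iff.mpr ⟨fun h => hP.ne_top (P.eq_top_iff_one.mpr h), ?_⟩
    intro J x hPJ hxP hxJ
    -- A product of fields is von Neumann regular, so its primes are maximal.
    have h1 : x * (1 - x * x⁻¹) = 0 := by
      funext b
      by_cases h : x b = 0 <;> simp [h]
    have h2 : 1 - x * x⁻¹ ∈ P :=
      (hP.mem_or_mem (h1 ▸ P.zero_mem : x * (1 - x * x⁻¹) ∈ P)).resolve_left hxP
    have h3 := J.add_mem (hPJ h2) (J.mul_mem_right x⁻¹ hxJ)
    simpa using h3
  let : Field ((B → k) ⧸ P) := Ideal.Quotient.field P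
  refine ⟨(B → k) ⧸ P, inferInstance, inferInstance, ?_, Ideal.Quotient.mkₐ k P,
    Ideal.Quotient.mk_surjective, ?_⟩
  · refine IsAlgClosed.of_exists_root _ fun f hf hirr => ?_
    -- Lift the polynomial to a monic one over the product and choose a root in each factor.
    obtain ⟨g, hg, hdeg, hmon⟩ := Polynomial.lifts_and_natDegree_eq_and_monic
      ((Polynomial.lifts_iff_coeff_lifts f).mpr fun n => Ideal.Quotient.mk_surjective _) hf
    have hpos : 0 < g.natDegree := by rw [hdeg]; exact hirr.natDegree_pos
    have hroot : ∀ b : B, ∃ x : k, (g.map (Pi.evalRingHom (fun _ : B => k) b)).eval x = 0 := by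
      intro b
      refine IsAlgClosed.exists_root _ ?_
      rw [hmon.degree_map]
      exact (Polynomial.natDegree_pos_iff_degree_pos.mp hpos).ne'
    choose x hx using hroot
    have h0 : g.eval x = 0 := by
      funext b
      have := Polynomial.eval_map_apply (Pi.evalRingHom (fun _ : B => k) b) (p := g) x
      exact this.symm.trans (hx b)
    refine ⟨Ideal.Quotient.mk P x, ?_⟩
    rw [← hg, Polynomial.eval_map_apply, h0, map_zero]
  · rw [algebraicIndependent_iff]
    intro G hG
    by_contra hne
    have h1 : (Ideal.Quotient.mkₐ k P) (ev G) = 0 := by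
      rw [← hG]
      have h : (Ideal.Quotient.mkₐ k P).comp ev =
          aeval fun i => (Ideal.Quotient.mkₐ k P) fun b => b.1 i := by
        ext i; simp [ev]
      exact DFunLike.congr_fun h G
    have h2 : ev G ∈ P := Ideal.Quotient.eq_zero_iff_mem.mp h1
    exact Set.disjoint_left.mp hPS h2 ⟨G, mem_nonZeroDivisors_of_ne_zero hne, rfl⟩

/-! ### Common zeros of forms -/

theorem aeval_smul_of_isHomogeneous {R A σ : Type*} [CommSemiring R] [CommSemiring A] [Algebra R A]
    {q : MvPolynomial σ R} {j : ℕ} (hq : q.IsHomogeneous j) (t : A) (x : σ → A) :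
    aeval (fun i => t * x i) q = t ^ j * aeval x q := by
  rw [aeval_def, aeval_def, eval₂_eq, eval₂_eq, Finset.mul_sum]
  refine Finset.sum_congr rfl fun m hm => ?_
  have hdeg : ∑ i ∈ m.support, m i = j := by
    rw [← Finsupp.degree_apply, Finsupp.degree_eq_weight_one]
    exact hq (mem_support_iff.mp hm)
  simp only [mul_pow, Finset.prod_mul_distrib, Finset.prod_pow_eq_pow_sum, hdeg]
  ring

theorem exists_forall_sum_ne_zero {K σ ι : Type*} [Field K] [Infinite K] [Fintype σ] (s : Finset ι)
    (v : ι → σ → K) (hv : ∀ i ∈ s, v i ≠ 0) : ∃ h : σ → K, ∀ i ∈ s, ∑ a, h a * v i a ≠ 0 := by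
  classical
  let G : MvPolynomial σ K := ∏ i ∈ s, ∑ a, C (v i a) * X a
  have hG : G ≠ 0 := by
    refine Finset.prod_ne_zero_iff.mpr fun i hi h0 => hv i hi (funext fun a => ?_)
    have := congrArg (eval (Pi.single a 1)) h0
    simpa [Pi.single_apply] using this
  by_contra hcon
  push Not at hcon
  refine hG (MvPolynomial.funext fun h => ?_)
  obtain ⟨i, hi, h0⟩ := hcon h
  rw [map_zero, map_prod]
  refine Finset.prod_eq_zero hi ?_
  rw [← h0]
  simp [mul_comm]

/-- If a system of forms has a nontrivial zero on every hyperplane, it has a zero in an extension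
field with coordinates `1` and one outside the ground field. -/
theorem exists_nonconstant_zero {K σ : Type} [Field K] [IsAlgClosed K] [Fintype σ]
    (Q : Set (MvPolynomial σ K)) (hQ : ∀ q ∈ Q, ∃ j, q.IsHomogeneous j)
    (hyp : ∀ h : σ → K, ∃ y : σ → K, y ≠ 0 ∧ ∑ a, h a * y a = 0 ∧ ∀ q ∈ Q, eval y q = 0) :
    ∃ (Ω : Type) (_ : Field Ω) (_ : Algebra K Ω) (p : σ → Ω) (i₀ : σ), p i₀ = 1 ∧
      (∃ i, p i ∉ Set.range (algebraMap K Ω)) ∧ ∀ q ∈ Q, aeval p q = 0 := by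
  classical
  set I := Ideal.span Q with hI
  have hfin : I.minimalPrimes.Finite := I.finite_minimalPrimes_of_isNoetherianRing
  by_contra hcon
  -- Failing the conclusion, the ratios of coordinates at the generic point of each component lie in
  -- K, so each component has its K-points on one line through the origin. There are finitely many
  -- components.
  have key : ∀ P ∈ I.minimalPrimes, ∃ v : σ → K, ∀ y : σ → K, (∀ f ∈ P, eval y f = 0) →
      ∃ t : K, y = t • v := by
    intro P hP
    have hPprime : P.IsPrime := hP.1.1
    let Ω := FractionRing (MvPolynomial σ K ⧸ P)
    let x : σ → Ω := fun i => algebraMap (MvPolynomial σ K ⧸ P) Ω (Ideal.Quotient.mk P (X i))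
    have hx : ∀ f : MvPolynomial σ K, aeval x f = algebraMap _ Ω (Ideal.Quotient.mk P f) := by
      intro f
      have h : (aeval x : MvPolynomial σ K →ₐ[K] Ω) =
          (IsScalarTower.toAlgHom K (MvPolynomial σ K ⧸ P) Ω).comp (Ideal.Quotient.mkₐ K P) := by
        ext i; simp [x]
      exact DFunLike.congr_fun h f
    have hx0 : ∀ f : MvPolynomial σ K, aeval x f = 0 → f ∈ P := fun f hf => by
      rw [hx, map_eq_zero_iff _ (IsFractionRing.injective _ Ω)] at hf
      exact Ideal.Quotient.eq_zero_iff_mem.mp hf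
    by_cases hall : ∀ i, x i = 0
    · refine ⟨0, fun y hy => ⟨0, ?_⟩⟩
      funext i
      have := hy (X i) (hx0 _ (by rw [aeval_X, hall i]))
      simpa using this
    · push Not at hall
      obtain ⟨i₀, hi₀⟩ := hall
      by_cases hconst : ∀ i, ∃ c : K, algebraMap K Ω c = (x i₀)⁻¹ * x i
      · choose v hv using hconst
        refine ⟨v, fun y hy => ⟨y i₀, ?_⟩⟩
        funext i
        have := hy (X i - C (v i) * X i₀) (hx0 _ (by
          rw [map_sub, map_mul, aeval_X, aeval_X, aeval_C, hv i]
          rw [mul_comm, ← mul_assoc, mul_inv_cancel₀ hi₀, one_mul, sub_self]))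
        rw [map_sub, map_mul, eval_X, eval_X, eval_C, sub_eq_zero] at this
        simp [this, mul_comm]
      · push Not at hconst
        obtain ⟨i, hi⟩ := hconst
        refine (hcon ⟨Ω, inferInstance, inferInstance, fun i => (x i₀)⁻¹ * x i, i₀,
          inv_mul_cancel₀ hi₀, ⟨i, fun ⟨c, hc⟩ => hi c hc⟩, fun q hq => ?_⟩).elim
        obtain ⟨j, hj⟩ := hQ q hq
        rw [aeval_smul_of_isHomogeneous hj, hx,
          Ideal.Quotient.eq_zero_iff_mem.mpr (hP.1.2 (Ideal.subset_span hq)), map_zero, mul_zero]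
  choose! v hv using key
  -- A hyperplane containing none of these lines meets the zero set only at the origin, against
  -- `hyp`.
  obtain ⟨h, hh⟩ := exists_forall_sum_ne_zero (hfin.toFinset.filter fun P => v P ≠ 0) v
    (fun P hP => (Finset.mem_filter.mp hP).2)
  obtain ⟨y, hy0, hyh, hyQ⟩ := hyp h
  have hker : I ≤ RingHom.ker (eval y) := Ideal.span_le.mpr fun q hq => hyQ q hq
  have hkerp : (RingHom.ker (eval y)).IsPrime := RingHom.ker_isPrime _
  obtain ⟨P, hP, hPy⟩ := Ideal.exists_minimalPrimes_le hker
  obtain ⟨t, rfl⟩ := hv P hP y fun f hf => hPy hf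
  have ht : t ≠ 0 := by rintro rfl; simp at hy0
  have hvP : v P ≠ 0 := by intro h0; simp [h0] at hy0
  refine hh P (Finset.mem_filter.mpr ⟨hfin.mem_toFinset.mpr hP, hvP⟩) ?_
  have : t * ∑ a, h a * v P a = 0 := by
    rw [← hyh, Finset.mul_sum]
    exact Finset.sum_congr rfl fun a _ => by simp; ring
  exact (mul_eq_zero.mp this).resolve_left ht

/-! ### Tuples of forms over arbitrary rings -/

section Forms

variable {n k : ℕ} {d : Fin k → ℕ}

/-- Indices of the coefficients of a tuple of forms of degrees `d` in `n + 1` variables. -/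
abbrev Par (n : ℕ) {k : ℕ} (d : Fin k → ℕ) : Type := Σ i : Fin k, Mon (Fin (n + 1)) (d i)

/-- The forms with given coefficients. -/
noncomputable def form {R : Type*} [CommSemiring R] (φ : Par n d → R) (i : Fin k) :
    MvPolynomial (Fin (n + 1)) R :=
  ∑ m : Mon (Fin (n + 1)) (d i), monomial m.1 (φ ⟨i, m⟩)

/-- Dehomogenization over an arbitrary ring, see `dehom`. -/
noncomputable def dehomR {R : Type*} [CommRing R] (c : Fin (n + 1)) (a : Fin n → R)
    (f : MvPolynomial (Fin (n + 1)) R) : MvPolynomial (Fin n) R :=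
  aeval (Fin.insertNth (α := fun _ => MvPolynomial (Fin n) R) c 1 (fun m => X m + C (a m))) f

/-- The homogeneous components of the dehomogenized forms. -/
noncomputable def loc {R : Type*} [CommRing R] (φ : Par n d → R) (c : Fin (n + 1)) (a : Fin n → R)
    (i : Fin k) (j : ℕ) : MvPolynomial (Fin n) R :=
  homogeneousComponent j (dehomR c a (form φ i))

theorem coeff_form {R : Type*} [CommSemiring R] (φ : Par n d → R) (i : Fin k)
    (m : Mon (Fin (n + 1)) (d i)) : coeff m.1 (form φ i) = φ ⟨i, m⟩ := by
  classical
  rw [form, coeff_sum, Finset.sum_eq_single m]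
  · simp
  · intro m' _ hne
    rw [coeff_monomial, if_neg fun h => hne (Subtype.ext h)]
  · simp

theorem isHomogeneous_form {R : Type*} [CommSemiring R] (φ : Par n d → R) (i : Fin k) :
    (form φ i).IsHomogeneous (d i) :=
  IsHomogeneous.sum _ _ _ fun m _ => isHomogeneous_monomial _ m.2

theorem map_form {R R' : Type*} [CommSemiring R] [CommSemiring R'] (g : R →+* R') (φ : Par n d → R)
    (i : Fin k) : map g (form φ i) = form (fun x => g (φ x)) i := by
  simp [form, map_monomial]

theorem map_dehomR {R R' : Type*} [CommRing R] [CommRing R'] (g : R →+* R') (c : Fin (n + 1))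
    (a : Fin n → R) (f : MvPolynomial (Fin (n + 1)) R) :
    map g (dehomR c a f) = dehomR c (fun m => g (a m)) (map g f) := by
  have h : (map g).comp (aeval (Fin.insertNth (α := fun _ => MvPolynomial (Fin n) R) c 1
      (fun m => X m + C (a m))) : MvPolynomial (Fin (n + 1)) R →ₐ[R] _).toRingHom =
      (aeval (Fin.insertNth (α := fun _ => MvPolynomial (Fin n) R') c 1
      (fun m => X m + C (g (a m)))) : MvPolynomial (Fin (n + 1)) R' →ₐ[R'] _).toRingHom.comp
        (map g) := by
    refine ringHom_ext (fun r => ?_) fun i => ?_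
    · simp
    · induction i using c.succAboveCases <;> simp
  exact DFunLike.congr_fun h f

theorem map_homogeneousComponent' {R R' σ : Type*} [CommSemiring R] [CommSemiring R'] (g : R →+* R')
    (j : ℕ) (f : MvPolynomial σ R) :
    map g (homogeneousComponent j f) = homogeneousComponent j (map g f) := by
  ext m
  rw [coeff_map, coeff_homogeneousComponent, coeff_homogeneousComponent, coeff_map]
  split_ifs <;> simp

theorem map_loc {R R' : Type*} [CommRing R] [CommRing R'] (g : R →+* R') (φ : Par n d → R)
    (c : Fin (n + 1)) (a : Fin n → R) (i : Fin k) (j : ℕ) :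
    map g (loc φ c a i j) = loc (fun x => g (φ x)) c (fun m => g (a m)) i j := by
  rw [loc, loc, map_homogeneousComponent', map_dehomR, map_form]

theorem isHomogeneous_loc {R : Type*} [CommRing R] (φ : Par n d → R) (c : Fin (n + 1))
    (a : Fin n → R) (i : Fin k) (j : ℕ) : (loc φ c a i j).IsHomogeneous j :=
  homogeneousComponent_isHomogeneous _ _

theorem dehomR_zero_eq {R : Type*} [CommRing R] (c : Fin (n + 1)) (a : Fin n → R)
    (f : MvPolynomial (Fin (n + 1)) R) :
    dehomR c 0 f = aeval (fun m => X m - C (a m)) (dehomR c a f) := by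
  have h : (aeval (Fin.insertNth (α := fun _ => MvPolynomial (Fin n) R) c 1
      (fun m => X m + C ((0 : Fin n → R) m))) : MvPolynomial (Fin (n + 1)) R →ₐ[R] _) =
      (aeval (fun m => X m - C (a m)) : MvPolynomial (Fin n) R →ₐ[R] _).comp
      (aeval (Fin.insertNth (α := fun _ => MvPolynomial (Fin n) R) c 1
      (fun m => X m + C (a m)))) := by
    refine algHom_ext fun i => ?_
    induction i using c.succAboveCases <;> simp
  exact DFunLike.congr_fun h f

theorem eval_dehomR {R : Type*} [CommRing R] (c : Fin (n + 1)) (a v : Fin n → R)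
    (f : MvPolynomial (Fin (n + 1)) R) :
    eval v (dehomR c a f) = eval (Fin.insertNth (α := fun _ => R) c 1 fun m => v m + a m) f := by
  have h : (aeval v : MvPolynomial (Fin n) R →ₐ[R] R).comp
      (aeval (Fin.insertNth (α := fun _ => MvPolynomial (Fin n) R) c 1
      (fun m => X m + C (a m)))) =
      aeval (Fin.insertNth (α := fun _ => R) c 1 fun m => v m + a m) := by
    refine algHom_ext fun i => ?_
    induction i using c.succAboveCases <;> simp
  have := DFunLike.congr_fun h f
  rwa [AlgHom.comp_apply, aeval_eq_eval, aeval_eq_eval] at this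

/-- The exponent of the variables other than `x_c`. -/
noncomputable def dropExp (c : Fin (n + 1)) (m : Fin (n + 1) →₀ ℕ) : Fin n →₀ ℕ :=
  Finsupp.equivFunOnFinite.symm fun i => m (c.succAbove i)

theorem dehomR_zero_monomial {R : Type*} [CommRing R] (c : Fin (n + 1)) (m : Fin (n + 1) →₀ ℕ)
    (r : R) : dehomR c 0 (monomial m r) = monomial (dropExp c m) r := by
  rw [dehomR, aeval_monomial, Finsupp.prod_fintype _ _ (by simp), Fin.prod_univ_succAbove _ c]
  simp only [Fin.insertNth_apply_same, Fin.insertNth_apply_succAbove, one_pow, one_mul]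
  rw [monomial_eq, Finsupp.prod_fintype _ _ (by simp)]
  simp [dropExp, algebraMap_eq]

theorem coeff_dehomR_zero_form {R : Type*} [CommRing R] (φ : Par n d → R) (c : Fin (n + 1))
    (i : Fin k) (m : Mon (Fin (n + 1)) (d i)) :
    coeff (dropExp c m.1) (dehomR c 0 (form φ i)) = φ ⟨i, m⟩ := by
  classical
  have h1 : dehomR c 0 (form φ i) =
      ∑ m : Mon (Fin (n + 1)) (d i), monomial (dropExp c m.1) (φ ⟨i, m⟩) := by
    rw [form, dehomR, map_sum]
    exact Finset.sum_congr rfl fun m _ => dehomR_zero_monomial c m.1 _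
  rw [h1, coeff_sum, Finset.sum_eq_single m]
  · simp
  · intro m' _ hne
    rw [coeff_monomial, if_neg]
    intro h
    apply hne
    apply Subtype.ext
    have hs : ∀ a, m'.1 (c.succAbove a) = m.1 (c.succAbove a) := fun a => DFunLike.congr_fun h a
    have h2 := m.2
    have h3 := m'.2
    rw [Finsupp.degree_eq_sum, Fin.sum_univ_succAbove _ c] at h2 h3
    ext a
    induction a using c.succAboveCases with
    | x =>
      have : ∑ i, m'.1 (c.succAbove i) = ∑ i, m.1 (c.succAbove i) :=
        Finset.sum_congr rfl fun i _ => hs i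
      omega
    | p a => exact hs a
  · simp

theorem totalDegree_dehomR_le {R : Type*} [CommRing R] [Nontrivial R] (φ : Par n d → R)
    (c : Fin (n + 1)) (a : Fin n → R) (i : Fin k) :
    (dehomR c a (form φ i)).totalDegree ≤ d i := by
  rw [form, dehomR, map_sum]
  refine totalDegree_finsetSum_le fun m _ => ?_
  rw [aeval_monomial, Finsupp.prod_fintype _ _ (by simp), algebraMap_eq]
  refine (totalDegree_mul _ _).trans ?_
  rw [totalDegree_C, zero_add]
  refine (totalDegree_finsetProd _ _).trans (le_trans ?_ (le_of_eq
    ((Finsupp.degree_eq_sum m.1).symm.trans m.2)))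
  refine Finset.sum_le_sum fun b _ => (totalDegree_pow _ _).trans ?_
  refine (Nat.mul_le_mul_left _ ?_).trans (mul_one _).le
  induction b using c.succAboveCases with
  | x => simp
  | p b =>
    rw [Fin.insertNth_apply_succAbove]
    refine (totalDegree_add _ _).trans ?_
    simp

/-- Undoing the shift by a expresses the coefficients of a form through a and the Taylor
coefficients at a, so replacing forms by local equations loses no transcendence degree once a is
adjoined. -/
theorem coeff_dehomR_mem_range {E Ω : Type*} [CommRing E] [CommRing Ω] (g : E →+* Ω)
    (φ : Par n d → Ω) (c : Fin (n + 1)) (a : Fin n → E) (i : Fin k)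
    (h : ∀ m, coeff m (dehomR c (fun m => g (a m)) (form φ i)) ∈ Set.range g)
    (m : Mon (Fin (n + 1)) (d i)) : φ ⟨i, m⟩ ∈ Set.range g := by
  obtain ⟨f, hf⟩ : ∃ f, map g f = dehomR c (fun m => g (a m)) (form φ i) := by
    have := (mem_range_map_iff_coeffs_subset (f := g)
      (x := dehomR c (fun m => g (a m)) (form φ i))).2 ?_
    · exact this
    · intro x hx
      obtain ⟨m, -, rfl⟩ := mem_coeffs_iff.1 hx
      exact h m
  have h1 : dehomR c 0 (form φ i) = map g (aeval (fun m => X m - C (a m)) f) := by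
    rw [dehomR_zero_eq c (fun m => g (a m)), ← hf]
    have h2 : ((aeval (fun m => X m - C (g (a m))) : MvPolynomial (Fin n) Ω →ₐ[Ω] _).toRingHom).comp
        (map g) = (map g).comp
        (aeval (fun m => X m - C (a m)) : MvPolynomial (Fin n) E →ₐ[E] _).toRingHom := by
      refine ringHom_ext (fun r => ?_) fun i => ?_
      · simp
      · simp
    exact DFunLike.congr_fun h2 f
  rw [← coeff_dehomR_zero_form φ c i m, h1, coeff_map]
  exact ⟨_, rfl⟩

theorem coeff_dehomR_mem {F Ω : Type*} [Field F] [Field Ω] [Algebra F Ω] (E : IntermediateField F Ω)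
    (φ : Par n d → Ω) (c : Fin (n + 1)) (a : Fin n → Ω) (ha : ∀ m, a m ∈ E) (i : Fin k)
    (h : ∀ m, coeff m (dehomR c a (form φ i)) ∈ E) (m : Mon (Fin (n + 1)) (d i)) :
    φ ⟨i, m⟩ ∈ E := by
  obtain ⟨x, hx⟩ := coeff_dehomR_mem_range (algebraMap E Ω) φ c (fun m => ⟨a m, ha m⟩) i
    (fun m => ⟨⟨_, h m⟩, rfl⟩) m
  rw [← hx]
  exact x.2

end Forms

set_option linter.unusedSectionVars false

/-! ### Counting parameters of systems of forms with a common zero -/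

section Counting

variable {F Ω : Type*} [Field F] [Field Ω] [Algebra F Ω] {σ : Type*} [Fintype σ]

theorem monVal_single {R : Type*} [CommSemiring R] (p : σ → R) (i : σ) :
    monVal p (Finsupp.single i 1) = p i := by
  simp [monVal, Finsupp.prod_single_index]

theorem exists_single_of_degree_eq_one {m : σ →₀ ℕ} (h : m.degree = 1) :
    ∃ i, m = Finsupp.single i 1 := by
  classical
  obtain ⟨i, hi⟩ : ∃ i, m i ≠ 0 := by
    by_contra hcon
    push Not at hcon
    obtain rfl : m = 0 := Finsupp.ext hcon
    simp at h
  have hle : Finsupp.single i 1 ≤ m := by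
    rw [Finsupp.single_le_iff]; omega
  refine ⟨i, ?_⟩
  have h2 : (m - Finsupp.single i 1).degree = 0 := by
    have h3 := congrArg Finsupp.degree (tsub_add_cancel_of_le hle)
    rw [map_add, h, Finsupp.degree_single] at h3
    omega
  rw [Finsupp.degree_eq_zero_iff] at h2
  rw [← tsub_add_cancel_of_le hle, h2, zero_add]

theorem linearIndependent_intermediateField_mono {E E' : IntermediateField F Ω} (hle : E ≤ E')
    {ι : Type*} {w : ι → Ω} (h : LinearIndependent E' w) : LinearIndependent E w := by
  rw [linearIndependent_iff'] at h ⊢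
  intro s g hg i hi
  have := h s (fun i => IntermediateField.inclusion hle (g i)) hg i hi
  exact Subtype.ext (congrArg (fun x : E' => (x : Ω)) this)

/-- Linear forms pay r + 1 conditions each without any freeness hypothesis: once all coordinates of
p lie in the span of the basis `p ∘ e` over `acl F S`, independence of that basis over K is enough.
-/
theorem trk_union_linear_le {K : IntermediateField F Ω} [IsAlgClosed K] {p : σ → Ω} {r : ℕ}
    {e : Fin (r + 1) → σ} (he : Function.Injective e) (hlin : LinearIndependent K (p ∘ e))
    (L : List (Σ j : ℕ, Mon σ j → Ω)) (hL : ∀ B ∈ L, B.1 = 1) {S : Set Ω} (hS : S.Finite)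
    (hSK : S ⊆ K) (hLK : entries L ⊆ K) (hrel : ∀ B ∈ L, ∑ m, B.2 m * monVal p m.1 = 0)
    (hspan : ∀ i, p i ∈ Submodule.span (acl F S) (Set.range (p ∘ e))) :
    trk F (S ∪ entries L) + L.length * (r + 1) ≤
      trk F S + (L.map fun B => Fintype.card (Mon σ B.1)).sum := by
  induction L generalizing S with
  | nil => simp [entries]
  | cons B L ih =>
    rw [entries_cons] at hLK ⊢
    have hBK : Set.range B.2 ⊆ K := Set.subset_union_left.trans hLK
    have hS' := hS.union (Set.finite_range B.2)
    have hle : acl F S ≤ acl F (S ∪ Set.range B.2) := acl_mono Set.subset_union_left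
    have h1 := ih (fun B hB => hL B (List.mem_cons_of_mem _ hB)) hS' (Set.union_subset hSK hBK)
      (Set.subset_union_right.trans hLK) (fun B hB => hrel B (List.mem_cons_of_mem _ hB)) ?_
    · have h2 : trk F (S ∪ Set.range B.2) + (r + 1) ≤ trk F S + Fintype.card (Mon σ B.1) := by
        have hB1 := hL B List.mem_cons_self
        have hB0 := hrel B List.mem_cons_self
        obtain ⟨j, v⟩ := B
        obtain rfl : j = 1 := hB1
        have hcomp : (fun m : Mon σ 1 => monVal p m.1) ∘
            (fun s : Fin (r + 1) => (⟨Finsupp.single (e s) 1, by simp⟩ : Mon σ 1)) = p ∘ e := by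
          funext s
          exact monVal_single p (e s)
        have := trk_union_range_add_card_le (F := F) (κ := Fin (r + 1)) hS
          (acl_le_of_isAlgClosed hSK)
          (v := v) (w := fun m : Mon σ 1 => monVal p m.1) (fun m => hBK ⟨m, rfl⟩)
          (e := fun s : Fin (r + 1) => (⟨Finsupp.single (e s) 1, by simp⟩ : Mon σ 1))
          (fun s t hst => he (by
            have := congrArg Subtype.val hst
            exact (Finsupp.single_left_inj one_ne_zero).1 this)) (by rwa [hcomp]) (fun m => by
              rw [hcomp]
              obtain ⟨i, hi⟩ := exists_single_of_degree_eq_one m.2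
              simp only [hi, monVal_single]
              exact hspan i) hB0
        simpa using this
      rw [← Set.union_assoc, List.map_cons, List.sum_cons, List.length_cons, add_mul]
      omega
    · intro i
      obtain ⟨c, hc⟩ := (Submodule.mem_span_range_iff_exists_fun _).1 (hspan i)
      exact (Submodule.mem_span_range_iff_exists_fun _).2
        ⟨fun s => ⟨c s, hle (c s).2⟩, hc⟩

/-- The bound is r and not r + 1: expressing the coordinate 1 through the basis eliminates one basis
element. -/
theorem trk_union_range_le_of_span {p : σ → Ω} {r : ℕ} {e : Fin (r + 1) → σ} {S : Set Ω}
    (hS : S.Finite) (hspan : ∀ i, p i ∈ Submodule.span (acl F S) (Set.range (p ∘ e))) {i₀ : σ}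
    (h1 : p i₀ = 1) : trk F (S ∪ Set.range p) ≤ trk F S + r := by
  classical
  choose h hh using fun i => (Submodule.mem_span_range_iff_exists_fun _).1 (hspan i)
  have hh' : ∀ i, ∑ s, (h i s : Ω) * p (e s) = p i := hh
  obtain ⟨s₀, hs₀⟩ : ∃ s, (h i₀ s : Ω) ≠ 0 := by
    by_contra hcon
    push Not at hcon
    have := hh' i₀
    simp [hcon, h1] at this
  let v : {s : Fin (r + 1) // s ≠ s₀} → Ω := fun s => p (e s)
  have hcard : Fintype.card {s : Fin (r + 1) // s ≠ s₀} = r := by simp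
  have hT := hS.union (Set.finite_range v)
  have hle : acl F S ≤ acl F (S ∪ Set.range v) := acl_mono Set.subset_union_left
  have hv : ∀ s, s ≠ s₀ → p (e s) ∈ acl F (S ∪ Set.range v) := fun s hs =>
    subset_acl _ (Or.inr ⟨⟨s, hs⟩, rfl⟩)
  have hv0 : p (e s₀) ∈ acl F (S ∪ Set.range v) := by
    have h2 := hh' i₀
    rw [← Finset.add_sum_erase _ _ (Finset.mem_univ s₀), h1] at h2
    have h3 : p (e s₀) = (h i₀ s₀ : Ω)⁻¹ *
        (1 - ∑ s ∈ Finset.univ.erase s₀, (h i₀ s : Ω) * p (e s)) := by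
      field_simp
      rw [← h2]; ring
    rw [h3]
    refine mul_mem (inv_mem (hle (h i₀ s₀).2)) (sub_mem (one_mem _) (sum_mem fun s hs => ?_))
    exact mul_mem (hle (h i₀ s).2) (hv s (Finset.ne_of_mem_erase hs))
  have hall : ∀ s, p (e s) ∈ acl F (S ∪ Set.range v) := fun s => by
    by_cases hs : s = s₀
    · rw [hs]; exact hv0
    · exact hv s hs
  refine (trk_le_of_subset_acl (hS.union (Set.finite_range p)) hT ?_).trans
    ((trk_union_range_le hS v).trans_eq (by rw [hcard]))
  rintro x (hx | ⟨i, rfl⟩)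
  · exact subset_acl _ (Or.inl hx)
  · rw [← hh' i]
    exact sum_mem fun s _ => mul_mem (hle (h i s).2) (hall s)

/-- Adjoin the coefficients of the linear relations between the coordinates of `p`, and then the
coefficients of linear forms vanishing at `p`. -/
theorem exists_linear_extension {K : IntermediateField F Ω} [IsAlgClosed K] {p : σ → Ω} {r : ℕ}
    {e : Fin (r + 1) → σ} (he : Function.Injective e) (hlin : LinearIndependent K (p ∘ e))
    (hspan : ∀ i, p i ∈ Submodule.span K (Set.range (p ∘ e))) {i₀ : σ} (h1 : p i₀ = 1)
    (L : List (Σ j : ℕ, Mon σ j → Ω)) (hL : ∀ B ∈ L, B.1 = 1) {A : Set Ω} (hA : A.Finite)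
    (hAK : A ⊆ K) (hLK : entries L ⊆ K) (hrel : ∀ B ∈ L, ∑ m, B.2 m * monVal p m.1 = 0) :
    ∃ S : Set Ω, S.Finite ∧ S ⊆ K ∧ A ∪ entries L ⊆ S ∧
      trk F S + L.length * (r + 1) ≤ trk F A + (Fintype.card σ - (r + 1)) * (r + 1) +
        (L.map fun B => Fintype.card (Mon σ B.1)).sum ∧
      trk F (S ∪ Set.range p) ≤ trk F S + r := by
  classical
  choose h hh using fun i => (Submodule.mem_span_range_iff_exists_fun _).1 (hspan i)
  -- Affine coordinates of the linear span of p in a Grassmannian: the coefficients of each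
  -- non-basis coordinate of p in the basis.
  let H : {i // i ∉ Set.range e} × Fin (r + 1) → Ω := fun x => h x.1 x.2
  have hcard : Fintype.card ({i // i ∉ Set.range e} × Fin (r + 1)) =
      (Fintype.card σ - (r + 1)) * (r + 1) := by
    rw [Fintype.card_prod, Fintype.card_subtype_compl, Fintype.card_fin]
    congr 2
    exact (Set.card_range_of_injective he).trans (Fintype.card_fin _)
  have hAH := hA.union (Set.finite_range H)
  have hAHK : A ∪ Set.range H ⊆ K := by
    refine Set.union_subset hAK ?_
    rintro _ ⟨x, rfl⟩
    exact (h x.1 x.2).2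
  have hspan' : ∀ S : Set Ω, A ∪ Set.range H ⊆ S →
      ∀ i, p i ∈ Submodule.span (acl F S) (Set.range (p ∘ e)) := by
    intro S hS i
    by_cases hi : i ∈ Set.range e
    · obtain ⟨s, rfl⟩ := hi
      exact Submodule.subset_span ⟨s, rfl⟩
    · refine (Submodule.mem_span_range_iff_exists_fun _).2
        ⟨fun s => ⟨h i s, subset_acl _ (hS (Or.inr ⟨(⟨i, hi⟩, s), rfl⟩))⟩, hh i⟩
  refine ⟨A ∪ Set.range H ∪ entries L, hAH.union (entries_finite L), Set.union_subset hAHK hLK, ?_,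
    ?_, ?_⟩
  · exact Set.union_subset_union_left _ Set.subset_union_left
  · have h2 := trk_union_linear_le he hlin L hL hAH hAHK hLK hrel (hspan' _ le_rfl)
    have h3 := trk_union_range_le (F := F) hA H
    rw [hcard] at h3
    omega
  · exact trk_union_range_le_of_span (hAH.union (entries_finite L))
      (hspan' _ Set.subset_union_left) h1

theorem le_finrank_span_acl {K : IntermediateField F Ω} [IsAlgClosed K] {p : σ → Ω} {r : ℕ}
    {e : Fin (r + 1) → σ} (hlin : LinearIndependent K (p ∘ e)) {T : Set Ω} (hT : T ⊆ K) :
    r + 1 ≤ Module.finrank (acl F T) (Submodule.span (acl F T) (Set.range p)) := by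
  have h1 : LinearIndependent (acl F T) (p ∘ e) :=
    linearIndependent_intermediateField_mono (acl_le_of_isAlgClosed hT) hlin
  have : FiniteDimensional (acl F T) (Submodule.span (acl F T) (Set.range p)) :=
    FiniteDimensional.span_of_finite _ (Set.finite_range p)
  simpa using card_le_finrank_of_mem (W := Submodule.span (acl F T) (Set.range p)) h1
    fun i => Submodule.subset_span ⟨e i, rfl⟩

theorem trk_add_one_le {K : IntermediateField F Ω} [IsAlgClosed K] {p : σ → Ω} {i : σ}
    (hi : p i ∉ K) {T : Set Ω} (hTf : T.Finite) (hT : T ⊆ K) :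
    trk F T + 1 ≤ trk F (T ∪ Set.range p) := by
  rw [← trk_insert_of_notMem hTf fun h => hi (acl_le_of_isAlgClosed hT h)]
  refine trk_mono (hTf.union (Set.finite_range p)) ?_
  exact Set.insert_subset (Or.inr ⟨i, rfl⟩) Set.subset_union_left

theorem choose_le_finrank_span_acl {p : σ → Ω} {i₀ : σ} (h1 : p i₀ = 1) {T : Set Ω}
    (hT : T.Finite) {b : ℕ} (hb : trk F T + b ≤ trk F (T ∪ Set.range p)) :
    (b + 2).choose 2 ≤ Module.finrank (acl F T)
      (Submodule.span (acl F T) (Set.range fun m : Mon σ 2 => monVal p m.1)) := by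
  classical
  have hp := Set.finite_range p
  obtain ⟨J, hJ, hind, hPJ⟩ := exists_algebraicIndependent_of_free (F := F) (V := ∅) hT
    Set.finite_empty hp (by rw [Set.union_empty]; omega)
  rw [Set.union_empty] at hind
  have hJf : J.Finite := hp.subset hJ
  let _ : Fintype J := hJf.fintype
  have h2 : trk F (T ∪ Set.range p) ≤ trk F (T ∪ J) := by
    refine trk_le_of_subset_acl (hT.union hp) (hT.union hJf) (Set.union_subset ?_ hPJ)
    exact Set.subset_union_left.trans (subset_acl _)
  have h3 := trk_union_le (F := F) hT hJf
  have h4 : J.ncard = Fintype.card J := by rw [← Nat.card_coe_set_eq, Nat.card_eq_fintype_card]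
  choose g hg using fun a : J => hJ a.2
  exact (Nat.choose_le_choose 2 (by omega)).trans (finrank_span_monVal_two_ge (J := J) p hind h1 hg)

/-- The data common to all parameter counts: a system of forms with coefficients in an
algebraically closed field `K` vanishing at a point `p` not defined over `K`, whose coordinates
span a space of dimension `r + 1` over `K`, while the coefficients of the linear forms `Lin`, the
other forms `L` and the forms `Rest` are as independent as possible. -/
structure CountingData (K : IntermediateField F Ω) (p : σ → Ω) (r k : ℕ)
    (Lin L Rest : List (Σ j : ℕ, Mon σ j → Ω)) (A : Set Ω) : Prop where
  finrank_eq : Module.finrank K (Submodule.span K (Set.range p)) = r + 1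
  exists_eq_one : ∃ i, p i = 1
  exists_notMem : ∃ i, p i ∉ K
  linear : ∀ B ∈ Lin, B.1 = 1
  length_eq : Lin.length = k
  finite : A.Finite
  subset : A ⊆ K
  subset_linear : entries Lin ⊆ K
  subset_list : entries L ⊆ K
  rel_linear : ∀ B ∈ Lin, ∑ m, B.2 m * monVal p m.1 = 0
  rel_list : ∀ B ∈ L, ∑ m, B.2 m * monVal p m.1 = 0
  trk_base : trk F A ≤ Fintype.card σ
  -- The summand k stands for the vanishing constant terms: the coefficients of the forms are
  -- algebraic over A and the positive-degree parts alone.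
  generic : k + ((Lin ++ L ++ Rest).map fun B => Fintype.card (Mon σ B.1)).sum ≤
    trk F (A ∪ entries (Lin ++ L ++ Rest))

namespace CountingData

variable {K : IntermediateField F Ω} [IsAlgClosed K] {p : σ → Ω} {r k : ℕ}
    {Lin L Rest : List (Σ j : ℕ, Mon σ j → Ω)} {A : Set Ω}

theorem exists_basis (p : σ → Ω) {r : ℕ}
    (h : Module.finrank K (Submodule.span K (Set.range p)) = r + 1) :
    ∃ e : Fin (r + 1) → σ, Function.Injective e ∧ LinearIndependent K (p ∘ e) ∧
      ∀ i, p i ∈ Submodule.span K (Set.range (p ∘ e)) := by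
  classical
  obtain ⟨κ, e, he, hspan, hlin⟩ := exists_linearIndependent' K p
  have := Finite.of_injective e he
  have := Fintype.ofFinite κ
  have hc : Fintype.card κ = Fintype.card (Fin (r + 1)) := by
    rw [Fintype.card_fin, ← h, ← hspan, finrank_span_eq_card hlin]
  let f := Fintype.equivOfCardEq hc
  refine ⟨e ∘ f.symm, he.comp f.symm.injective, hlin.comp _ f.symm.injective, fun i => ?_⟩
  have : Set.range (p ∘ e ∘ f.symm) = Set.range (p ∘ e) := by
    rw [← Function.comp_assoc, f.symm.surjective.range_comp]
  rw [this, hspan]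
  exact Submodule.subset_span ⟨i, rfl⟩

/-- The master inequality. S contains the base point, the linear span of p and the linear forms, and
c is the number of conditions imposed by L over S. The right side counts parameters, |σ| for the
base point plus those of the linear span. The left side counts conditions: k constant terms and k(r
+ 1) from the linear forms besides c. -/
theorem exists_extension (D : CountingData K p r k Lin L Rest A) :
    ∃ S : Set Ω, S.Finite ∧ S ⊆ K ∧
      (∀ c, trk F (S ∪ entries L) + c ≤
        trk F S + (L.map fun B => Fintype.card (Mon σ B.1)).sum →
        c + k + k * (r + 1) ≤ Fintype.card σ + (Fintype.card σ - (r + 1)) * (r + 1)) ∧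
      trk F (S ∪ Set.range p) ≤ trk F S + r ∧
      ∀ T : Set Ω, T ⊆ K →
        r + 1 ≤ Module.finrank (acl F T) (Submodule.span (acl F T) (Set.range p)) := by
  obtain ⟨e, he, hlin, hspan⟩ := exists_basis p D.finrank_eq
  obtain ⟨i₀, h1⟩ := D.exists_eq_one
  obtain ⟨S, hS, hSK, hAS, hcount, hr⟩ := exists_linear_extension he hlin hspan h1 Lin D.linear
    D.finite D.subset D.subset_linear D.rel_linear
  refine ⟨S, hS, hSK, fun c hc => ?_, hr, fun T hT => le_finrank_span_acl hlin hT⟩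
  have h2 := D.generic
  have h3 : trk F (A ∪ entries (Lin ++ L ++ Rest)) ≤ trk F (S ∪ entries L ∪ entries Rest) := by
    refine trk_mono ((hS.union (entries_finite _)).union (entries_finite _)) ?_
    rw [entries_append, entries_append, ← Set.union_assoc, ← Set.union_assoc]
    gcongr
  have h4 := trk_union_entries_le (F := F) (hS.union (entries_finite L)) Rest
  rw [List.map_append, List.map_append, List.sum_append, List.sum_append] at h2
  rw [D.length_eq] at hcount
  have h5 := D.trk_base
  omega

/-- The transcendence degree of p is at most r over S and still at least 1 at the end, since a
coordinate lies outside K. Hence at most r - 1 forms escape paying. -/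
theorem exists_sublist (D : CountingData K p r k Lin L Rest A) :
    ∃ N : List (Σ j : ℕ, Mon σ j → Ω), N.Sublist L ∧ L.length + 1 ≤ N.length + r ∧
      (N.map fun B => B.1 * r + 1).sum + k + k * (r + 1) ≤
        Fintype.card σ + (Fintype.card σ - (r + 1)) * (r + 1) := by
  obtain ⟨S, hS, hSK, hcount, hr, hrk⟩ := D.exists_extension
  obtain ⟨i, hi⟩ := D.exists_notMem
  obtain ⟨N, hN, hlen, hsum⟩ := exists_sublist_chain (F := F) p (fun j => j * r + 1) L hS hSK
    D.subset_list D.rel_list (fun B hB T hT hT' => by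
      have hTK : T ⊆ K := hT'.trans (Set.union_subset hSK D.subset_list)
      have := isAlgClosed_acl (F := F) hTK
      exact finrank_span_monVal_ge p (hrk T hTK) B.1)
  refine ⟨N, hN, ?_, hcount _ hsum⟩
  have := trk_add_one_le (F := F) hi (hS.union (entries_finite L))
    (Set.union_subset hSK D.subset_list)
  omega

/-- Adjoining C after Q, either some member of C pays, or each one lowers the degree of p. In the
latter case p has degree at least |C| + 1 over everything between S and S ∪ Q. The quadrics cannot
all lower it further, as r ≤ |Q| + |C|, and a quadric that pays does so for all quadratic monomials
in |C| + 2 homogeneous variables. -/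
theorem exists_cost {Q C : List (Σ j : ℕ, Mon σ j → Ω)}
    (D : CountingData K p r k Lin (Q ++ C) Rest A) (hQ : ∀ B ∈ Q, B.1 = 2)
    (hlen : r ≤ Q.length + C.length) :
    (∃ B ∈ C, B.1 * r + 1 + k + k * (r + 1) ≤
        Fintype.card σ + (Fintype.card σ - (r + 1)) * (r + 1)) ∨
      (C.length + 3).choose 2 + k + k * (r + 1) ≤
        Fintype.card σ + (Fintype.card σ - (r + 1)) * (r + 1) := by
  obtain ⟨S, hS, hSK, hcount, hr, hrk⟩ := D.exists_extension
  obtain ⟨i, hi⟩ := D.exists_notMem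
  have hQC := D.subset_list
  rw [entries_append] at hQC hcount
  have hQK : entries Q ⊆ K := Set.subset_union_left.trans hQC
  have hCK : entries C ⊆ K := Set.subset_union_right.trans hQC
  have hSQ := hS.union (entries_finite Q)
  have hSQK := Set.union_subset hSK hQK
  obtain ⟨N, hN, hlenN, hsumN⟩ := exists_sublist_chain (F := F) p (fun j => j * r + 1) C hSQ hSQK
    hCK (fun B hB => D.rel_list B (List.mem_append_right _ hB)) (fun B hB T hT hT' => by
      have hTK : T ⊆ K := hT'.trans (Set.union_subset hSQK hCK)
      have := isAlgClosed_acl (F := F) hTK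
      exact finrank_span_monVal_ge p (hrk T hTK) B.1)
  rw [List.map_append, List.sum_append, ← Set.union_assoc] at hcount
  have hleQ := trk_union_entries_le (F := F) hS Q
  have hleC := trk_union_entries_le (F := F) hSQ C
  rcases N with _ | ⟨B, N⟩
  · right
    have h1 := trk_add_one_le (F := F) hi (hSQ.union (entries_finite C))
      (Set.union_subset hSQK hCK)
    simp only [List.length_nil, zero_add] at hlenN
    have hb : trk F (S ∪ entries Q) + (C.length + 1) ≤ trk F (S ∪ entries Q ∪ Set.range p) := by
      omega
    obtain ⟨i₀, hi₀⟩ := D.exists_eq_one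
    obtain ⟨N, hN, hlenN', hsumN'⟩ := exists_sublist_chain (F := F) p
      (fun _ => (C.length + 1 + 2).choose 2) Q hS hSK
      hQK (fun B hB => D.rel_list B (List.mem_append_left _ hB)) (fun B hB T hT hT' => by
        rw [hQ B hB]
        refine choose_le_finrank_span_acl hi₀ (hSQ.subset hT') ?_
        have := trk_submodular (F := F) hT' hSQ (Set.finite_range p)
        omega)
    rcases N with _ | ⟨B, N⟩
    · simp only [List.length_nil, zero_add] at hlenN'
      omega
    · refine hcount _ ?_
      rw [List.map_cons, List.sum_cons] at hsumN'
      have : (C.length + 3).choose 2 = (C.length + 1 + 2).choose 2 := rfl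
      omega
  · left
    refine ⟨B, hN.subset List.mem_cons_self, hcount _ ?_⟩
    rw [List.map_cons, List.sum_cons] at hsumN
    omega

end CountingData

end Counting

/-! ### The numerical contradictions. -/

section Numerical

variable {F Ω : Type*} [Field F] [Field Ω] [Algebra F Ω] {σ : Type*} [Fintype σ]
  {K : IntermediateField F Ω} [IsAlgClosed K] {p : σ → Ω} {r k M : ℕ}
  {Lin Q C Rest : List (Σ j : ℕ, Mon σ j → Ω)} {A : Set Ω}

theorem length_mul_le_sum {α : Type*} (f : α → ℕ) (b : ℕ) (L : List α) (h : ∀ x ∈ L, b ≤ f x) :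
    L.length * b ≤ (L.map f).sum := by
  have := List.card_nsmul_le_sum (L.map f) b (by simpa using h)
  simpa using this

/-- With t = M - 1 - r at least t forms pay 2r + 1 or more, while r + t + 1 + t(r + 1) is available.
This gives (r - 1)(t - 1) ≤ 2, whereas r + t + 1 = M ≥ 9. Only r = 1 and t = 1 survive, and they are
excluded because at most k of the forms are quadrics. -/
theorem CountingData.length_lt (D : CountingData K p r k Lin (Q ++ C) Rest A)
    (hQ : ∀ B ∈ Q, B.1 = 2) (hC : ∀ B ∈ C, 3 ≤ B.1) (hσ : Fintype.card σ = M + k) (hk : 2 ≤ k)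
    (hM : 4 * k + 1 ≤ M) (hQk : Q.length ≤ k) (hlen : Q.length + C.length + 2 = M)
    : M < r + 2 := by
  by_contra hr
  push Not at hr
  obtain ⟨m, rfl⟩ : ∃ m, M = m + 1 := ⟨M - 1, by omega⟩
  have hL : ∀ B ∈ Q ++ C, 2 ≤ B.1 := fun B hB => by
    rcases List.mem_append.1 hB with h | h
    · rw [hQ B h]
    · exact (by norm_num : 2 ≤ 3).trans (hC B h)
  obtain ⟨t, rfl⟩ : ∃ t, m = r + t := ⟨m - r, by omega⟩
  have hrhs : Fintype.card σ + (Fintype.card σ - (r + 1)) * (r + 1) =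
      k + k * (r + 1) + (r + t + 1 + t * (r + 1)) := by
    rw [hσ, show r + t + 1 + k - (r + 1) = t + k by omega]; ring
  obtain ⟨N, hN, hNlen, hNsum⟩ := D.exists_sublist
  rw [hrhs] at hNsum
  have hNle : (N.map fun B => B.1 * r + 1).sum ≤ r + t + 1 + t * (r + 1) := by omega
  have hN2 : N.length ≤ (Q ++ C).length := hN.length_le
  rw [List.length_append] at hN2 hNlen
  have h2 : N.length * (2 * r + 1) ≤ (N.map fun B => B.1 * r + 1).sum :=
    length_mul_le_sum _ _ _ fun B hB => by
      have := hL B (hN.subset hB)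
      have := Nat.mul_le_mul_right r this
      omega
  have hr1 : 1 ≤ r := by omega
  have hkey : t * r ≤ r + t + 1 := by
    have h3 : t * (2 * r + 1) ≤ N.length * (2 * r + 1) := Nat.mul_le_mul_right _ (by omega)
    nlinarith
  have ht1 : 1 ≤ t := by omega
  -- For r = 1 no form escapes: quadrics pay 3 and the others at least 4, which exceeds the
  -- available 3M - 4 because at least five of the M - 2 forms are not quadrics.
  rcases Nat.lt_or_ge r 2 with hr2 | hr2
  · obtain rfl : r = 1 := by omega
    have hNL : N = Q ++ C := hN.eq_of_length_le (by rw [List.length_append]; omega)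
    rw [hNL, List.map_append, List.sum_append] at hNle
    have h3 : Q.length * 3 ≤ (Q.map fun B => B.1 * 1 + 1).sum :=
      length_mul_le_sum _ _ _ fun B hB => by rw [hQ B hB]
    have h4 : C.length * 4 ≤ (C.map fun B => B.1 * 1 + 1).sum :=
      length_mul_le_sum _ _ _ fun B hB => by have := hC B hB; omega
    omega
  -- For t = 1 a single quadric paying 2r + 1 fits into the available 2r + 3, so the finer
  -- alternative of `exists_cost` is needed. A form of degree at least 3 costs too much, and so do
  -- the quadratic monomials in |C| + 2 ≥ M - k variables.
  · rcases Nat.lt_or_ge t 2 with ht2 | ht2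
    · obtain rfl : t = 1 := by omega
      rcases D.exists_cost hQ (by omega) with ⟨B, hB, hcost⟩ | hcost
      · rw [hrhs] at hcost
        have := Nat.mul_le_mul_right r (hC B hB)
        omega
      · rw [hrhs] at hcost
        have h5 : (C.length + 3).choose 2 * 2 = (C.length + 3) * (C.length + 2) := by
          rw [Nat.choose_two_right]
          exact Nat.div_mul_cancel (Nat.even_mul_pred_self _).two_dvd
        have h6 : 8 * (C.length + 2) ≤ (C.length + 3) * (C.length + 2) :=
          Nat.mul_le_mul_right _ (by omega)
        omega
    · nlinarith

/-- For r = M - 1 only r + 1 is available, while one more equation guarantees a form that pays at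
least 2r + 1. -/
theorem CountingData.ne_pred (D : CountingData K p r k Lin (Q ++ C) Rest A)
    (hQ : ∀ B ∈ Q, B.1 = 2) (hC : ∀ B ∈ C, 3 ≤ B.1) (hσ : Fintype.card σ = M + k)
    (hM : 4 * k + 1 ≤ M) (hk : 2 ≤ k) (hlen : Q.length + C.length + 1 = M)
    : r + 1 ≠ M := by
  rintro rfl
  have hL : ∀ B ∈ Q ++ C, 2 ≤ B.1 := fun B hB => by
    rcases List.mem_append.1 hB with h | h
    · rw [hQ B h]
    · exact (by norm_num : 2 ≤ 3).trans (hC B h)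
  have hrhs : Fintype.card σ + (Fintype.card σ - (r + 1)) * (r + 1) =
      k + k * (r + 1) + (r + 1) := by
    rw [hσ, show r + 1 + k - (r + 1) = k by omega]; ring
  obtain ⟨N, hN, hNlen, hNsum⟩ := D.exists_sublist
  rw [hrhs] at hNsum
  rw [List.length_append] at hNlen
  have h2 : N.length * (2 * r + 1) ≤ (N.map fun B => B.1 * r + 1).sum :=
    length_mul_le_sum _ _ _ fun B hB => by
      have := Nat.mul_le_mul_right r (hL B (hN.subset hB))
      omega
  have h3 : 1 * (2 * r + 1) ≤ N.length * (2 * r + 1) := Nat.mul_le_mul_right _ (by omega)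
  omega

end Numerical

/-! ### The coefficients of the local equations -/

section Blocks

variable {n k : ℕ} {d : Fin k → ℕ}

theorem multichoose_succ_eq_sum (n D : ℕ) :
    (n + 1).multichoose D = 1 + ∑ j ∈ Finset.Icc 1 D, n.multichoose j := by
  induction D with
  | zero => simp
  | succ D ih =>
    rw [Nat.multichoose_succ_succ, ih, Finset.sum_Icc_succ_top (by omega)]
    ring

theorem card_par (n : ℕ) (d : Fin k → ℕ) :
    Fintype.card (Par n d) = k + ∑ e ∈ allIdx d, Fintype.card (Mon (Fin n) e.2) := by
  rw [Fintype.card_sigma, allIdx, Finset.sum_sigma]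
  simp only [card_mon, Fintype.card_fin, multichoose_succ_eq_sum, Finset.sum_add_distrib]
  simp

/-- The coefficients of one homogeneous component of one equation. -/
noncomputable def block {R : Type*} [CommRing R] (φ : Par n d → R) (c : Fin (n + 1)) (a : Fin n → R)
    (e : Σ _ : Fin k, ℕ) : Σ j : ℕ, Mon (Fin n) j → R :=
  ⟨e.2, fun m => coeff m.1 (loc φ c a e.1 e.2)⟩

/-- The base point and the positive-degree Taylor coefficients determine the forms, because the
constant terms vanish. -/
theorem card_par_le_trk {F Ω : Type*} [Field F] [Field Ω] [Algebra F Ω] {φ : Par n d → Ω}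
    (hφ : AlgebraicIndependent F φ) (c : Fin (n + 1)) (a : Fin n → Ω)
    (h0 : ∀ i, coeff 0 (dehomR c a (form φ i)) = 0) (L : List (Σ _ : Fin k, ℕ))
    (hL : ∀ e ∈ allIdx d, e ∈ L) :
    Fintype.card (Par n d) ≤ trk F (Set.range a ∪ entries (L.map (block φ c a))) := by
  rw [← trk_range_of_algebraicIndependent hφ]
  refine trk_le_of_subset_acl (Set.finite_range _)
    ((Set.finite_range _).union (entries_finite _)) ?_
  rintro _ ⟨⟨i, m⟩, rfl⟩
  refine coeff_dehomR_mem _ φ c a (fun m => subset_acl _ (Or.inl ⟨m, rfl⟩)) i (fun m => ?_) m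
  rcases Nat.eq_zero_or_pos m.degree with hm | hm
  · rw [(Finsupp.degree_eq_zero_iff m).1 hm, h0]
    exact zero_mem _
  · by_cases hd : m.degree ≤ d i
    · refine subset_acl _ (Or.inr ⟨block φ c a ⟨i, m.degree⟩, ?_, ⟨m, rfl⟩, ?_⟩)
      · exact List.mem_map_of_mem (hL _ (by simp [allIdx]; omega))
      · simp [block, loc, coeff_homogeneousComponent]
    · rw [coeff_eq_zero_of_totalDegree_lt]
      · exact zero_mem _
      · refine (totalDegree_dehomR_le φ c a i).trans_lt ?_
        rw [← Finsupp.degree_apply]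
        omega

end Blocks

/-! ### The index sets of the regularity conditions. -/

section Indices

variable {k : ℕ} {d : Fin k → ℕ}

theorem mem_allIdx {e : Σ _ : Fin k, ℕ} : e ∈ allIdx d ↔ 1 ≤ e.2 ∧ e.2 ≤ d e.1 := by
  simp [allIdx]

theorem card_allIdx (d : Fin k → ℕ) : (allIdx d).card = ∑ i, d i := by
  simp [allIdx, Finset.card_sigma]

theorem card_filter_snd_eq_le (X : Finset (Σ _ : Fin k, ℕ)) (j : ℕ) :
    (X.filter fun e => e.2 = j).card ≤ k := by
  have h := Finset.card_le_card_of_injOn (s := X.filter fun e => e.2 = j)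
    (t := (Finset.univ : Finset (Fin k))) (fun e => e.1) (by simp) ?_
  · simpa using h
  · rintro ⟨i, a⟩ h ⟨i', a'⟩ h' hii
    simp only [Finset.coe_filter, Set.mem_ofPred_eq] at h h'
    obtain rfl : i = i' := hii
    rw [h.2, h'.2]

theorem card_filter_snd_eq_one {X : Finset (Σ _ : Fin k, ℕ)} (hX : ∀ i, ⟨i, 1⟩ ∈ X) :
    (X.filter fun e => e.2 = 1).card = k := by
  refine (card_filter_snd_eq_le X 1).antisymm ?_
  have h := Finset.card_le_card_of_injOn (s := (Finset.univ : Finset (Fin k)))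
    (t := X.filter fun e => e.2 = 1) (fun i => ⟨i, 1⟩) (by
      intro i _; simpa using hX i) ?_
  · simpa using h
  · intro i _ i' _ h
    exact (Sigma.mk.inj_iff.1 h).1

theorem card_eq_add {X : Finset (Σ _ : Fin k, ℕ)} (hX : ∀ i, ⟨i, 1⟩ ∈ X) (hXd : X ⊆ allIdx d) :
    X.card = k + ((X.filter fun e => e.2 = 2).card + (X.filter fun e => 3 ≤ e.2).card) := by
  classical
  refine Eq.trans ?_ (congrArg (· + _) (card_filter_snd_eq_one hX))
  rw [← Finset.card_union_of_disjoint, ← Finset.card_union_of_disjoint, ← Finset.filter_or,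
    ← Finset.filter_or, Finset.filter_true_of_mem]
  · intro e he
    have := (mem_allIdx.1 (hXd he)).1
    omega
  · rw [← Finset.filter_or]
    exact Finset.disjoint_filter.2 fun e _ h => by omega
  · exact Finset.disjoint_filter.2 fun e _ h => by omega

variable (hk : 2 ≤ k)

theorem regIdx_subset : regIdx hk d ⊆ allIdx d := Finset.erase_subset _ _

theorem strongIdx_subset : strongIdx hk d ⊆ regIdx hk d := by
  rw [strongIdx]; split_ifs <;> exact Finset.erase_subset _ _

theorem card_regIdx (hd : ∀ i, 2 ≤ d i) : (regIdx hk d).card + 1 = ∑ i, d i := by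
  rw [regIdx, Finset.card_erase_add_one, card_allIdx]
  have := hd (lastIdx hk)
  rw [mem_allIdx]
  exact ⟨le_trans (by norm_num) this, le_rfl⟩

theorem prevIdx_ne : prevIdx hk ≠ lastIdx hk := by
  simp only [prevIdx, lastIdx, ne_eq, Fin.mk.injEq]; omega

theorem card_strongIdx (hd : ∀ i, 2 ≤ d i) : (strongIdx hk d).card + 2 = ∑ i, d i := by
  rw [← card_regIdx hk hd, strongIdx]
  have h1 := hd (lastIdx hk)
  have h2 := hd (prevIdx hk)
  split_ifs with h
  · rw [← Finset.card_erase_add_one (s := regIdx hk d) (a := ⟨prevIdx hk, d (prevIdx hk)⟩)]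
    rw [regIdx, Finset.mem_erase, mem_allIdx]
    exact ⟨fun h => prevIdx_ne hk (Sigma.mk.inj_iff.1 h).1, by simp; omega⟩
  · rw [← Finset.card_erase_add_one (s := regIdx hk d) (a := ⟨lastIdx hk, d (lastIdx hk) - 1⟩)]
    rw [regIdx, Finset.mem_erase, mem_allIdx]
    refine ⟨fun h => ?_, by simp; omega⟩
    have := eq_of_heq (Sigma.mk.inj_iff.1 h).2
    omega

theorem one_mem_strongIdx (hmono : Monotone d) (hd : ∀ i, 2 ≤ d i) (i : Fin k) :
    ⟨i, 1⟩ ∈ strongIdx hk d := by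
  have h0 := hd i
  have h1 := hd (lastIdx hk)
  have h2 := hd (prevIdx hk)
  -- Ordering the degrees matters here: when the last two differ, d_k - 1 ≥ d_{k-1} ≥ 2, so the
  -- second omitted component is not linear.
  have h3 : d (prevIdx hk) ≤ d (lastIdx hk) := hmono (by
    simp only [prevIdx, lastIdx, Fin.mk_le_mk]; omega)
  rw [strongIdx]
  split_ifs with h <;> rw [Finset.mem_erase, regIdx, Finset.mem_erase, mem_allIdx] <;>
    refine ⟨fun h' => ?_, fun h' => ?_, le_rfl, by simp; omega⟩ <;>
    · have h4 := congrArg Sigma.snd h'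
      simp only at h4
      omega

end Indices

/-! ### The parameter count for the local equations of a generic tuple. -/

section Count

variable {n k : ℕ} {d : Fin k → ℕ}

theorem aeval_map_algebraMap_eq {K Ω σ : Type*} [Field K] [Field Ω] [Algebra K Ω]
    (p : σ → Ω) (q : MvPolynomial σ K) : eval p (map (algebraMap K Ω) q) = aeval p q := by
  rw [eval_map, aeval_def]

/-- A generic system of local equations has no common zero outside a finite union of lines. -/
theorem exists_rank_of_common_zero {F K Ω : Type} [Field F] [Field K] [IsAlgClosed K]
    [Algebra F K] [Field Ω] [Algebra K Ω] {φ : Par n d → K} (hφ : AlgebraicIndependent F φ)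
    (c : Fin (n + 1)) (a : Fin n → K) (h0 : ∀ i, coeff 0 (dehomR c a (form φ i)) = 0)
    (p : Fin n → Ω) {i₀ : Fin n} (h1 : p i₀ = 1)
    (hp : ∃ i, p i ∉ Set.range (algebraMap K Ω)) (hk : 2 ≤ k) :
    ∃ r, (∃ e : Fin (r + 1) → Fin n, LinearIndependent K (p ∘ e)) ∧
      ∀ (X : Finset (Σ _ : Fin k, ℕ)), X ⊆ allIdx d → (∀ i, ⟨i, 1⟩ ∈ X) →
        (∀ e ∈ X, aeval p (loc φ c a e.1 e.2) = 0) → ∀ M, n = M + k → 4 * k + 1 ≤ M →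
          (X.card + 2 = M + k → M < r + 2) ∧ (X.card + 1 = M + k → r + 1 ≠ M) := by
  classical
  let _ : Algebra F Ω := ((algebraMap K Ω).comp (algebraMap F K)).toAlgebra
  have : IsScalarTower F K Ω := IsScalarTower.of_algebraMap_eq fun _ => rfl
  let ψ : K →ₐ[F] Ω := IsScalarTower.toAlgHom F K Ω
  have hψ : ∀ x, ψ x = algebraMap K Ω x := fun _ => rfl
  have hψi : Function.Injective ψ := (algebraMap K Ω).injective
  -- The counting lemmas work inside one field, so K is replaced by its image in Ω.
  let K' : IntermediateField F Ω := ψ.fieldRange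
  have hK' : ∀ x, ψ x ∈ K' := fun x => ⟨x, rfl⟩
  have : IsAlgClosed K' := IsAlgClosed.of_ringEquiv K K'
    (RingEquiv.ofBijective (ψ.toRingHom.codRestrict K' hK')
      ⟨fun x y h => hψi (congrArg (fun x : K' => (x : Ω)) h), fun ⟨_, x, hx⟩ => ⟨x, Subtype.ext hx⟩⟩)
  let φ' : Par n d → Ω := fun x => ψ (φ x)
  let a' : Fin n → Ω := fun m => ψ (a m)
  have hφ' : AlgebraicIndependent F φ' := hφ.map' (f := ψ) hψi
  have hloc : ∀ i j, loc φ' c a' i j = map (algebraMap K Ω) (loc φ c a i j) := fun i j =>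
    (map_loc (algebraMap K Ω) φ c a i j).symm
  have h0' : ∀ i, coeff 0 (dehomR c a' (form φ' i)) = 0 := fun i => by
    have := map_dehomR (algebraMap K Ω) c a (form φ i)
    rw [map_form] at this
    have h2 := congrArg (coeff 0) this
    rw [coeff_map, h0, map_zero] at h2
    exact h2.symm
  have hfin : FiniteDimensional K' (Submodule.span K' (Set.range p)) :=
    FiniteDimensional.span_of_finite _ (Set.finite_range p)
  have hpos : Module.finrank K' (Submodule.span K' (Set.range p)) ≠ 0 := by
    intro h
    have h2 := Submodule.finrank_eq_zero.1 h
    have h3 : p i₀ ∈ Submodule.span K' (Set.range p) := Submodule.subset_span ⟨i₀, rfl⟩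
    rw [h2, h1] at h3
    exact one_ne_zero ((Submodule.mem_bot K').1 h3)
  -- The number r depends on p alone and is fixed before X, so that one r can be tested against
  -- several subsystems vanishing at p.
  obtain ⟨r, hr⟩ := Nat.exists_eq_succ_of_ne_zero hpos
  obtain ⟨e, -, hlin, -⟩ := CountingData.exists_basis (F := F) p hr
  refine ⟨r, ⟨e, ?_⟩, fun X hX hX1 hzero M hn hM => ?_⟩
  · rw [linearIndependent_iff'] at hlin ⊢
    intro s g hg i hi
    have := hlin s (fun i => ⟨ψ (g i), hK' _⟩) (by
      refine Eq.trans (Finset.sum_congr rfl fun i _ => ?_) hg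
      rw [Algebra.smul_def (g i)]; rfl) i hi
    exact hψi ((congrArg (fun x : K' => (x : Ω)) this).trans (map_zero ψ).symm)
  · have hblock : ∀ L : List (Σ _ : Fin k, ℕ), entries (L.map (block φ' c a')) ⊆ K' := by
      rintro L x ⟨B, hB, m, rfl⟩
      obtain ⟨e, -, rfl⟩ := List.mem_map.1 hB
      simp only [block, hloc, coeff_map]
      exact hK' _
    have hrel : ∀ L : List (Σ _ : Fin k, ℕ), (∀ e ∈ L, e ∈ X) →
        ∀ B ∈ L.map (block φ' c a'), ∑ m, B.2 m * monVal p m.1 = 0 := by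
      intro L hL B hB
      obtain ⟨e, he, rfl⟩ := List.mem_map.1 hB
      have h2 := hzero e (hL e he)
      rw [← aeval_map_algebraMap_eq, ← hloc, eval_eq_sum_mon (isHomogeneous_loc φ' c a' _ _)] at h2
      exact h2
    set Lin := (X.filter fun e => e.2 = 1).toList with hLin
    set Q := (X.filter fun e => e.2 = 2).toList with hQ
    set C := (X.filter fun e => 3 ≤ e.2).toList with hC
    set Rest := (allIdx d \ X).toList with hRest
    have hcov : (allIdx d).val = (Lin ++ (Q ++ C) ++ Rest : List _) := by
      have e1 : allIdx d = (X.filter fun e => e.2 = 1).disjUnion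
        ((X.filter fun e => e.2 = 2).disjUnion (X.filter fun e => 3 ≤ e.2)
          (Finset.disjoint_filter.2 fun e _ h => by omega)) (by
          rw [Finset.disjUnion_eq_union, ← Finset.filter_or]
          exact Finset.disjoint_filter.2 fun e _ h => by omega) ∪ (allIdx d \ X) := by
        rw [Finset.disjUnion_eq_union, Finset.disjUnion_eq_union, ← Finset.filter_or,
          ← Finset.filter_or, Finset.filter_true_of_mem, Finset.union_sdiff_of_subset hX]
        intro e he
        have := (mem_allIdx.1 (hX he)).1
        omega
      have e2 : (allIdx d) = ((X.filter fun e => e.2 = 1).disjUnion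
        ((X.filter fun e => e.2 = 2).disjUnion (X.filter fun e => 3 ≤ e.2)
          (Finset.disjoint_filter.2 fun e _ h => by omega)) (by
          rw [Finset.disjUnion_eq_union, ← Finset.filter_or]
          exact Finset.disjoint_filter.2 fun e _ h => by omega)).disjUnion (allIdx d \ X) (by
          refine Finset.disjoint_of_subset_left ?_ Finset.disjoint_sdiff
          rw [Finset.disjUnion_eq_union, Finset.disjUnion_eq_union, ← Finset.filter_or,
            ← Finset.filter_or]
          exact Finset.filter_subset _ _) := by
        rw [Finset.disjUnion_eq_union]; exact e1
      rw [e2]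
      simp only [Finset.disjUnion_val, ← Multiset.coe_add, hLin, hQ, hC, hRest, Finset.coe_toList]
    have hmem : ∀ e ∈ allIdx d, e ∈ Lin ++ (Q ++ C) ++ Rest := fun e he => by
      have : e ∈ (allIdx d).val := he
      rwa [hcov, Multiset.mem_coe] at this
    have D : CountingData K' p r k (Lin.map (block φ' c a'))
        (Q.map (block φ' c a') ++ C.map (block φ' c a')) (Rest.map (block φ' c a'))
        (Set.range a') := by
      refine ⟨hr, ⟨i₀, h1⟩, ?_, ?_, ?_, Set.finite_range _, ?_, hblock _, ?_, hrel _ ?_, ?_, ?_, ?_⟩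
      · obtain ⟨i, hi⟩ := hp
        exact ⟨i, fun ⟨x, hx⟩ => hi ⟨x, hx⟩⟩
      · intro B hB
        obtain ⟨e, he, rfl⟩ := List.mem_map.1 hB
        rw [hLin, Finset.mem_toList, Finset.mem_filter] at he
        exact he.2
      · rw [List.length_map, hLin, Finset.length_toList, card_filter_snd_eq_one hX1]
      · rintro _ ⟨m, rfl⟩
        exact hK' _
      · rw [← List.map_append]; exact hblock _
      · intro e he
        rw [hLin, Finset.mem_toList, Finset.mem_filter] at he
        exact he.1
      · rw [← List.map_append]
        refine hrel _ fun e he => ?_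
        rw [hQ, hC, List.mem_append, Finset.mem_toList, Finset.mem_filter, Finset.mem_toList,
          Finset.mem_filter] at he
        rcases he with h | h <;> exact h.1
      · simpa using trk_range_le (F := F) a'
      · rw [← List.map_append, ← List.map_append, ← List.map_append, List.map_map]
        refine le_trans (le_of_eq ?_) (card_par_le_trk hφ' c a' h0' _ hmem)
        rw [card_par, Finset.sum, hcov, Multiset.map_coe, Multiset.sum_coe]
        rfl
    have hQ2 : ∀ B ∈ Q.map (block φ' c a'), B.1 = 2 := by
      intro B hB
      obtain ⟨e, he, rfl⟩ := List.mem_map.1 hB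
      rw [hQ, Finset.mem_toList, Finset.mem_filter] at he
      exact he.2
    have hC3 : ∀ B ∈ C.map (block φ' c a'), 3 ≤ B.1 := by
      intro B hB
      obtain ⟨e, he, rfl⟩ := List.mem_map.1 hB
      rw [hC, Finset.mem_toList, Finset.mem_filter] at he
      exact he.2
    have hQl : (Q.map (block φ' c a')).length = (X.filter fun e => e.2 = 2).card := by
      rw [List.length_map, hQ, Finset.length_toList]
    have hCl : (C.map (block φ' c a')).length = (X.filter fun e => 3 ≤ e.2).card := by
      rw [List.length_map, hC, Finset.length_toList]
    have hcard := card_eq_add hX1 hX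
    have hQk := card_filter_snd_eq_le X 2
    refine ⟨fun h => ?_, fun h => ?_⟩
    · exact D.length_lt hQ2 hC3 (by simpa using hn) hk hM (by omega) (by omega)
    · exact D.ne_pred hQ2 hC3 (by simpa using hn) hM hk (by omega)

end Count

/-! ### Degenerate tuples of forms -/

section Degenerate

variable {n k : ℕ} {d : Fin k → ℕ} {R : Type} [CommRing R]

/-- The forms have a common zero in the chart `c` at which their linear parts are dependent. -/
def HasSingularPoint (c : Fin (n + 1)) (φ : Par n d → R) : Prop :=
  ∃ (a : Fin n → R) (u v : Fin k → R), (∀ i, coeff 0 (dehomR c a (form φ i)) = 0) ∧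
    -- Writing "u is non-zero" as an equation with a witness v makes the condition pass to products
    -- and along ring homomorphisms.
    ∑ i, u i * v i = 1 ∧ ∑ i, C (u i) * loc φ c a i 1 = 0

/-- The forms have a common zero in the chart `c` at which the local equations with indices in `X`,
together with `s` independent linear forms on the tangent space, have a common zero on every
hyperplane. -/
def HasDegeneratePoint (X : Finset (Σ _ : Fin k, ℕ)) (s : ℕ) (c : Fin (n + 1))
    (φ : Par n d → R) : Prop :=
  ∃ (a : Fin n → R) (l v : Fin s → Fin n → R), (∀ i, coeff 0 (dehomR c a (form φ i)) = 0) ∧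
    (∀ i t, eval (v t) (loc φ c a i 1) = 0) ∧
    (∀ t t', ∑ m, l t m * v t' m = if t = t' then 1 else 0) ∧
    ∀ h : Fin n → R, ∃ y z : Fin n → R, ∑ m, z m * y m = 1 ∧ ∑ m, h m * y m = 0 ∧
      (∀ t, ∑ m, l t m * y m = 0) ∧ ∀ e ∈ X, eval y (loc φ c a e.1 e.2) = 0

/-- The forms have a common zero on the coordinate subspace spanned by the last `k` coordinates. -/
def HasZeroOnSubspace (φ : Par n d → R) : Prop :=
  ∃ y z : Fin (n + 1) → R, ∑ m, z m * y m = 1 ∧ (∀ m, m.1 + k ≤ n → y m = 0) ∧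
    ∀ i, eval y (form φ i) = 0

end Degenerate

/-! ### Tuples with independent coefficients are not degenerate. -/

section Generic

variable {n k : ℕ} {d : Fin k → ℕ} {F K : Type} [Field F] [Field K] [Algebra F K]

theorem eq_sum_of_isHomogeneous_one {σ R : Type*} [CommSemiring R] [Fintype σ]
    {q : MvPolynomial σ R} (hq : q.IsHomogeneous 1) :
    q = ∑ m, C (coeff (Finsupp.single m 1) q) * X m := by
  classical
  ext m
  simp only [coeff_sum, coeff_C_mul, coeff_X]
  by_cases hm : m.degree = 1
  · obtain ⟨i, rfl⟩ := exists_single_of_degree_eq_one hm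
    rw [Finset.sum_eq_single i]
    · simp
    · intro j _ hj
      rw [if_neg, mul_zero]
      rwa [Finsupp.single_left_inj one_ne_zero]
    · simp
  · rw [hq.coeff_eq_zero hm, Finset.sum_eq_zero]
    intro j _
    rw [if_neg, mul_zero]
    rintro rfl
    simp at hm

theorem aeval_eq_sum_of_isHomogeneous_one {σ R A : Type*} [CommSemiring R] [Fintype σ]
    [CommSemiring A] [Algebra R A]
    {q : MvPolynomial σ R} (hq : q.IsHomogeneous 1) (p : σ → A) :
    aeval p q = ∑ m, coeff (Finsupp.single m 1) q • p m := by
  conv_lhs => rw [eq_sum_of_isHomogeneous_one hq]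
  simp [Algebra.smul_def]

/-- The point contributes n parameters and the ratios uᵢ / u_{i₀} contribute k - 1, while the n
coefficients of one linear part become dependent on the rest and k constant terms vanish: one
parameter too few. -/
theorem not_hasSingularPoint {φ : Par n d → K} (hφ : AlgebraicIndependent F φ)
    (hd : ∀ i, 1 ≤ d i) (c : Fin (n + 1)) : ¬ HasSingularPoint c φ := by
  classical
  rintro ⟨a, u, v, h0, huv, hu⟩
  obtain ⟨i₀, hi₀⟩ : ∃ i, u i ≠ 0 := by
    by_contra hcon
    push Not at hcon
    simp [hcon] at huv
  let w : {i // i ≠ i₀} → K := fun i => u i / u i₀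
  let e₀ : Σ _ : Fin k, ℕ := ⟨i₀, 1⟩
  have he₀ : e₀ ∈ allIdx d := mem_allIdx.2 ⟨le_rfl, hd i₀⟩
  let L := ((allIdx d).erase e₀).toList.map (block φ c a)
  let T := Set.range a ∪ Set.range w ∪ entries L
  have haw := (Set.finite_range a).union (Set.finite_range w)
  have hT : T.Finite := haw.union (entries_finite _)
  have h1 := card_par_le_trk hφ c a h0 (allIdx d).toList fun e he => Finset.mem_toList.2 he
  have hlin : ∀ i, i ≠ i₀ → ∀ m : Fin n →₀ ℕ, coeff m (loc φ c a i 1) ∈ acl F T := by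
    intro i hi m
    by_cases hm : m.degree = 1
    · refine subset_acl _ (Or.inr ⟨block φ c a ⟨i, 1⟩, List.mem_map_of_mem ?_, ⟨m, hm⟩, rfl⟩)
      rw [Finset.mem_toList, Finset.mem_erase]
      exact ⟨fun h => hi (congrArg Sigma.fst h), mem_allIdx.2 ⟨le_rfl, hd i⟩⟩
    · rw [(isHomogeneous_loc φ c a i 1).coeff_eq_zero hm]
      exact zero_mem _
  have h2 : trk F (Set.range a ∪ entries ((allIdx d).toList.map (block φ c a))) ≤ trk F T := by
    refine trk_le_of_subset_acl ((Set.finite_range a).union (entries_finite _)) hT ?_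
    rintro x (hx | ⟨B, hB, m, rfl⟩)
    · exact subset_acl _ (Or.inl (Or.inl hx))
    · obtain ⟨e, he, rfl⟩ := List.mem_map.1 hB
      rw [Finset.mem_toList] at he
      by_cases hee : e = e₀
      · subst hee
        have h3 := congrArg (coeff m.1) hu
        rw [coeff_sum, coeff_zero, ← Finset.add_sum_erase _ _ (Finset.mem_univ i₀)] at h3
        simp only [coeff_C_mul] at h3
        have h4 : coeff m.1 (loc φ c a i₀ 1) =
            - ∑ i ∈ Finset.univ.erase i₀, (u i / u i₀) * coeff m.1 (loc φ c a i 1) := by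
          have : ∑ i ∈ Finset.univ.erase i₀, (u i / u i₀) * coeff m.1 (loc φ c a i 1) =
              (∑ i ∈ Finset.univ.erase i₀, u i * coeff m.1 (loc φ c a i 1)) / u i₀ := by
            rw [Finset.sum_div]
            exact Finset.sum_congr rfl fun i _ => by ring
          rw [this]
          field_simp
          linear_combination h3
        change coeff m.1 (loc φ c a i₀ 1) ∈ acl F T
        rw [h4]
        refine neg_mem (sum_mem fun i hi => mul_mem ?_ (hlin i (Finset.ne_of_mem_erase hi) _))
        exact subset_acl _ (Or.inl (Or.inr ⟨⟨i, Finset.ne_of_mem_erase hi⟩, rfl⟩))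
      · refine subset_acl _ (Or.inr ⟨block φ c a e, List.mem_map_of_mem ?_, m, rfl⟩)
        rw [Finset.mem_toList, Finset.mem_erase]
        exact ⟨hee, he⟩
  have h3 := trk_union_entries_le (F := F) haw L
  have h4 := trk_union_range_le (F := F) (Set.finite_range a) w
  have h5 := trk_range_le (F := F) a
  have h6 : (L.map fun B => Fintype.card (Mon (Fin n) B.1)).sum =
      ∑ e ∈ (allIdx d).erase e₀, Fintype.card (Mon (Fin n) e.2) := by
    rw [List.map_map, ← Finset.sum_map_toList]; rfl
  have h7 := Finset.add_sum_erase _ (fun e => Fintype.card (Mon (Fin n) e.2)) he₀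
  have h8 : Fintype.card (Mon (Fin n) e₀.2) = n := by simp [e₀, card_mon]
  have h9 := card_par n d
  have h10 : Fintype.card {i // i ≠ i₀} + 1 = k := by
    have := i₀.2
    simp; omega
  rw [Fintype.card_fin] at h5
  change trk F T ≤ _ at h3
  omega

/-- A point of a projective space of dimension k - 1 has k - 1 parameters. With the coordinate j₀
normalised to 1, each of the k equations determines the coefficient of the corresponding power of
x_{j₀}. -/
theorem not_hasZeroOnSubspace {φ : Par n d → K} (hφ : AlgebraicIndependent F φ)
    (hkn : k ≤ n) : ¬ HasZeroOnSubspace φ := by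
  classical
  rintro ⟨y₁, z, hz, hy₁, hzero₁⟩
  obtain ⟨j₀, hj₀⟩ : ∃ j, y₁ j ≠ 0 := by
    by_contra hcon
    push Not at hcon
    simp [hcon] at hz
  obtain ⟨y, hy, hzero, hone⟩ : ∃ y : Fin (n + 1) → K, (∀ m, m.1 + k ≤ n → y m = 0) ∧
      (∀ i, eval y (form φ i) = 0) ∧ y j₀ = 1 := by
    refine ⟨fun m => (y₁ j₀)⁻¹ * y₁ m, fun m hm => by simp [hy₁ m hm], fun i => ?_,
      inv_mul_cancel₀ hj₀⟩
    have := aeval_smul_of_isHomogeneous (isHomogeneous_form φ i) (y₁ j₀)⁻¹ y₁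
    rw [aeval_eq_eval, aeval_eq_eval] at this
    change eval _ _ = _ * eval _ _ at this
    rw [this, hzero₁, mul_zero]
  have hj : n < j₀.1 + k := by
    by_contra h
    rw [hy j₀ (by omega)] at hone
    exact zero_ne_one hone
  let e : ∀ i, Mon (Fin (n + 1)) (d i) := fun i => ⟨Finsupp.single j₀ (d i), by simp⟩
  let P := {x : Par n d // x ∉ Set.range fun i => (⟨i, e i⟩ : Par n d)}
  let Y := {m : Fin (n + 1) // n < m.1 + k ∧ m ≠ j₀}
  let T : Set K := Set.range (fun x : P => φ x.1) ∪ Set.range fun m : Y => y m.1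
  have hT : T.Finite := (Set.finite_range _).union (Set.finite_range _)
  have hyT : ∀ m, y m ∈ acl F T := by
    intro m
    by_cases h1 : n < m.1 + k
    · by_cases h2 : m = j₀
      · rw [h2, hone]; exact one_mem _
      · exact subset_acl _ (Or.inr ⟨⟨m, h1, h2⟩, rfl⟩)
    · rw [hy m (by omega)]; exact zero_mem _
  have h1 : Fintype.card (Par n d) ≤ trk F T := by
    rw [← trk_range_of_algebraicIndependent hφ]
    refine trk_le_of_subset_acl (Set.finite_range _) hT ?_
    rintro _ ⟨x, rfl⟩
    by_cases hx : x ∈ Set.range fun i => (⟨i, e i⟩ : Par n d)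
    · obtain ⟨i, rfl⟩ := hx
      have h2 := hzero i
      rw [eval_eq_sum_mon (isHomogeneous_form φ i), ← Finset.add_sum_erase _ _
        (Finset.mem_univ (e i)), coeff_form] at h2
      have h3 : monVal y (e i).1 = 1 := by
        simp [monVal, e, Finsupp.prod_single_index, hone]
      rw [h3, mul_one] at h2
      change φ ⟨i, e i⟩ ∈ acl F T
      rw [eq_neg_of_add_eq_zero_left h2]
      refine neg_mem (sum_mem fun m hm => mul_mem ?_ ?_)
      · rw [coeff_form]
        refine subset_acl _ (Or.inl ⟨⟨⟨i, m⟩, ?_⟩, rfl⟩)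
        rintro ⟨i', hi'⟩
        obtain rfl : i' = i := congrArg Sigma.fst hi'
        exact Finset.ne_of_mem_erase hm (eq_of_heq (Sigma.mk.inj_iff.1 hi').2).symm
      · exact prod_mem fun m _ => pow_mem (hyT m) _
    · exact subset_acl _ (Or.inl ⟨⟨x, hx⟩, rfl⟩)
  have h2 := trk_union_range_le (F := F) (Set.finite_range fun x : P => φ x.1) fun m : Y => y m.1
  have h3 := trk_range_le (F := F) fun x : P => φ x.1
  have h4 : Fintype.card P + k = Fintype.card (Par n d) := by
    have h5 : Fintype.card (Set.range fun i => (⟨i, e i⟩ : Par n d)) = k := by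
      rw [Set.card_range_of_injective fun i i' h => congrArg Sigma.fst h, Fintype.card_fin]
    have h6 : Fintype.card P = Fintype.card (Par n d) -
      Fintype.card (Set.range fun i => (⟨i, e i⟩ : Par n d)) := Fintype.card_subtype_compl _
    have h7 : Fintype.card (Set.range fun i => (⟨i, e i⟩ : Par n d)) ≤ Fintype.card (Par n d) :=
      set_fintype_card_le_univ _
    omega
  have h5 : Fintype.card Y + 1 ≤ k := by
    have h6 : Fintype.card Y ≤ ((Finset.Ico (n + 1 - k) (n + 1)).erase j₀.1).card := by
      rw [← Fintype.card_coe]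
      refine Fintype.card_le_of_injective (fun m : Y => ⟨m.1.1, ?_⟩) ?_
      · have := m.2.1
        have := m.1.2
        rw [Finset.mem_erase, Finset.mem_Ico]
        exact ⟨fun h => m.2.2 (Fin.ext h), by omega, by omega⟩
      · intro m m' h
        exact Subtype.ext (Fin.ext (congrArg Subtype.val h))
    have := j₀.2
    rw [Finset.card_erase_of_mem (by rw [Finset.mem_Ico]; omega), Nat.card_Ico] at h6
    omega
  change trk F T ≤ _ at h2
  omega

/-- Linear relations bound the dimension of the span. -/
theorem card_add_card_le_of_relations {Ω ι κ σ : Type*} [Field Ω] [Algebra K Ω] [Fintype ι]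
    [Fintype κ] [Fintype σ] {p : σ → Ω} {e : ι → σ} (he : LinearIndependent K (p ∘ e))
    {w : κ → σ → K} (hw : LinearIndependent K w) (hrel : ∀ t, ∑ m, w t m • p m = 0) :
    Fintype.card ι + Fintype.card κ ≤ Fintype.card σ := by
  classical
  let T : (σ → K) →ₗ[K] Ω := Fintype.linearCombination K p
  have h1 := T.finrank_range_add_finrank_ker
  have h2 : Fintype.card κ ≤ Module.finrank K (LinearMap.ker T) :=
    card_le_finrank_of_mem hw fun t => by
      rw [LinearMap.mem_ker, Fintype.linearCombination_apply]; exact hrel t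
  have h3 : Fintype.card ι ≤ Module.finrank K (LinearMap.range T) :=
    card_le_finrank_of_mem he fun i => by
      refine ⟨Pi.single (e i) 1, ?_⟩
      simp [T, Fintype.linearCombination_apply, Pi.single_apply]
  rw [Module.finrank_fintype_fun_eq_card] at h1
  omega

/-- The bound on r holds because the k linear parts and the s forms l are independent linear
relations among the coordinates of p. The remaining conclusions are the parameter count applied to
subsystems of X. -/
theorem exists_rank_of_hasDegeneratePoint [IsAlgClosed K] {φ : Par n d → K}
    (hφ : AlgebraicIndependent F φ) (hd : ∀ i, 1 ≤ d i) (hk : 2 ≤ k) {X : Finset (Σ _ : Fin k, ℕ)}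
    (hX : X ⊆ allIdx d) (hX1 : ∀ i, ⟨i, 1⟩ ∈ X) {s : ℕ} {c : Fin (n + 1)}
    (h : HasDegeneratePoint X s c φ) :
    ∃ r, r + 1 + (k + s) ≤ n ∧ ∀ Y ⊆ X, (∀ i, ⟨i, 1⟩ ∈ Y) → ∀ M, n = M + k → 4 * k + 1 ≤ M →
      (Y.card + 2 = M + k → M < r + 2) ∧ (Y.card + 1 = M + k → r + 1 ≠ M) := by
  classical
  obtain ⟨a, l, v, h0, hv, hlv, hyp⟩ := h
  let lf : Fin s → MvPolynomial (Fin n) K := fun t => ∑ m, C (l t m) * MvPolynomial.X m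
  have hlf : ∀ t, (lf t).IsHomogeneous 1 := fun t =>
    IsHomogeneous.sum _ _ _ fun m _ => by
      simpa using (isHomogeneous_C (Fin n) (l t m)).mul (isHomogeneous_X K m)
  have hlfe : ∀ t (y : Fin n → K), eval y (lf t) = ∑ m, l t m * y m := fun t y => by simp [lf]
  let Q : Set (MvPolynomial (Fin n) K) :=
    {q | ∃ e ∈ X, q = loc φ c a e.1 e.2} ∪ Set.range lf
  obtain ⟨Ω, _, _, p, i₀, hp1, hp, hQ⟩ := exists_nonconstant_zero Q (by
      rintro q (⟨e, -, rfl⟩ | ⟨t, rfl⟩)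
      · exact ⟨_, isHomogeneous_loc φ c a _ _⟩
      · exact ⟨_, hlf t⟩) (by
    intro h
    obtain ⟨y, z, hz, hh, hl, hX⟩ := hyp h
    refine ⟨y, ?_, hh, ?_⟩
    · rintro rfl
      simp at hz
    · rintro q (⟨e, he, rfl⟩ | ⟨t, rfl⟩)
      · exact hX e he
      · rw [hlfe, hl])
  obtain ⟨r, ⟨e, he⟩, hr⟩ := exists_rank_of_common_zero hφ c a h0 p hp1 hp hk
  refine ⟨r, ?_, fun Y hY hY1 => hr Y (hY.trans hX) hY1 fun e he => hQ _ (Or.inl ⟨e, hY he, rfl⟩)⟩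
  let w : Fin k ⊕ Fin s → Fin n → K :=
    Sum.elim (fun i m => coeff (Finsupp.single m 1) (loc φ c a i 1)) l
  have hw : LinearIndependent K w := by
    rw [Fintype.linearIndependent_iff]
    intro g hg
    have hg' : ∀ m, ∑ i, g (Sum.inl i) * coeff (Finsupp.single m 1) (loc φ c a i 1) +
        ∑ t, g (Sum.inr t) * l t m = 0 := fun m => by
      have := congrFun hg m
      simpa [w, Fintype.sum_sum_type] using this
    -- Pair the relation with v t, which is annihilated by the linear parts and dual to l.
    have hr0 : ∀ t, g (Sum.inr t) = 0 := by
      intro t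
      have h1 : ∑ m, (∑ i, g (Sum.inl i) * coeff (Finsupp.single m 1) (loc φ c a i 1) +
        ∑ t, g (Sum.inr t) * l t m) * v t m = 0 := by simp [hg']
      simp only [add_mul, Finset.sum_add_distrib, Finset.sum_mul] at h1
      rw [Finset.sum_comm, Finset.sum_comm (f := fun m t' => g (Sum.inr t') * l t' m * v t m)] at h1
      have h2 : ∀ i, ∑ m, g (Sum.inl i) * coeff (Finsupp.single m 1) (loc φ c a i 1) * v t m = 0 := by
        intro i
        have h3 := aeval_eq_sum_of_isHomogeneous_one (isHomogeneous_loc φ c a i 1) (v t)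
        rw [aeval_eq_eval] at h3
        change eval _ _ = _ at h3
        rw [hv] at h3
        simp only [mul_assoc, ← Finset.mul_sum]
        simp only [smul_eq_mul] at h3
        rw [← h3, mul_zero]
      have h4 : ∀ t', ∑ m, g (Sum.inr t') * l t' m * v t m = if t' = t then g (Sum.inr t') else 0 := by
        intro t'
        simp only [mul_assoc, ← Finset.mul_sum, hlv]
        split_ifs <;> simp
      simpa [h2, h4] using h1
    -- What remains is a relation between the linear parts, that is, a singular point.
    have hl0 : ∀ i, g (Sum.inl i) = 0 := by
      by_contra hcon
      push Not at hcon
      obtain ⟨i, hi⟩ := hcon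
      refine not_hasSingularPoint hφ hd c ⟨a, fun i => g (Sum.inl i),
        Pi.single i (g (Sum.inl i))⁻¹, h0, ?_, ?_⟩
      · simp [Pi.single_apply, hi]
      · have h5 : ∀ i, loc φ c a i 1 = _ := fun i =>
          eq_sum_of_isHomogeneous_one (isHomogeneous_loc φ c a i 1)
        have h6 : ∑ i, C (g (Sum.inl i)) * loc φ c a i 1 = ∑ m : Fin n,
            C (∑ i, g (Sum.inl i) * coeff (Finsupp.single m 1) (loc φ c a i 1)) * MvPolynomial.X m := by
          conv_lhs => enter [2, i]; rw [h5 i]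
          simp only [Finset.mul_sum, map_sum, Finset.sum_mul]
          rw [Finset.sum_comm]
          exact Finset.sum_congr rfl fun m _ => Finset.sum_congr rfl fun i _ => by
            rw [C_mul]; ring
        rw [h6]
        refine Finset.sum_eq_zero fun m _ => ?_
        have h7 := hg' m
        simp only [hr0, zero_mul, Finset.sum_const_zero, add_zero] at h7
        rw [h7, C_0, zero_mul]
    rintro (i | t)
    · exact hl0 i
    · exact hr0 t
  have := card_add_card_le_of_relations he hw (by
    rintro (i | t)
    · rw [← hQ _ (Or.inl ⟨⟨i, 1⟩, hX1 i, rfl⟩)]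
      exact (aeval_eq_sum_of_isHomogeneous_one (isHomogeneous_loc φ c a i 1) p).symm
    · have := hQ _ (Or.inr ⟨t, rfl⟩)
      simpa [lf, w, Algebra.smul_def] using this)
  simpa using this

end Generic

/-! ### The open set of generic tuples -/

section Transfer

variable {n k : ℕ} {d : Fin k → ℕ}

theorem map_eval_eq {R R' σ : Type*} [CommSemiring R] [CommSemiring R'] (g : R →+* R') (y : σ → R)
    (f : MvPolynomial σ R) : g (eval y f) = eval (fun i => g (y i)) (map g f) := by
  rw [eval_map, ← RingHom.comp_apply]
  have : g.comp (eval y) = eval₂Hom g fun i => g (y i) :=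
    ringHom_ext (fun r => by simp) fun i => by simp
  rw [this]; rfl

theorem coeff_zero_map_dehomR {R R' : Type*} [CommRing R] [CommRing R'] (g : R →+* R')
    (φ : Par n d → R) (c : Fin (n + 1)) (a : Fin n → R) (i : Fin k) :
    coeff 0 (dehomR c (fun m => g (a m)) (form (fun x => g (φ x)) i)) =
      g (coeff 0 (dehomR c a (form φ i))) := by
  rw [← map_form, ← map_dehomR, coeff_map]

theorem eq_zero_of_forall_map_eval {B σ : Type*} (f : MvPolynomial σ (B → ℂ))
    (h : ∀ b, map (Pi.evalRingHom (fun _ : B => ℂ) b) f = 0) : f = 0 := by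
  ext m b
  have := congrArg (coeff m) (h b)
  rwa [coeff_map] at this

/-- A condition on tuples of forms that is compatible with products and quotients of rings and
fails for tuples of independent coefficients is contained in a hypersurface. -/
theorem exists_polynomial_of_transfer (P : ∀ (R : Type) [CommRing R], (Par n d → R) → Prop)
    (hprod : ∀ (B : Type) (φ : B → Par n d → ℂ), (∀ b, P ℂ (φ b)) → P (B → ℂ) fun x b => φ b x)
    (hpush : ∀ (R R' : Type) [CommRing R] [CommRing R'] (g : R →+* R') (_ : Function.Surjective g)
      (φ : Par n d → R), P R φ → P R' fun x => g (φ x))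
    (hno : ∀ (K : Type) [Field K] [Algebra ℂ K] [IsAlgClosed K] (φ : Par n d → K),
      AlgebraicIndependent ℂ φ → ¬ P K φ) :
    ∃ G : MvPolynomial (Par n d) ℂ, G ≠ 0 ∧ ∀ φ, P ℂ φ → eval φ G = 0 := by
  by_contra hcon
  push Not at hcon
  obtain ⟨K, _, _, _, π, hπ, hind⟩ := exists_generic_point {φ : Par n d → ℂ | P ℂ φ} hcon
  exact hno K _ hind (hpush _ _ π.toRingHom hπ _
    (hprod {φ : Par n d → ℂ | P ℂ φ} (fun b => b.1) fun b => b.2))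

theorem exists_polynomial_hasSingularPoint (hd : ∀ i, 1 ≤ d i) (c : Fin (n + 1)) :
    ∃ G : MvPolynomial (Par n d) ℂ, G ≠ 0 ∧ ∀ φ, HasSingularPoint c φ → eval φ G = 0 := by
  refine exists_polynomial_of_transfer (fun R _ φ => HasSingularPoint c φ) ?_ ?_
    fun K _ _ _ φ hφ => not_hasSingularPoint hφ hd c
  · intro B φ h
    choose a u v h0 huv hu using h
    refine ⟨fun m b => a b m, fun i b => u b i, fun i b => v b i, fun i => ?_, ?_, ?_⟩
    · funext b
      rw [← Pi.evalRingHom_apply (fun _ => ℂ) b (coeff 0 _), ← coeff_zero_map_dehomR]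
      exact h0 b i
    · funext b
      simpa using huv b
    · refine eq_zero_of_forall_map_eval _ fun b => ?_
      rw [map_sum, ← hu b]
      refine Finset.sum_congr rfl fun i _ => ?_
      rw [map_mul, map_C, map_loc]
      rfl
  · rintro R R' _ _ g - φ ⟨a, u, v, h0, huv, hu⟩
    refine ⟨fun m => g (a m), fun i => g (u i), fun i => g (v i), fun i => ?_, ?_, ?_⟩
    · rw [coeff_zero_map_dehomR, h0, map_zero]
    · rw [← map_one g, ← huv, map_sum]
      simp
    · rw [← map_zero (map g), ← hu, map_sum]
      refine Finset.sum_congr rfl fun i _ => ?_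
      rw [map_mul, map_C, map_loc]

theorem exists_polynomial_hasZeroOnSubspace (hkn : k ≤ n) :
    ∃ G : MvPolynomial (Par n d) ℂ, G ≠ 0 ∧ ∀ φ, HasZeroOnSubspace φ → eval φ G = 0 := by
  refine exists_polynomial_of_transfer (fun R _ φ => HasZeroOnSubspace φ) ?_ ?_
    fun K _ _ _ φ hφ => not_hasZeroOnSubspace hφ hkn
  · intro B φ h
    choose y z hz hy h0 using h
    refine ⟨fun m b => y b m, fun i b => z b i, ?_, fun m hm => ?_, fun i => ?_⟩
    · funext b
      simpa using hz b
    · funext b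
      exact hy b m hm
    · funext b
      rw [← Pi.evalRingHom_apply (fun _ => ℂ) b (eval _ _), map_eval_eq, map_form]
      exact h0 b i
  · rintro R R' _ _ g - φ ⟨y, z, hz, hy, h0⟩
    refine ⟨fun m => g (y m), fun i => g (z i), ?_, fun m hm => ?_, fun i => ?_⟩
    · rw [← map_one g, ← hz, map_sum]
      simp
    · simp only [hy m hm, map_zero]
    · rw [← map_form, ← map_eval_eq, h0, map_zero]

theorem exists_polynomial_hasDegeneratePoint (hd : ∀ i, 1 ≤ d i) (hk : 2 ≤ k)
    {X : Finset (Σ _ : Fin k, ℕ)} (hX : X ⊆ allIdx d) (hX1 : ∀ i, ⟨i, 1⟩ ∈ X) (s : ℕ)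
    (c : Fin (n + 1)) (hfalse : ∀ r, r + 1 + (k + s) ≤ n →
      ¬ ∀ Y ⊆ X, (∀ i, ⟨i, 1⟩ ∈ Y) → ∀ M, n = M + k → 4 * k + 1 ≤ M →
      (Y.card + 2 = M + k → M < r + 2) ∧ (Y.card + 1 = M + k → r + 1 ≠ M)) :
    ∃ G : MvPolynomial (Par n d) ℂ, G ≠ 0 ∧ ∀ φ, HasDegeneratePoint X s c φ → eval φ G = 0 := by
  refine exists_polynomial_of_transfer (fun R _ φ => HasDegeneratePoint X s c φ) ?_ ?_
    fun K _ _ _ φ hφ h => ?_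
  · intro B φ h
    choose a l v h0 hv hlv hyp using h
    refine ⟨fun m b => a b m, fun t m b => l b t m, fun t m b => v b t m, fun i => ?_,
      fun i t => ?_, fun t t' => ?_, fun h => ?_⟩
    · funext b
      rw [← Pi.evalRingHom_apply (fun _ => ℂ) b (coeff 0 _), ← coeff_zero_map_dehomR]
      exact h0 b i
    · funext b
      rw [← Pi.evalRingHom_apply (fun _ => ℂ) b (eval _ _), map_eval_eq, map_loc]
      exact hv b i t
    · funext b
      have := hlv b t t'
      split_ifs with htt <;> simpa [htt] using this
    · choose y z hz hh hl he using fun b => hyp b fun m => h m b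
      refine ⟨fun m b => y b m, fun m b => z b m, ?_, ?_, fun t => ?_, fun e heX => ?_⟩
      · funext b
        simpa using hz b
      · funext b
        simpa using hh b
      · funext b
        simpa using hl b t
      · funext b
        rw [← Pi.evalRingHom_apply (fun _ => ℂ) b (eval _ _), map_eval_eq, map_loc]
        exact he b e heX
  · rintro R R' _ _ g hg φ ⟨a, l, v, h0, hv, hlv, hyp⟩
    have hsum : ∀ u w : Fin n → R, ∑ m, g (u m) * g (w m) = g (∑ m, u m * w m) := by simp
    refine ⟨fun m => g (a m), fun t m => g (l t m), fun t m => g (v t m), fun i => ?_,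
      fun i t => ?_, fun t t' => ?_, fun h => ?_⟩
    · rw [coeff_zero_map_dehomR, h0, map_zero]
    · rw [← map_loc, ← map_eval_eq, hv, map_zero]
    · rw [hsum, hlv]
      split_ifs <;> simp
    -- Every hyperplane over R' has to be lifted to R; this is where surjectivity is used.
    · choose h' hh' using fun m => hg (h m)
      obtain ⟨y, z, hz, hh, hl, he⟩ := hyp h'
      refine ⟨fun m => g (y m), fun m => g (z m), ?_, ?_, fun t => ?_, fun e heX => ?_⟩
      · rw [hsum, hz, map_one]
      · simp only [← hh']
        rw [hsum, hh, map_zero]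
      · rw [hsum, hl, map_zero]
      · rw [← map_loc, ← map_eval_eq, he e heX, map_zero]
  · obtain ⟨r, hr, hY⟩ := exists_rank_of_hasDegeneratePoint hφ hd hk hX hX1 h
    exact hfalse r hr hY

/-- The tuples of forms avoiding all degenerations. -/
structure IsGeneral (hk : 2 ≤ k) (φ : Par n d → ℂ) : Prop where
  singular : ∀ c, ¬ HasSingularPoint c φ
  strong : ∀ c, ¬ HasDegeneratePoint (strongIdx hk d) 1 c φ
  reg : ∀ c, ¬ HasDegeneratePoint (regIdx hk d) 0 c φ
  subspace : ¬ HasZeroOnSubspace φ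

theorem exists_polynomial_isGeneral {M : ℕ} (hk : 2 ≤ k) (hM : 4 * k + 1 ≤ M) (hmono : Monotone d)
    (hd : ∀ i, 2 ≤ d i) (hsum : ∑ i, d i = M + k) (hn : n = M + k) :
    ∃ G : MvPolynomial (Par n d) ℂ, G ≠ 0 ∧ ∀ φ, eval φ G ≠ 0 →
      IsGeneral hk φ ∧ ∀ i, form φ i ≠ 0 := by
  classical
  have hd1 : ∀ i, 1 ≤ d i := fun i => (by norm_num : 1 ≤ 2).trans (hd i)
  have hone := one_mem_strongIdx hk hmono hd
  have hsr := strongIdx_subset hk (d := d)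
  have hra := regIdx_subset hk (d := d)
  have hcs := card_strongIdx hk hd
  have hcr := card_regIdx hk hd
  choose G₁ hG₁ hG₁' using exists_polynomial_hasSingularPoint (n := n) hd1
  -- With s = 1 the linear relations give r ≤ M - 2, which the count for `strongIdx` forbids.
  choose G₂ hG₂ hG₂' using fun c => exists_polynomial_hasDegeneratePoint (n := n) hd1 hk
    (hsr.trans hra) hone 1 c (fun r hr h => by
      have := (h _ le_rfl hone M hn hM).1 (hcs.trans hsum)
      omega)
  -- With s = 0 only r ≤ M - 1 is known. The subsystem `strongIdx` excludes r ≤ M - 2, and the full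
  -- system, with one more equation, excludes r = M - 1.
  choose G₃ hG₃ hG₃' using fun c => exists_polynomial_hasDegeneratePoint (n := n) hd1 hk
    hra (fun i => hsr (hone i)) 0 c (fun r hr h => by
      have h1 := (h _ hsr hone M hn hM).1 (hcs.trans hsum)
      have h2 := (h _ le_rfl (fun i => hsr (hone i)) M hn hM).2 (hcr.trans hsum)
      omega)
  obtain ⟨G₄, hG₄, hG₄'⟩ := exists_polynomial_hasZeroOnSubspace (n := n) (d := d) (by omega)
  let e : ∀ i, Mon (Fin (n + 1)) (d i) := fun i => ⟨Finsupp.single 0 (d i), by simp⟩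
  -- The last factors, the coefficients of the powers of x₀, keep every form non-zero so that it
  -- defines a projective point.
  refine ⟨(∏ c, G₁ c * G₂ c * G₃ c) * G₄ * ∏ i, X ⟨i, e i⟩, ?_, fun φ hφ => ?_⟩
  · refine mul_ne_zero (mul_ne_zero (Finset.prod_ne_zero_iff.2 fun c _ =>
      mul_ne_zero (mul_ne_zero (hG₁ c) (hG₂ c)) (hG₃ c)) hG₄)
      (Finset.prod_ne_zero_iff.2 fun i _ => X_ne_zero _)
  · simp only [map_mul, map_prod, eval_X, mul_ne_zero_iff, Finset.prod_ne_zero_iff,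
      Finset.mem_univ, true_imp_iff] at hφ
    obtain ⟨⟨h1, h2⟩, h3⟩ := hφ
    refine ⟨⟨fun c h => (h1 c).1.1 (hG₁' c φ h), fun c h => (h1 c).1.2 (hG₂' c φ h),
      fun c h => (h1 c).2 (hG₃' c φ h), fun h => h2 (hG₄' φ h)⟩, fun i h => h3 i ?_⟩
    rw [← coeff_form φ i (e i), h, coeff_zero]

end Transfer

/-! ### Rescaling the equations and descent to the product of projective spaces. -/

section Scaling

variable {n k : ℕ} {d : Fin k → ℕ}

/-- Multiplication of the forms by constants. -/
def scale (t : Fin k → ℂ) (φ : Par n d → ℂ) : Par n d → ℂ := fun x => t x.1 * φ x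

theorem form_scale (t : Fin k → ℂ) (φ : Par n d → ℂ) (i : Fin k) :
    form (scale t φ) i = C (t i) * form φ i := by
  simp only [form, scale, Finset.mul_sum, C_mul_monomial]

theorem dehomR_C_mul (c : Fin (n + 1)) (a : Fin n → ℂ) (t : ℂ) (f : MvPolynomial (Fin (n + 1)) ℂ) :
    dehomR c a (C t * f) = C t * dehomR c a f := by
  simp [dehomR, algebraMap_eq]

theorem loc_scale (t : Fin k → ℂ) (φ : Par n d → ℂ) (c : Fin (n + 1)) (a : Fin n → ℂ) (i : Fin k)
    (j : ℕ) : loc (scale t φ) c a i j = C (t i) * loc φ c a i j := by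
  rw [loc, form_scale, dehomR_C_mul, homogeneousComponent_C_mul, loc]

theorem IsGeneral.of_scale {hk : 2 ≤ k} {t : Fin k → ℂ} (ht : ∀ i, t i ≠ 0) {φ : Par n d → ℂ}
    (h : IsGeneral hk (scale t φ)) : IsGeneral hk φ := by
  have hdeg : ∀ X s c, HasDegeneratePoint X s c φ → HasDegeneratePoint X s c (scale t φ) := by
    rintro X s c ⟨a, l, v, h0, hv, hlv, hyp⟩
    refine ⟨a, l, v, fun i => ?_, fun i t => ?_, hlv, fun h => ?_⟩
    · rw [form_scale, dehomR_C_mul, coeff_C_mul, h0, mul_zero]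
    · rw [loc_scale, map_mul, hv, mul_zero]
    · obtain ⟨y, z, hz, hh, hl, he⟩ := hyp h
      exact ⟨y, z, hz, hh, hl, fun e heX => by rw [loc_scale, map_mul, he e heX, mul_zero]⟩
  refine ⟨fun c hc => h.singular c ?_, fun c hc => h.strong c (hdeg _ _ _ hc),
    fun c hc => h.reg c (hdeg _ _ _ hc), fun hc => h.subspace ?_⟩
  · obtain ⟨a, u, v, h0, huv, hu⟩ := hc
    refine ⟨a, fun i => u i / t i, fun i => t i * v i, fun i => ?_, ?_, ?_⟩
    · rw [form_scale, dehomR_C_mul, coeff_C_mul, h0, mul_zero]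
    · rw [← huv]
      refine Finset.sum_congr rfl fun i _ => ?_
      have := ht i
      field_simp
    · rw [← hu]
      refine Finset.sum_congr rfl fun i _ => ?_
      rw [loc_scale, ← mul_assoc, ← C_mul, div_mul_cancel₀ _ (ht i)]
  · obtain ⟨y, z, hz, hy, h0⟩ := hc
    exact ⟨y, z, hz, hy, fun i => by rw [form_scale, map_mul, h0, mul_zero]⟩

/-- The coefficients of the equations of a member of the parameter space. -/
noncomputable def coeffs (F : ParamSpace n d) : Par n d → ℂ := fun x => coeff x.2.1 (eqns F x.1)

theorem form_coeff {f : MvPolynomial (Fin (n + 1)) ℂ} {i : Fin k} (hf : f.IsHomogeneous (d i))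
    {φ : Par n d → ℂ} (hφ : ∀ m : Mon (Fin (n + 1)) (d i), φ ⟨i, m⟩ = coeff m.1 f) :
    form φ i = f := by
  ext m
  by_cases hm : m.degree = d i
  · exact (coeff_form φ i ⟨m, hm⟩).trans (hφ ⟨m, hm⟩)
  · rw [hf.coeff_eq_zero hm, (isHomogeneous_form φ i).coeff_eq_zero hm]

theorem isHomogeneous_eqns (F : ParamSpace n d) (i : Fin k) : (eqns F i).IsHomogeneous (d i) :=
  (mem_homogeneousSubmodule _ _).1 (F i).rep.2

theorem form_coeffs (F : ParamSpace n d) (i : Fin k) : form (coeffs F) i = eqns F i :=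
  form_coeff (isHomogeneous_eqns F i) fun _ => rfl

/-- A hypersurface in the space of coefficients defines a non-empty open set of tuples having,
after scaling, coefficients outside of it. -/
theorem exists_isZariskiOpen (G : MvPolynomial (Par n d) ℂ) (hG : G ≠ 0)
    (hG' : ∀ φ, eval φ G ≠ 0 → ∀ i, form φ i ≠ 0) :
    ∃ U : Set (ParamSpace n d), U.Nonempty ∧ IsZariskiOpen U ∧
      ∀ F ∈ U, ∃ t : Fin k → ℂ, (∀ i, t i ≠ 0) ∧ eval (scale t (coeffs F)) G ≠ 0 := by
  classical
  -- Allowing all rescalings removes the dependence on representatives. The set remains open, as a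
  -- union of non-vanishing loci.
  let U : Set (ParamSpace n d) :=
    {F | ∃ t : Fin k → ℂ, (∀ i, t i ≠ 0) ∧ eval (scale t (coeffs F)) G ≠ 0}
  have hU : ∀ (f : (i : Fin k) → homogeneousSubmodule (Fin (n + 1)) ℂ (d i)) (hf : ∀ i, f i ≠ 0),
      (fun i => Projectivization.mk ℂ (f i) (hf i)) ∈ U ↔ ∃ t : Fin k → ℂ, (∀ i, t i ≠ 0) ∧
        eval (scale t fun x => coeff x.2.1 (f x.1 : MvPolynomial (Fin (n + 1)) ℂ)) G ≠ 0 := by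
    intro f hf
    choose w hw using fun i => Projectivization.exists_smul_eq_mk_rep ℂ (f i) (hf i)
    have hc : coeffs (fun i => Projectivization.mk ℂ (f i) (hf i)) =
        scale (fun i => (w i : ℂ)) fun x => coeff x.2.1 (f x.1 : MvPolynomial (Fin (n + 1)) ℂ) := by
      funext x
      simp only [coeffs, eqns, scale, ← hw]
      simp [Units.smul_def]
    have hs : ∀ (t u : Fin k → ℂ) (φ : Par n d → ℂ), scale t (scale u φ) =
        scale (fun i => t i * u i) φ := fun t u φ => by
      funext x; simp only [scale]; ring
    constructor
    · rintro ⟨t, ht, h⟩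
      rw [hc, hs] at h
      exact ⟨_, fun i => mul_ne_zero (ht i) (w i).ne_zero, h⟩
    · rintro ⟨t, ht, h⟩
      refine ⟨fun i => t i / w i, fun i => div_ne_zero (ht i) (w i).ne_zero, ?_⟩
      rw [hc, hs]
      have : (fun i => t i / (w i : ℂ) * (w i : ℂ)) = t :=
        funext fun i => div_mul_cancel₀ _ (w i).ne_zero
      rwa [this]
  refine ⟨U, ?_, ?_, fun F hF => hF⟩
  · obtain ⟨φ, hφ⟩ : ∃ φ, eval φ G ≠ 0 := by
      by_contra hcon
      push Not at hcon
      exact hG (MvPolynomial.funext fun φ => by rw [hcon, map_zero])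
    let f : (i : Fin k) → homogeneousSubmodule (Fin (n + 1)) ℂ (d i) := fun i =>
      ⟨form φ i, (mem_homogeneousSubmodule _ _).2 (isHomogeneous_form φ i)⟩
    have hf : ∀ i, f i ≠ 0 := fun i h => hG' φ hφ i (congrArg Subtype.val h)
    refine ⟨_, (hU f hf).2 ⟨fun _ => 1, fun _ => one_ne_zero, ?_⟩⟩
    convert hφ using 3
    funext x
    simp only [scale, one_mul, f]
    exact coeff_form φ x.1 x.2
  · refine ⟨{H | ∃ t : Fin k → ℂ, (∀ i, t i ≠ 0) ∧
      H = aeval (fun x : Par n d => C (t x.1) * X (x.1, x.2.1)) G}, fun f hf => ?_⟩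
    rw [hU f hf]
    have he : ∀ t : Fin k → ℂ,
        eval (fun im => coeff im.2 (f im.1 : MvPolynomial (Fin (n + 1)) ℂ))
          (aeval (fun x : Par n d => C (t x.1) * X (x.1, x.2.1)) G :
            MvPolynomial (Fin k × (Fin (n + 1) →₀ ℕ)) ℂ) =
        eval (scale t fun x => coeff x.2.1 (f x.1 : MvPolynomial (Fin (n + 1)) ℂ)) G := by
      intro t
      rw [← coe_aeval_eq_eval, ← coe_aeval_eq_eval, RingHom.coe_coe, RingHom.coe_coe,
        ← AlgHom.comp_apply]
      congr 1
      refine algHom_ext fun x => ?_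
      simp [scale]
    constructor
    · rintro ⟨t, ht, h⟩
      exact ⟨_, ⟨t, ht, rfl⟩, by rwa [he]⟩
    · rintro ⟨_, ⟨t, ht, rfl⟩, h⟩
      exact ⟨t, ht, by rwa [he] at h⟩

end Scaling

/-! ### Systems of parameters in Cohen–Macaulay rings -/

section Depth

open CategoryTheory Abelian Limits RingTheory.Sequence IsLocalRing
open scoped Pointwise

variable {R : Type} [CommRing R] [IsLocalRing R] [IsNoetherianRing R]

variable (R) in
/-- The depth of a module over a local ring is at least `n`, expressed by the vanishing of `Ext`. -/
def DepthGE (n : ℕ) (M : Type) [AddCommGroup M] [Module R M] : Prop :=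
  ∀ i < n, Subsingleton
    (Ext (ModuleCat.of R (R ⧸ maximalIdeal R)) (ModuleCat.of R M) i)

variable {M : Type} [AddCommGroup M] [Module R M]

theorem DepthGE.quotSMulTop {n : ℕ} (h : DepthGE R (n + 1) M) {x : R} (hx : IsSMulRegular M x) :
    DepthGE R n (QuotSMulTop x M) := by
  intro i hi
  have zero1 := AddCommGrpCat.isZero_of_iff_subsingleton.mpr (h i (by omega))
  have zero2 := AddCommGrpCat.isZero_of_iff_subsingleton.mpr (h (i + 1) (by omega))
  have hx' : IsSMulRegular (ModuleCat.of R M) x := hx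
  exact AddCommGrpCat.subsingleton_of_isZero <| ShortComplex.Exact.isZero_of_both_zeros
    ((Ext.covariant_sequence_exact₃' (ModuleCat.of R (R ⧸ maximalIdeal R))
      hx'.smulShortComplex_shortExact) i (i + 1) rfl)
    (zero1.eq_zero_of_src _) (zero2.eq_zero_of_tgt _)

theorem DepthGE.exists_isSMulRegular [Module.Finite R M] {n : ℕ} (h : DepthGE R (n + 1) M) :
    ∃ x ∈ maximalIdeal R, IsSMulRegular M x := by
  have : Subsingleton (ModuleCat.of R (R ⧸ maximalIdeal R) ⟶ ModuleCat.of R M) :=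
    Ext.addEquiv₀.subsingleton_congr.mp (h 0 n.zero_lt_succ)
  have : Subsingleton ((R ⧸ maximalIdeal R) →ₗ[R] M) :=
    (ModuleCat.homAddEquiv (M := ModuleCat.of R (R ⧸ maximalIdeal R))
      (N := ModuleCat.of R M)).symm.subsingleton
  obtain ⟨x, hx, hreg⟩ := IsSMulRegular.subsingleton_linearMap_iff.mp this
  rw [Ideal.annihilator_quotient] at hx
  exact ⟨x, hx, hreg⟩

theorem depthGE_of_isRegular {rs : List R} (hrs : IsRegular R rs)
    (hmem : ∀ r ∈ rs, r ∈ maximalIdeal R) : DepthGE R rs.length R := by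
  intro i hi
  refine ModuleCat.subsingleton_ext_of_exists_isRegular (maximalIdeal R) _ ?_
    (ModuleCat.of R R) ?_ rs hmem hrs i hi
  · rw [Module.support_eq_zeroLocus, Ideal.annihilator_quotient]
  · change maximalIdeal R • (⊤ : Ideal R) < ⊤
    rw [smul_eq_mul, Ideal.mul_top]
    exact lt_top_iff_ne_top.2 (maximalIdeal.isMaximal R).ne_top

/-- The elements N of M killed by P do not all lie in xM: otherwise regularity of x gives N = xN,
and N = 0 by Nakayama. The class of such an element is killed by P and by x, and an associated prime
containing its annihilator is strictly larger because x ∉ P. -/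
theorem exists_lt_associatedPrime_quotSMulTop [Module.Finite R M] {x : R}
    (hxm : x ∈ maximalIdeal R) (hx : IsSMulRegular M x) {P : Ideal R}
    (hP : P ∈ associatedPrimes R M) :
    ∃ Q ∈ associatedPrimes R (QuotSMulTop x M), P < Q := by
  obtain ⟨hPp, m, hm⟩ := isAssociatedPrime_iff.1 (AssociatedPrimes.mem_iff.1 hP)
  let N : Submodule R M := Submodule.torsionBySet R M P
  have hmN : m ∈ N := by
    rw [Submodule.mem_torsionBySet_iff]
    rintro ⟨a, ha⟩
    rw [SetLike.mem_coe, hm, Submodule.mem_colon_singleton, Submodule.mem_bot] at ha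
    exact ha
  have hm0 : m ≠ 0 := by
    rintro rfl
    apply hPp.ne_top
    rw [hm, Ideal.eq_top_iff_one, Submodule.mem_colon_singleton]
    simp
  have hxP : x ∉ P := by
    intro h
    rw [hm, Submodule.mem_colon_singleton, Submodule.mem_bot] at h
    exact hm0 (hx (by simpa using h))
  obtain ⟨m', hm', hm'x⟩ : ∃ m' ∈ N, m' ∉ x • (⊤ : Submodule R M) := by
    by_contra hcon
    push Not at hcon
    have hle : N ≤ maximalIdeal R • N := by
      intro a ha
      obtain ⟨b, -, hb⟩ := (Submodule.mem_smul_pointwise_iff_exists _ _ _).1 (hcon a ha)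
      rw [← hb]
      refine Submodule.smul_mem_smul hxm ?_
      rw [Submodule.mem_torsionBySet_iff] at ha ⊢
      intro p
      apply hx
      have := ha p
      rw [← hb, smul_comm] at this
      simpa using this
    have := Submodule.eq_bot_of_le_smul_of_le_jacobson_bot _ N (IsNoetherian.noetherian N) hle
      (IsLocalRing.maximalIdeal_le_jacobson ⊥)
    rw [this, Submodule.mem_bot] at hmN
    exact hm0 hmN
  have hne : (Submodule.Quotient.mk m' : QuotSMulTop x M) ≠ 0 := by
    rwa [ne_eq, Submodule.Quotient.mk_eq_zero]
  obtain ⟨Q, hQ, hle⟩ := exists_le_isAssociatedPrime_of_isNoetherianRing R _ hne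
  refine ⟨Q, hQ, lt_of_le_of_ne (fun p hp => hle ?_) ?_⟩
  · rw [Submodule.mem_colon_singleton, Submodule.mem_bot, ← Submodule.Quotient.mk_smul]
    rw [Submodule.mem_torsionBySet_iff] at hm'
    rw [hm' ⟨p, hp⟩, Submodule.Quotient.mk_zero]
  · rintro rfl
    refine hxP (hle ?_)
    rw [Submodule.mem_colon_singleton, Submodule.mem_bot, ← Submodule.Quotient.mk_smul,
      Submodule.Quotient.mk_eq_zero]
    exact Submodule.smul_mem_pointwise_smul _ _ _ Submodule.mem_top

theorem ringKrullDim_quotient_succ_le_of_lt {P Q : Ideal R} [P.IsPrime] (h : P < Q) :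
    ringKrullDim (R ⧸ Q) + 1 ≤ ringKrullDim (R ⧸ P) := by
  obtain ⟨r, hrQ, hrP⟩ := SetLike.exists_of_lt h
  refine ringKrullDim_succ_le_of_surjective (Ideal.Quotient.factor h.le)
    (Ideal.Quotient.factor_surjective h.le) (r := Ideal.Quotient.mk P r) ?_ ?_
  · rw [mem_nonZeroDivisors_iff_ne_zero, ne_eq, Ideal.Quotient.eq_zero_iff_mem]
    exact hrP
  · rw [Ideal.Quotient.factor_mk, Ideal.Quotient.eq_zero_iff_mem]
    exact hrQ

/-- Depth is at most the dimension of every associated component: dividing by a regular element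
lowers the depth by one and moves P to a strictly larger associated prime. -/
theorem DepthGE.le_ringKrullDim {n : ℕ} : ∀ {M : Type} [AddCommGroup M] [Module R M]
    [Module.Finite R M], DepthGE R n M → ∀ {P : Ideal R}, P ∈ associatedPrimes R M →
      (n : WithBot ℕ∞) ≤ ringKrullDim (R ⧸ P) := by
  induction n with
  | zero =>
    intro M _ _ _ _ P hP
    have := (AssociatedPrimes.mem_iff.1 hP).isPrime
    exact ringKrullDim_nonneg_of_nontrivial
  | succ n ih =>
    intro M _ _ _ h P hP
    obtain ⟨x, hxm, hx⟩ := h.exists_isSMulRegular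
    obtain ⟨Q, hQ, hlt⟩ := exists_lt_associatedPrime_quotSMulTop hxm hx hP
    have := (AssociatedPrimes.mem_iff.1 hP).isPrime
    refine le_trans ?_ (ringKrullDim_quotient_succ_le_of_lt hlt)
    have := ih (h.quotSMulTop hx) hQ
    push_cast
    gcongr

/-- Krull's height theorem in R ⧸ P, whose maximal ideal is minimal over the images of L. -/
theorem ringKrullDim_quotient_le_of_le_radical {P : Ideal R} [P.IsPrime] (L : List R)
    (hLm : ∀ r ∈ L, r ∈ maximalIdeal R) (h : maximalIdeal R ≤ (Ideal.ofList L ⊔ P).radical) :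
    ringKrullDim (R ⧸ P) ≤ L.length := by
  classical
  have : IsLocalRing (R ⧸ P) :=
    IsLocalRing.of_surjective' (Ideal.Quotient.mk P) Ideal.Quotient.mk_surjective
  have hPm : P ≤ maximalIdeal R := le_maximalIdeal (Ideal.IsPrime.ne_top ‹_›)
  rw [← IsLocalRing.maximalIdeal_height_eq_ringKrullDim]
  let s : Finset (R ⧸ P) := (L.map (Ideal.Quotient.mk P)).toFinset
  have hs : s.card ≤ L.length := (List.toFinset_card_le _).trans (List.length_map _).le
  have hcomap : (maximalIdeal (R ⧸ P)).comap (Ideal.Quotient.mk P) = maximalIdeal R := by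
    have : ((maximalIdeal (R ⧸ P)).comap (Ideal.Quotient.mk P)).IsMaximal :=
      Ideal.comap_isMaximal_of_surjective _ Ideal.Quotient.mk_surjective
    exact eq_maximalIdeal this
  have hmin : maximalIdeal (R ⧸ P) ∈ (Ideal.span (s : Set (R ⧸ P))).minimalPrimes := by
    refine ⟨⟨inferInstance, Ideal.span_le.2 fun a ha => ?_⟩, fun p ⟨hp, hsp⟩ _ => ?_⟩
    · simp only [s, List.coe_toFinset, List.mem_map, Set.mem_ofPred_eq] at ha
      obtain ⟨r, hr, rfl⟩ := ha
      have := hLm r hr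
      rwa [← hcomap, Ideal.mem_comap] at this
    · intro a ha
      obtain ⟨a, rfl⟩ := Ideal.Quotient.mk_surjective a
      rw [← Ideal.mem_comap, hcomap] at ha
      have h2 : (Ideal.ofList L ⊔ P).radical ≤ p.comap (Ideal.Quotient.mk P) := by
        refine (Ideal.IsPrime.radical_le_iff (hp.comap _)).2 (sup_le ?_ ?_)
        · refine Ideal.span_le.2 fun r hr => hsp (Ideal.subset_span ?_)
          simp only [s, List.coe_toFinset, List.mem_map, Set.mem_ofPred_eq]
          exact ⟨r, hr, rfl⟩
        · intro r hr
          rw [Ideal.mem_comap, Ideal.Quotient.eq_zero_iff_mem.2 hr]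
          exact zero_mem p
      exact h2 (h ha)
  have := Ideal.height_le_card_of_mem_minimalPrimes_span_finset hmin
  exact_mod_cast this.trans (by exact_mod_cast hs)

/-- A system of parameters of a Cohen–Macaulay module is a regular sequence. -/
theorem DepthGE.isWeaklyRegular (L : List R) (hLm : ∀ r ∈ L, r ∈ maximalIdeal R) :
    ∀ {M : Type} [AddCommGroup M] [Module R M] [Module.Finite R M], DepthGE R L.length M →
      maximalIdeal R ≤ (Ideal.ofList L ⊔ Module.annihilator R M).radical →
      IsWeaklyRegular M L := by
  induction L with
  | nil => intro M _ _ _ _ _; exact IsWeaklyRegular.nil R M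
  | cons f L ih =>
    intro M _ _ _ h hrad
    have hf : IsSMulRegular M f := by
      -- A zero divisor f lies in an associated prime P. Then L alone is a system of parameters
      -- modulo P, so R ⧸ P has dimension at most |L|, against depth at least |L| + 1.
      by_contra hcon
      have hmem : f ∈ ⋃ p ∈ associatedPrimes R M, (p : Set R) := by
        rw [biUnion_associatedPrimes_eq_compl_regular]
        exact hcon
      simp only [Set.mem_iUnion, SetLike.mem_coe] at hmem
      obtain ⟨P, hP, hfP⟩ := hmem
      have hPp := (AssociatedPrimes.mem_iff.1 hP).isPrime
      have hann : Module.annihilator R M ≤ P := by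
        obtain ⟨-, m, hm⟩ := isAssociatedPrime_iff.1 (AssociatedPrimes.mem_iff.1 hP)
        intro r hr
        rw [hm, Submodule.mem_colon_singleton, Module.mem_annihilator.1 hr]
        exact zero_mem _
      have h1 := ringKrullDim_quotient_le_of_le_radical (P := P) L
        (fun r hr => hLm r (List.mem_cons_of_mem _ hr)) (hrad.trans (Ideal.radical_mono (by
          rw [Ideal.ofList_cons]
          refine sup_le (sup_le ?_ le_sup_left) (hann.trans le_sup_right)
          rw [Ideal.span_singleton_le_iff_mem]
          exact Ideal.mem_sup_right hfP)))
      have h2 := h.le_ringKrullDim hP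
      have h3 := h2.trans h1
      rw [List.length_cons] at h3
      have : L.length + 1 ≤ L.length := by exact_mod_cast h3
      omega
    rw [isWeaklyRegular_cons_iff]
    refine ⟨hf, ih (fun r hr => hLm r (List.mem_cons_of_mem _ hr)) (h.quotSMulTop hf)
      (hrad.trans (Ideal.radical_mono ?_))⟩
    rw [Ideal.ofList_cons]
    refine sup_le (sup_le ?_ le_sup_left) (le_trans ?_ le_sup_right)
    · rw [Ideal.span_singleton_le_iff_mem]
      refine Ideal.mem_sup_right (Module.mem_annihilator.2 fun m => ?_)
      obtain ⟨m, rfl⟩ := Submodule.Quotient.mk_surjective _ m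
      rw [← Submodule.Quotient.mk_smul, Submodule.Quotient.mk_eq_zero]
      exact Submodule.smul_mem_pointwise_smul _ _ _ Submodule.mem_top
    · intro r hr
      refine Module.mem_annihilator.2 fun m => ?_
      obtain ⟨m, rfl⟩ := Submodule.Quotient.mk_surjective _ m
      rw [← Submodule.Quotient.mk_smul, Module.mem_annihilator.1 hr, Submodule.Quotient.mk_zero]

end Depth

/-! ### The local ring of affine space at the origin -/

section LocalRing

open RingTheory.Sequence IsLocalRing

theorem mul_mem_ofList_of_isWeaklyRegular {R : Type*} [CommRing R] {L₁ L₂ : List R} {r : R}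
    (h : IsWeaklyRegular R (L₁ ++ r :: L₂)) {u : R} (hu : r * u ∈ Ideal.ofList L₁) :
    u ∈ Ideal.ofList L₁ := by
  have h1 := ((isWeaklyRegular_append_iff R L₁ (r :: L₂)).1 h).2
  rw [isWeaklyRegular_cons_iff] at h1
  have h2 := isSMulRegular_quotient_iff_mem_of_smul_mem _ _ |>.1 h1.1 u
  simp only [smul_eq_mul, Ideal.mul_top] at h2
  exact h2 hu

theorem isWeaklyRegular_of_forall {R : Type*} [CommRing R] {L : List R}
    (h : ∀ L₁ r L₂, L = L₁ ++ r :: L₂ → ∀ u, r * u ∈ Ideal.ofList L₁ → u ∈ Ideal.ofList L₁) :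
    IsWeaklyRegular R L := by
  refine ⟨fun i hi => ?_⟩
  rw [isSMulRegular_quotient_iff_mem_of_smul_mem]
  intro u hu
  simp only [smul_eq_mul, Ideal.mul_top] at hu ⊢
  exact h (L.take i) L[i] (L.drop (i + 1)) (by simp) u hu

theorem isRegular_of_append {R : Type*} [CommRing R] {L₁ L₂ : List R}
    (h : IsRegular R (L₁ ++ L₂)) : IsRegular R L₁ := by
  refine ⟨((isWeaklyRegular_append_iff R L₁ L₂).1 h.toIsWeaklyRegular).1, fun htop => h.top_ne_smul ?_⟩
  rw [Ideal.ofList_append, Submodule.sup_smul, ← htop, top_sup_eq]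

variable {N : ℕ}

theorem mem_originIdeal {f : MvPolynomial (Fin N) ℂ} : f ∈ originIdeal N ↔ coeff 0 f = 0 := by
  rw [originIdeal, RingHom.mem_ker, constantCoeff_eq]

theorem originIdeal_eq : originIdeal N = idealOfVars (Fin N) ℂ := by
  ext f
  rw [← pow_one (idealOfVars (Fin N) ℂ), mem_pow_idealOfVars_iff', mem_originIdeal]
  refine ⟨fun h m hm => ?_, fun h => h 0 (by simp)⟩
  obtain rfl := (Finsupp.degree_eq_zero_iff m).1 (by omega)
  exact h

theorem isWeaklyRegular_X : IsWeaklyRegular (MvPolynomial (Fin N) ℂ)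
    (List.ofFn fun i : Fin N => (X i : MvPolynomial (Fin N) ℂ)) := by
  refine isWeaklyRegular_of_forall fun L₁ r L₂ hL u hu => ?_
  have hlen := congrArg List.length hL
  rw [List.length_ofFn, List.length_append, List.length_cons] at hlen
  have hlt : L₁.length < N := by omega
  obtain rfl : r = X ⟨L₁.length, hlt⟩ := by
    have h := congrArg (fun l => l[L₁.length]?) hL
    simpa [hlt] using h.symm
  have hL₁ : Ideal.ofList L₁ = Ideal.span ((X : Fin N → MvPolynomial (Fin N) ℂ) ''
      {j | j.1 < L₁.length}) := by
    refine congrArg Ideal.span (Set.ext fun g => ?_)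
    constructor
    · intro hg
      obtain ⟨j, hj, rfl⟩ := List.mem_iff_getElem.1 (show g ∈ L₁ from hg)
      refine ⟨⟨j, by omega⟩, hj, ?_⟩
      have h := congrArg (fun l => l[j]?) hL
      simpa [hj, hj.trans hlt, List.getElem?_append_left hj] using h
    · rintro ⟨j, hj, rfl⟩
      refine List.mem_iff_getElem.2 ⟨j.1, hj, ?_⟩
      have h := congrArg (fun l => l[j.1]?) hL
      simpa [List.getElem?_append_left (show j.1 < L₁.length from hj),
        show j.1 < L₁.length from hj] using h.symm
  rw [hL₁, mem_ideal_span_X_image] at hu ⊢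
  intro m hm
  obtain ⟨i, hi, hne⟩ := hu (m + Finsupp.single ⟨L₁.length, hlt⟩ 1) (by
    rw [mem_support_iff, mul_comm, coeff_mul_X]
    exact mem_support_iff.1 hm)
  refine ⟨i, hi, fun h0 => hne ?_⟩
  have : (⟨L₁.length, hlt⟩ : Fin N) ≠ i := fun h => by
    rw [← h] at hi
    exact lt_irrefl L₁.length hi
  simp [h0, this]

instance : IsNoetherianRing (LocalRingAtOrigin N) :=
  IsLocalization.isNoetherianRing (originIdeal N).primeCompl _ inferInstance

theorem algebraMap_mem_maximalIdeal {f : MvPolynomial (Fin N) ℂ} :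
    algebraMap _ (LocalRingAtOrigin N) f ∈ maximalIdeal (LocalRingAtOrigin N) ↔ coeff 0 f = 0 := by
  rw [IsLocalization.AtPrime.to_map_mem_maximal_iff (LocalRingAtOrigin N) (originIdeal N),
    mem_originIdeal]

theorem isRegular_X : IsRegular (LocalRingAtOrigin N)
    ((List.ofFn fun i : Fin N => (X i : MvPolynomial (Fin N) ℂ)).map
      (algebraMap _ (LocalRingAtOrigin N))) :=
  isWeaklyRegular_X.isRegular_of_isLocalization_of_mem _ (originIdeal N) (by
    intro r hr
    obtain ⟨i, rfl⟩ := (List.mem_ofFn' _ _).1 hr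
    simp [mem_originIdeal])

theorem depthGE_localRingAtOrigin : DepthGE (LocalRingAtOrigin N) N (LocalRingAtOrigin N) := by
  have := depthGE_of_isRegular (isRegular_X (N := N)) (by
    intro r hr
    obtain ⟨f, hf, rfl⟩ := List.mem_map.1 hr
    obtain ⟨i, rfl⟩ := (List.mem_ofFn' _ _).1 hf
    rw [algebraMap_mem_maximalIdeal]
    simp)
  simpa using this

theorem isRegular_of_le_radical {L : List (MvPolynomial (Fin N) ℂ)} (hlen : L.length = N)
    (hL : ∀ f ∈ L, coeff 0 f = 0) (hrad : maximalIdeal (LocalRingAtOrigin N) ≤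
      (Ideal.ofList (L.map (algebraMap _ (LocalRingAtOrigin N)))).radical) :
    IsRegular (LocalRingAtOrigin N) (L.map (algebraMap _ (LocalRingAtOrigin N))) := by
  have hmem : ∀ r ∈ L.map (algebraMap _ (LocalRingAtOrigin N)),
      r ∈ maximalIdeal (LocalRingAtOrigin N) := by
    intro r hr
    obtain ⟨f, hf, rfl⟩ := List.mem_map.1 hr
    exact algebraMap_mem_maximalIdeal.2 (hL f hf)
  refine IsRegular.of_isWeaklyRegular_of_mem_maximalIdeal (LocalRingAtOrigin N) hmem ?_
  refine DepthGE.isWeaklyRegular _ hmem ?_ (hrad.trans (Ideal.radical_mono le_sup_left))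
  rw [List.length_map, hlen]
  exact depthGE_localRingAtOrigin

theorem map_originIdeal : (originIdeal N).map (algebraMap _ (LocalRingAtOrigin N)) =
    maximalIdeal (LocalRingAtOrigin N) :=
  Localization.AtPrime.map_eq_maximalIdeal

theorem isRegular_of_zeros {L : List (MvPolynomial (Fin N) ℂ)} (hlen : L.length = N)
    (hL : ∀ f ∈ L, coeff 0 f = 0) (hzero : ∀ y : Fin N → ℂ, (∀ f ∈ L, eval y f = 0) → y = 0) :
    IsRegular (LocalRingAtOrigin N) (L.map (algebraMap _ (LocalRingAtOrigin N))) := by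
  refine isRegular_of_le_radical hlen hL ?_
  -- The Nullstellensatz turns the absence of non-zero common zeros into the condition on the
  -- radical.
  have h1 : originIdeal N ≤ (Ideal.ofList L).radical := by
    rw [← vanishingIdeal_zeroLocus_eq_radical (K := ℂ)]
    intro f hf y hy
    obtain rfl := hzero y fun g hg => by
      have := hy g (Ideal.subset_span hg)
      simpa using this
    rw [mem_originIdeal] at hf
    have h2 : eval (0 : Fin N → ℂ) f = coeff 0 f := by
      rw [← constantCoeff_eq, ← eval_zero]
    rw [← aeval_eq_eval] at h2
    exact h2.trans hf
  rw [← map_originIdeal, ← Ideal.map_ofList]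
  exact (Ideal.map_mono h1).trans (Ideal.map_radical_le _)

/-- Any ordering of Q followed by E is a full system of parameters, and an initial segment of a
regular sequence is regular. -/
theorem makesRegularSequence_of_zeros {Q : Multiset (MvPolynomial (Fin N) ℂ)}
    (E : List (MvPolynomial (Fin N) ℂ)) (hlen : Q.card + E.length = N)
    (hQ : ∀ f ∈ Q, coeff 0 f = 0) (hE : ∀ f ∈ E, coeff 0 f = 0)
    (hzero : ∀ y : Fin N → ℂ, (∀ f ∈ Q, eval y f = 0) → (∀ f ∈ E, eval y f = 0) → y = 0) :
    MakesRegularSequence Q := by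
  rintro L rfl
  refine isRegular_of_append (L₂ := E.map (algebraMap _ (LocalRingAtOrigin N))) ?_
  rw [← List.map_append]
  refine isRegular_of_zeros (by simpa using hlen) ?_ fun y hy => hzero y ?_ ?_
  · intro f hf
    rcases List.mem_append.1 hf with h | h
    · exact hQ f h
    · exact hE f h
  · exact fun f hf => hy f (List.mem_append_left _ hf)
  · exact fun f hf => hy f (List.mem_append_right _ hf)

/-- A minimal prime q inside (x) does not contain the non-zero-divisor x, so each of its elements is
x times an element of q. Nakayama then gives q = 0. -/
theorem isPrime_bot_of_span_singleton {S : Type*} [CommRing S] [IsLocalRing S] [IsNoetherianRing S]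
    {x : S} (hxm : x ∈ maximalIdeal S) (hx : x ∈ nonZeroDivisors S)
    (hp : (Ideal.span {x}).IsPrime) : (⊥ : Ideal S).IsPrime := by
  obtain ⟨q, hq, hle⟩ := Ideal.exists_minimalPrimes_le (I := ⊥) (J := Ideal.span {x}) bot_le
  have hqp : q.IsPrime := hq.1.1
  have hxq : x ∉ q := fun h => Set.disjoint_iff.mp
    (Ideal.disjoint_nonZeroDivisors_of_mem_minimalPrimes hq) ⟨h, hx⟩
  have : q = ⊥ := by
    refine Submodule.eq_bot_of_le_smul_of_le_jacobson_bot (maximalIdeal S) q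
      (IsNoetherian.noetherian q) (fun y hy => ?_) (IsLocalRing.maximalIdeal_le_jacobson ⊥)
    obtain ⟨t, rfl⟩ := Ideal.mem_span_singleton'.1 (hle hy)
    rw [mul_comm]
    exact Submodule.smul_mem_smul hxm ((hqp.mem_or_mem hy).resolve_right hxq)
  rwa [← this]

theorem isPrime_of_isPrime_sup {R : Type*} [CommRing R] [IsLocalRing R] [IsNoetherianRing R]
    {I : Ideal R} {x : R} (hxm : x ∈ maximalIdeal R) (hx : ∀ u, x * u ∈ I → u ∈ I)
    (hp : (I ⊔ Ideal.span {x}).IsPrime) : I.IsPrime := by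
  have hI : I ≠ ⊤ := fun h => hp.ne_top (by rw [h, top_sup_eq])
  have : Nontrivial (R ⧸ I) := Ideal.Quotient.nontrivial_iff.2 hI
  have : IsLocalRing (R ⧸ I) :=
    IsLocalRing.of_surjective' (Ideal.Quotient.mk I) Ideal.Quotient.mk_surjective
  rw [← Ideal.Quotient.isDomain_iff_prime]
  have hbot : (⊥ : Ideal (R ⧸ I)).IsPrime := by
    refine isPrime_bot_of_span_singleton (x := Ideal.Quotient.mk I x) ?_ ?_ ?_
    · rw [mem_maximalIdeal, mem_nonunits_iff]
      intro hu
      obtain ⟨y, hy⟩ := hu.exists_right_inv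
      obtain ⟨y, rfl⟩ := Ideal.Quotient.mk_surjective y
      rw [← map_mul, ← map_one (Ideal.Quotient.mk I), Ideal.Quotient.eq] at hy
      have h1 : (1 : R) ∈ maximalIdeal R := by
        have := sub_mem (Ideal.mul_mem_right y _ hxm) (le_maximalIdeal hI hy)
        rwa [sub_sub_cancel] at this
      exact (Ideal.ne_top_iff_one _).1 (maximalIdeal.isMaximal R).ne_top h1
    · rw [mem_nonZeroDivisors_iff_right]
      intro u hu
      obtain ⟨u, rfl⟩ := Ideal.Quotient.mk_surjective u
      rw [← map_mul, Ideal.Quotient.eq_zero_iff_mem, mul_comm] at hu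
      exact Ideal.Quotient.eq_zero_iff_mem.2 (hx u hu)
    · have h1 := Ideal.isPrime_map_quotientMk_of_isPrime (I := I) (p := I ⊔ Ideal.span {x})
        le_sup_left
      rwa [Ideal.map_sup, Ideal.map_quotient_self, bot_sup_eq, Ideal.map_span,
        Set.image_singleton] at h1
  have : NoZeroDivisors (R ⧸ I) := ⟨fun {a b} h => hbot.mem_or_mem (x := a) (y := b) h⟩
  exact NoZeroDivisors.to_isDomain _

theorem isPrime_ofList_of_append {R : Type*} [CommRing R] [IsLocalRing R] [IsNoetherianRing R]
    (L₂ : List R) : ∀ L₁ : List R, IsWeaklyRegular R (L₁ ++ L₂) → (∀ r ∈ L₂, r ∈ maximalIdeal R) →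
      (Ideal.ofList (L₁ ++ L₂)).IsPrime → (Ideal.ofList L₁).IsPrime := by
  induction L₂ with
  | nil => intro L₁ _ _ h; simpa using h
  | cons x L₂ ih =>
    intro L₁ hreg hm hp
    refine isPrime_of_isPrime_sup (hm x List.mem_cons_self)
      (fun u hu => mul_mem_ofList_of_isWeaklyRegular hreg hu) ?_
    rw [← Ideal.ofList_singleton, ← Ideal.ofList_append]
    refine ih (L₁ ++ [x]) ?_ (fun r hr => hm r (List.mem_cons_of_mem _ hr)) ?_
    · simpa using hreg
    · rw [List.append_assoc]; exact hp

theorem sub_homogeneousComponent_one_mem {f : MvPolynomial (Fin N) ℂ} (hf : coeff 0 f = 0) :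
    f - homogeneousComponent 1 f ∈ originIdeal N ^ 2 := by
  rw [originIdeal_eq, mem_pow_idealOfVars_iff']
  intro m hm
  rw [coeff_sub, coeff_homogeneousComponent]
  split_ifs with h
  · rw [sub_self]
  · obtain rfl := (Finsupp.degree_eq_zero_iff m).1 (by omega)
    rw [hf, sub_self]

/-- Equations with independent linear parts define a domain locally at the origin. -/
theorem exists_mul_mem_of_linearIndependent {k : ℕ} {g : Fin k → MvPolynomial (Fin N) ℂ}
    (h0 : ∀ i, coeff 0 (g i) = 0)
    (hlin : LinearIndependent ℂ fun i => homogeneousComponent 1 (g i))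
    {u v : MvPolynomial (Fin N) ℂ} (huv : u * v ∈ Ideal.span (Set.range g)) :
    ∃ s, coeff 0 s ≠ 0 ∧ (s * u ∈ Ideal.span (Set.range g) ∨ s * v ∈ Ideal.span (Set.range g)) := by
  classical
  set q := fun i => homogeneousComponent 1 (g i) with hq
  have hX : LinearIndependent ℂ (X : Fin N → MvPolynomial (Fin N) ℂ) :=
    MvPolynomial.linearIndependent_X (Fin N) ℂ
  -- Complete the linear parts to a basis of the linear forms by coordinates. By Nakayama the
  -- equations and these coordinates generate the maximal ideal.
  obtain ⟨b, hbt, hsb, htb, hb⟩ := exists_linearIndepOn_id_extension (K := ℂ)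
    (s := Set.range q) (t := Set.range q ∪ Set.range X) hlin.linearIndepOn_id
    Set.subset_union_left
  have hbfin : b.Finite := ((Set.finite_range q).union (Set.finite_range X)).subset hbt
  have hspan : Submodule.span ℂ b = Submodule.span ℂ (Set.range (X : Fin N → _)) := by
    refine le_antisymm (Submodule.span_le.2 fun f hf => ?_)
      (Submodule.span_le.2 fun f hf => htb (Or.inr hf))
    rcases hbt hf with ⟨i, rfl⟩ | h
    · have := eq_sum_of_isHomogeneous_one (homogeneousComponent_isHomogeneous 1 (g i))
      change homogeneousComponent 1 (g i) ∈ _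
      rw [this]
      refine sum_mem fun m _ => ?_
      rw [C_mul']
      exact Submodule.smul_mem _ _ (Submodule.subset_span ⟨m, rfl⟩)
    · exact Submodule.subset_span h
  have hcard : b.ncard = N := by
    have := hbfin.fintype
    have h1 : Module.finrank ℂ (Submodule.span ℂ b) = Fintype.card b :=
      finrank_span_set_eq_card hb |>.trans (Set.toFinset_card b)
    rw [hspan, finrank_span_eq_card hX, Fintype.card_fin] at h1
    rw [← Nat.card_coe_set_eq, Nat.card_eq_fintype_card]
    exact h1.symm
  have hdiff : (b \ Set.range q).Finite := hbfin.subset Set.sdiff_subset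
  let l := hdiff.toFinset.toList
  have hl : ∀ f, f ∈ l ↔ f ∈ b ∧ f ∉ Set.range q := fun f => by
    simp [l]
  have hllen : l.length + k = N := by
    have h2 : (Set.range q).ncard = k := by
      rw [← Nat.card_coe_set_eq, Nat.card_range_of_injective hlin.injective, Nat.card_eq_fintype_card,
        Fintype.card_fin]
    have h3 := Set.ncard_sdiff_add_ncard_of_subset hsb hbfin
    rw [Set.ncard_eq_toFinset_card _ hdiff, h2, hcard] at h3
    simpa [l] using h3
  have hlX : ∀ f ∈ l, ∃ m, X m = f := fun f hf =>
    ((hbt ((hl f).1 hf).1).resolve_left ((hl f).1 hf).2)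
  let R := LocalRingAtOrigin N
  let L := List.ofFn g ++ l
  have hL0 : ∀ f ∈ L, coeff 0 f = 0 := by
    intro f hf
    rcases List.mem_append.1 hf with h | h
    · obtain ⟨i, rfl⟩ := (List.mem_ofFn' _ _).1 h
      exact h0 i
    · obtain ⟨m, rfl⟩ := hlX f h
      simp
  have hle : originIdeal N ≤ Ideal.ofList L ⊔ originIdeal N ^ 2 := by
    have h4 : ∀ f ∈ b, f ∈ Ideal.ofList L ⊔ originIdeal N ^ 2 := by
      intro f hf
      by_cases hfq : f ∈ Set.range q
      · obtain ⟨i, rfl⟩ := hfq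
        have h5 : q i = g i - (g i - q i) := by ring
        rw [h5]
        refine sub_mem (Ideal.mem_sup_left (Ideal.subset_span ?_))
          (Ideal.mem_sup_right (sub_homogeneousComponent_one_mem (h0 i)))
        exact List.mem_append_left _ ((List.mem_ofFn' _ _).2 ⟨i, rfl⟩)
      · exact Ideal.mem_sup_left (Ideal.subset_span (List.mem_append_right _ ((hl f).2 ⟨hf, hfq⟩)))
    conv_lhs => rw [originIdeal_eq]
    refine Ideal.span_le.2 ?_
    rintro _ ⟨m, rfl⟩
    have h6 : X m ∈ Submodule.span ℂ b := htb (Or.inr ⟨m, rfl⟩)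
    have h7 : Submodule.span ℂ b ≤
        (Ideal.ofList L ⊔ originIdeal N ^ 2).restrictScalars ℂ := Submodule.span_le.2 h4
    exact h7 h6
  have hmax : maximalIdeal R = Ideal.ofList (L.map (algebraMap _ R)) := by
    refine le_antisymm ?_ (Ideal.span_le.2 fun r hr => ?_)
    · refine Submodule.le_of_le_smul_of_le_jacobson_bot (I := maximalIdeal R)
        (IsNoetherian.noetherian _) (IsLocalRing.maximalIdeal_le_jacobson ⊥) ?_
      have h8 := Ideal.map_mono (f := algebraMap (MvPolynomial (Fin N) ℂ) R) hle
      rwa [Ideal.map_sup, Ideal.map_pow, map_originIdeal, Ideal.map_ofList, pow_two] at h8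
    · obtain ⟨f, hf, rfl⟩ := List.mem_map.1 (show r ∈ L.map (algebraMap _ R) from hr)
      exact algebraMap_mem_maximalIdeal.2 (hL0 f hf)
  have hreg := isRegular_of_le_radical (L := L) (by simp [L]; omega) hL0
    (hmax.le.trans Ideal.le_radical)
  -- The maximal ideal is prime, and primality survives removing the added coordinates one at a time
  -- from the end of the regular sequence.
  have hprime : (Ideal.ofList ((List.ofFn g).map (algebraMap _ R))).IsPrime := by
    refine isPrime_ofList_of_append (l.map (algebraMap _ R)) _ ?_ ?_ ?_
    · rw [← List.map_append]; exact hreg.toIsWeaklyRegular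
    · intro r hr
      rw [hmax]
      refine Ideal.subset_span ?_
      obtain ⟨f, hf, rfl⟩ := List.mem_map.1 hr
      exact List.mem_map_of_mem (List.mem_append_right _ hf)
    · rw [← List.map_append, ← hmax]; infer_instance
  have hgen : Ideal.ofList (List.ofFn g) = Ideal.span (Set.range g) := by
    exact congrArg Ideal.span (Set.ext fun f => List.mem_ofFn' _ _)
  rw [← Ideal.map_ofList, hgen] at hprime
  have h9 : algebraMap _ R u * algebraMap _ R v ∈ (Ideal.span (Set.range g)).map (algebraMap _ R) := by
    rw [← map_mul]; exact Ideal.mem_map_of_mem _ huv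
  rcases hprime.mem_or_mem h9 with h | h <;>
    obtain ⟨s, hs, hsu⟩ := (IsLocalization.algebraMap_mem_map_algebraMap_iff
      (originIdeal N).primeCompl _ _ _).1 h
  · exact ⟨s, fun h => hs (mem_originIdeal.2 h), Or.inl hsu⟩
  · exact ⟨s, fun h => hs (mem_originIdeal.2 h), Or.inr hsu⟩

end LocalRing

/-! ### Homogeneous ideals -/

section Homogeneous

open RingTheory.Sequence IsLocalRing

variable {N : ℕ}

theorem homogeneousComponent_mem_span {S : Set (MvPolynomial (Fin N) ℂ)}
    (hS : ∀ f ∈ S, ∃ j, f.IsHomogeneous j) {g : MvPolynomial (Fin N) ℂ} (hg : g ∈ Ideal.span S)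
    (j : ℕ) : homogeneousComponent j g ∈ Ideal.span S := by
  let _ : GradedAlgebra (homogeneousSubmodule (Fin N) ℂ) := gradedAlgebra
  refine homogeneousComponent_mem_of_mem (Ideal.homogeneous_span _ S fun f hf => ?_) hg j
  obtain ⟨i, hi⟩ := hS f hf
  exact ⟨i, (mem_homogeneousSubmodule _ _).2 hi⟩

/-- A homogeneous ideal of a polynomial ring is determined by its localization at the origin. -/
theorem mem_span_of_mul_mem {S : Set (MvPolynomial (Fin N) ℂ)}
    (hS : ∀ f ∈ S, ∃ j, f.IsHomogeneous j) {s u : MvPolynomial (Fin N) ℂ} (hs : coeff 0 s ≠ 0)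
    (hsu : s * u ∈ Ideal.span S) : u ∈ Ideal.span S := by
  -- Modulo the ideal u equals t ^ j * u for every j, and t has no constant term. So each fixed
  -- homogeneous component of u lies in the ideal, by taking j larger than its degree.
  set t : MvPolynomial (Fin N) ℂ := 1 - C (coeff 0 s)⁻¹ * s with ht
  have ht0 : t ∈ originIdeal N := by
    rw [mem_originIdeal, ht, coeff_sub, coeff_C_mul, coeff_zero_one, inv_mul_cancel₀ hs, sub_self]
  have htu : u - t * u ∈ Ideal.span S := by
    have : u - t * u = C (coeff 0 s)⁻¹ * (s * u) := by rw [ht]; ring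
    rw [this]
    exact Ideal.mul_mem_left _ _ hsu
  have hpow : ∀ j : ℕ, u - t ^ j * u ∈ Ideal.span S := by
    intro j
    induction j with
    | zero => simp
    | succ j ih =>
      have : u - t ^ (j + 1) * u = (u - t ^ j * u) + t ^ j * (u - t * u) := by ring
      rw [this]
      exact add_mem ih (Ideal.mul_mem_left _ _ htu)
  have hcomp : ∀ j, homogeneousComponent j u ∈ Ideal.span S := by
    intro j
    have h1 := homogeneousComponent_mem_span hS (hpow (j + 1)) j
    have h2 : homogeneousComponent j (t ^ (j + 1) * u) = 0 := by
      have h3 : t ^ (j + 1) * u ∈ idealOfVars (Fin N) ℂ ^ (j + 1) := by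
        rw [← originIdeal_eq]
        exact Ideal.mul_mem_right _ _ (Ideal.pow_mem_pow ht0 _)
      rw [mem_pow_idealOfVars_iff'] at h3
      ext m
      rw [coeff_homogeneousComponent, coeff_zero]
      split_ifs with hm
      · exact h3 m (by omega)
      · rfl
    rwa [map_sub, h2, sub_zero] at h1
  rw [← sum_homogeneousComponent u]
  exact sum_mem fun j _ => hcomp j

theorem isWeaklyRegular_of_localRingAtOrigin {L : List (MvPolynomial (Fin N) ℂ)}
    (hL : ∀ f ∈ L, ∃ j, f.IsHomogeneous j)
    (h : IsWeaklyRegular (LocalRingAtOrigin N) (L.map (algebraMap _ (LocalRingAtOrigin N)))) :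
    IsWeaklyRegular (MvPolynomial (Fin N) ℂ) L := by
  refine isWeaklyRegular_of_forall fun L₁ r L₂ hLe u hu => ?_
  rw [hLe, List.map_append, List.map_cons] at h
  have h1 := mul_mem_ofList_of_isWeaklyRegular h (u := algebraMap _ _ u) (by
    rw [← Ideal.map_ofList, ← map_mul]
    exact Ideal.mem_map_of_mem _ hu)
  rw [← Ideal.map_ofList] at h1
  obtain ⟨s, hs, hsu⟩ := (IsLocalization.algebraMap_mem_map_algebraMap_iff
      (originIdeal N).primeCompl _ _ _).1 h1
  refine mem_span_of_mul_mem (fun f hf => hL f ?_) (fun h0 => hs (mem_originIdeal.2 h0)) hsu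
  rw [hLe]
  exact List.mem_append_left _ hf

theorem ringKrullDim_quotient_ofList_add_length_le {A : Type*} [CommRing A] (L : List A)
    (h : IsWeaklyRegular A L) :
    ringKrullDim (A ⧸ Ideal.ofList L) + L.length ≤ ringKrullDim A := by
  induction L using List.reverseRecOn with
  | nil =>
    simp only [List.length_nil, Nat.cast_zero, add_zero]
    exact ringKrullDim_quotient_le _
  | append_singleton L x ih =>
    have h1 := ((isWeaklyRegular_append_iff A L [x]).1 h).1
    refine le_trans ?_ (ih h1)
    rw [List.length_append, List.length_singleton, Nat.cast_add, Nat.cast_one,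
      add_comm (L.length : WithBot ℕ∞), ← add_assoc]
    gcongr
    have hle : Ideal.ofList L ≤ Ideal.ofList (L ++ [x]) := by
      rw [Ideal.ofList_append]; exact le_sup_left
    refine ringKrullDim_succ_le_of_surjective (Ideal.Quotient.factor hle)
      (Ideal.Quotient.factor_surjective hle) (r := Ideal.Quotient.mk _ x) ?_ ?_
    · rw [mem_nonZeroDivisors_iff_right]
      intro u hu
      obtain ⟨u, rfl⟩ := Ideal.Quotient.mk_surjective u
      rw [← map_mul, Ideal.Quotient.eq_zero_iff_mem, mul_comm] at hu
      exact Ideal.Quotient.eq_zero_iff_mem.2 (mul_mem_ofList_of_isWeaklyRegular h hu)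
    · rw [Ideal.Quotient.factor_mk, Ideal.Quotient.eq_zero_iff_mem]
      exact Ideal.subset_span (List.mem_append_right _ List.mem_cons_self)

theorem le_height_originIdeal : (N : ℕ∞) ≤ (originIdeal N).height := by
  obtain ⟨P, hP⟩ := associatedPrimes.nonempty (LocalRingAtOrigin N) (LocalRingAtOrigin N)
  have h1 := (depthGE_localRingAtOrigin (N := N)).le_ringKrullDim hP
  have h2 := h1.trans (ringKrullDim_quotient_le P)
  rw [IsLocalization.AtPrime.ringKrullDim_eq_height (originIdeal N)] at h2
  exact_mod_cast h2

end Homogeneous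

/-! ### A connectedness criterion for primality -/

section Connected

variable {A : Type*} [CommRing A] {I : Ideal A} {x y : A}

theorem mem_of_pow_mul_mem (hx : ∀ u, x * u ∈ I → u ∈ I) (m : ℕ) (u : A) (hu : x ^ m * u ∈ I) :
    u ∈ I := by
  induction m generalizing u with
  | zero => simpa using hu
  | succ m ih =>
    refine ih u (hx _ ?_)
    rwa [pow_succ', mul_assoc] at hu

theorem mem_sup_span_pow_of_mul_mem (hx : ∀ u, x * u ∈ I → u ∈ I)
    (hy : ∀ u, y * u ∈ I ⊔ Ideal.span {x} → u ∈ I ⊔ Ideal.span {x}) (m : ℕ) (u : A)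
    (hu : y * u ∈ I ⊔ Ideal.span {x ^ m}) : u ∈ I ⊔ Ideal.span {x ^ m} := by
  induction m generalizing u with
  | zero => simp
  | succ m ih =>
    obtain ⟨i, hi, z, hz, hiz⟩ := Submodule.mem_sup.1 hu
    obtain ⟨t, rfl⟩ := Ideal.mem_span_singleton'.1 hz
    have h1 : u ∈ I ⊔ Ideal.span {x ^ m} := by
      refine ih u (Submodule.mem_sup.2 ⟨i, hi, t * x ^ (m + 1), ?_, hiz⟩)
      exact Ideal.mem_span_singleton'.2 ⟨t * x, by ring⟩
    obtain ⟨i', hi', z', hz', rfl⟩ := Submodule.mem_sup.1 h1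
    obtain ⟨u', rfl⟩ := Ideal.mem_span_singleton'.1 hz'
    have h2 : y * u' - x * t ∈ I := by
      refine mem_of_pow_mul_mem hx m _ ?_
      have : x ^ m * (y * u' - x * t) = i - y * i' := by linear_combination -hiz
      rw [this]
      exact sub_mem hi (Ideal.mul_mem_left _ _ hi')
    have h3 : u' ∈ I ⊔ Ideal.span {x} := by
      refine hy u' (Submodule.mem_sup.2 ⟨_, h2, t * x, Ideal.mem_span_singleton'.2 ⟨t, rfl⟩, ?_⟩)
      ring
    obtain ⟨i'', hi'', z'', hz'', rfl⟩ := Submodule.mem_sup.1 h3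
    obtain ⟨w, rfl⟩ := Ideal.mem_span_singleton'.1 hz''
    refine Submodule.mem_sup.2 ⟨i' + i'' * x ^ m, add_mem hi' (Ideal.mul_mem_right _ _ hi''),
      w * x ^ (m + 1), Ideal.mem_span_singleton'.2 ⟨w, rfl⟩, ?_⟩
    ring

/-- Let `x, y` be a regular sequence modulo `I`. If `A ⧸ I` has no non-trivial idempotents and is
a domain locally outside of `x = y = 0`, it is a domain. -/
theorem isPrime_of_connected [IsNoetherianRing A] (hI : I ≠ ⊤)
    (hx : ∀ u, x * u ∈ I → u ∈ I)
    (hy : ∀ u, y * u ∈ I ⊔ Ideal.span {x} → u ∈ I ⊔ Ideal.span {x})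
    (hidem : ∀ w, w * (1 - w) ∈ I → w ∈ I ∨ 1 - w ∈ I)
    (hloc : ∀ Q : Ideal A, Q.IsPrime → I ≤ Q → (x ∉ Q ∨ y ∉ Q) → ∀ u v, u * v ∈ I →
      ∃ s, s ∉ Q ∧ (s * u ∈ I ∨ s * v ∈ I)) : I.IsPrime := by
  classical
  refine ⟨hI, fun {a b} hab => ?_⟩
  -- J₁ = (I : b) and J₂ = (I : J₁), so J₁J₂ ⊆ I. Where I is locally prime, either b or all of J₁
  -- dies modulo I, so J₁ + J₂ is locally the unit ideal there.
  let J₁ : Ideal A :=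
    { carrier := {c | c * b ∈ I}
      add_mem' := fun {c c'} h h' => by
        change (c + c') * b ∈ I
        rw [add_mul]; exact add_mem h h'
      zero_mem' := by change 0 * b ∈ I; rw [zero_mul]; exact zero_mem _
      smul_mem' := fun r c h => by
        change r * c * b ∈ I
        rw [mul_assoc]; exact Ideal.mul_mem_left _ _ h }
  let J₂ : Ideal A :=
    { carrier := {c | ∀ j ∈ J₁, c * j ∈ I}
      add_mem' := fun {c c'} h h' j hj => by
        rw [add_mul]; exact add_mem (h j hj) (h' j hj)
      zero_mem' := fun j _ => by rw [zero_mul]; exact zero_mem _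
      smul_mem' := fun r c h j hj => by
        rw [smul_eq_mul, mul_assoc]; exact Ideal.mul_mem_left _ _ (h j hj) }
  have hJ₁ : ∀ c, c ∈ J₁ ↔ c * b ∈ I := fun _ => Iff.rfl
  have hJ₂ : ∀ c, c ∈ J₂ ↔ ∀ j ∈ J₁, c * j ∈ I := fun _ => Iff.rfl
  have hpow : ∀ z, (z = x ∨ z = y) → z ∈ (J₁ ⊔ J₂).radical := by
    intro z hz
    by_contra hcon
    rw [Ideal.radical_eq_sInf, Ideal.mem_sInf] at hcon
    push Not at hcon
    obtain ⟨Q, ⟨hle, hQ⟩, hzQ⟩ := hcon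
    have hIQ : I ≤ Q := fun c hc => hle (Ideal.mem_sup_left ((hJ₁ c).2 (Ideal.mul_mem_right _ _ hc)))
    have hxy : x ∉ Q ∨ y ∉ Q := by
      rcases hz with rfl | rfl
      · exact Or.inl hzQ
      · exact Or.inr hzQ
    by_cases hb : ∃ s, s ∉ Q ∧ s * b ∈ I
    · obtain ⟨s, hs, hsb⟩ := hb
      exact hs (hle (Ideal.mem_sup_left hsb))
    · push Not at hb
      have h1 : ∀ j ∈ J₁, ∃ s, s ∉ Q ∧ s * j ∈ I := by
        intro j hj
        obtain ⟨s, hs, h | h⟩ := hloc Q hQ hIQ hxy j b hj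
        · exact ⟨s, hs, h⟩
        · exact absurd h (hb s hs)
      obtain ⟨T, hT⟩ : J₁.FG := IsNoetherian.noetherian J₁
      have hTJ : ∀ j ∈ T, j ∈ J₁ := fun j hj => hT ▸ Ideal.subset_span hj
      choose! s hs hsj using h1
      refine hQ.prod_mem_iff (s := T) (x := s) |>.not.2 (by
        push Not; exact fun j hj => hs j (hTJ j hj)) (hle (Ideal.mem_sup_right ?_))
      intro j hj
      rw [← hT] at hj
      induction hj using Submodule.span_induction with
      | mem j hj =>
        rw [← Finset.mul_prod_erase T s hj, mul_right_comm]
        exact Ideal.mul_mem_right _ _ (hsj j (hTJ j hj))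
      | zero => rw [mul_zero]; exact zero_mem _
      | add c c' _ _ h h' => rw [mul_add]; exact add_mem h h'
      | smul r c _ h => rw [smul_eq_mul, mul_left_comm]; exact Ideal.mul_mem_left _ _ h
  obtain ⟨m₁, hm₁⟩ := hpow x (Or.inl rfl)
  obtain ⟨m₂, hm₂⟩ := hpow y (Or.inr rfl)
  obtain ⟨u, hu, v, hv, huv⟩ := Submodule.mem_sup.1 hm₁
  obtain ⟨u', hu', v', hv', huv'⟩ := Submodule.mem_sup.1 hm₂
  -- The local idempotents u / x ^ m₁ and u' / y ^ m₂ agree where both are defined. Regularity of x,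
  -- y lets them extend to a global w, necessarily idempotent modulo I.
  have hyu : y ^ m₂ * u ∈ I ⊔ Ideal.span {x ^ m₁} := by
    have : y ^ m₂ * u = (v' * u - v * u') + u' * x ^ m₁ := by rw [← huv, ← huv']; ring
    rw [this]
    exact Submodule.add_mem_sup (sub_mem (hv' u hu) (hv u' hu'))
      (Ideal.mem_span_singleton'.2 ⟨u', rfl⟩)
  have hu2 := mem_of_pow_mul_mem (mem_sup_span_pow_of_mul_mem hx hy m₁) m₂ u hyu
  obtain ⟨i, hi, z, hz, hiz⟩ := Submodule.mem_sup.1 hu2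
  obtain ⟨w, rfl⟩ := Ideal.mem_span_singleton'.1 hz
  have hw : w * (1 - w) ∈ I := by
    refine mem_of_pow_mul_mem hx (m₁ + m₁) _ ?_
    have : x ^ (m₁ + m₁) * (w * (1 - w)) = v * u + i * (u + w * x ^ m₁ - x ^ m₁) := by
      have hv : v = x ^ m₁ - u := by rw [← huv]; ring
      rw [hv, ← hiz]; ring
    rw [this]
    exact add_mem (hv u hu) (Ideal.mul_mem_right _ _ hi)
  rcases hidem w hw with h | h
  · left
    refine mem_of_pow_mul_mem hx m₁ a ?_
    have : x ^ m₁ * a = v * a + (i + w * x ^ m₁) * a := by rw [hiz, ← huv]; ring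
    rw [this]
    exact add_mem (hv a hab) (Ideal.mul_mem_right _ _ (add_mem hi (Ideal.mul_mem_right _ _ h)))
  · right
    refine mem_of_pow_mul_mem hx m₁ b ?_
    have : x ^ m₁ * b = u * b - i * b + (1 - w) * (x ^ m₁ * b) := by rw [← hiz]; ring
    rw [this]
    exact add_mem (sub_mem hu (Ideal.mul_mem_right _ _ hi)) (Ideal.mul_mem_right _ _ h)

end Connected

/-! ### Translations -/

section Translate

variable {N : ℕ}

/-- The substitution `X ↦ X + a`. -/
noncomputable def translate (a : Fin N → ℂ) : MvPolynomial (Fin N) ℂ →ₐ[ℂ] MvPolynomial (Fin N) ℂ :=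
  aeval fun m => X m + C (a m)

theorem translate_neg_translate (a : Fin N → ℂ) (f : MvPolynomial (Fin N) ℂ) :
    translate (-a) (translate a f) = f := by
  rw [← AlgHom.comp_apply]
  have : (translate (-a)).comp (translate a) = AlgHom.id ℂ _ := by
    refine algHom_ext fun m => ?_
    simp [translate]
  rw [this]; rfl

theorem coeff_zero_translate (a : Fin N → ℂ) (f : MvPolynomial (Fin N) ℂ) :
    coeff 0 (translate a f) = eval a f := by
  have h : (constantCoeff : MvPolynomial (Fin N) ℂ →+* ℂ).comp (translate a).toRingHom = eval a := by
    refine ringHom_ext (fun r => ?_) fun m => ?_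
    · simp [translate, algebraMap_eq]
    · simp [translate]
  exact DFunLike.congr_fun h f

theorem eval_translate_neg (a : Fin N → ℂ) (s : MvPolynomial (Fin N) ℂ) :
    eval a (translate (-a) s) = coeff 0 s := by
  rw [← coeff_zero_translate]
  have := translate_neg_translate (-a) s
  rw [neg_neg] at this
  rw [this]

theorem exists_eval_ne_zero_mul_mem {k : ℕ} {g : Fin k → MvPolynomial (Fin N) ℂ} {a : Fin N → ℂ}
    (h0 : ∀ i, eval a (g i) = 0)
    (hlin : LinearIndependent ℂ fun i => homogeneousComponent 1 (translate a (g i)))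
    {u v : MvPolynomial (Fin N) ℂ} (huv : u * v ∈ Ideal.span (Set.range g)) :
    ∃ s, eval a s ≠ 0 ∧
      (s * u ∈ Ideal.span (Set.range g) ∨ s * v ∈ Ideal.span (Set.range g)) := by
  have hmap : ∀ b (g : Fin k → MvPolynomial (Fin N) ℂ) w, w ∈ Ideal.span (Set.range g) →
      translate b w ∈ Ideal.span (Set.range fun i => translate b (g i)) := by
    intro b g w hw
    have := Ideal.mem_map_of_mem (translate b) hw
    rwa [Ideal.map_span, ← Set.range_comp] at this
  obtain ⟨s, hs, h⟩ := exists_mul_mem_of_linearIndependent (g := fun i => translate a (g i))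
    (fun i => by rw [coeff_zero_translate, h0]) hlin
    (u := translate a u) (v := translate a v) (by rw [← map_mul]; exact hmap a g _ huv)
  have hback : ∀ w, s * translate a w ∈ Ideal.span (Set.range fun i => translate a (g i)) →
      translate (-a) s * w ∈ Ideal.span (Set.range g) := by
    intro w hw
    have := hmap (-a) _ _ hw
    simpa only [map_mul, translate_neg_translate] using this
  refine ⟨translate (-a) s, by rwa [eval_translate_neg], h.imp (hback u) (hback v)⟩

/-- Being radical is local: at a zero the equations define a domain, and away from the zeros the
ideal is the unit ideal. -/
theorem isRadical_of_linearIndependent {k : ℕ} {g : Fin k → MvPolynomial (Fin N) ℂ}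
    (hlin : ∀ a : Fin N → ℂ, (∀ i, eval a (g i) = 0) →
      LinearIndependent ℂ fun i => homogeneousComponent 1 (translate a (g i))) :
    (Ideal.span (Set.range g)).IsRadical := by
  rintro u ⟨m, hm⟩
  set J := Ideal.span (Set.range g) with hJ
  -- T = (J : u). Were it proper, it would lie in the maximal ideal of a point a, where some s not
  -- vanishing at a nevertheless multiplies u into J.
  let T : Ideal (MvPolynomial (Fin N) ℂ) :=
    { carrier := {t | t * u ∈ J}
      add_mem' := fun {c c'} h h' => by
        change (c + c') * u ∈ J
        rw [add_mul]; exact add_mem h h'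
      zero_mem' := by change 0 * u ∈ J; rw [zero_mul]; exact zero_mem _
      smul_mem' := fun r c h => by
        change r * c * u ∈ J
        rw [mul_assoc]; exact Ideal.mul_mem_left _ _ h }
  by_contra hcon
  have hT : T ≠ ⊤ := fun h => hcon (by
    have : (1 : MvPolynomial (Fin N) ℂ) ∈ T := h ▸ Submodule.mem_top
    have h1 : 1 * u ∈ J := this
    rwa [one_mul] at h1)
  obtain ⟨P, hP, hle⟩ := T.exists_le_maximal hT
  obtain ⟨a, rfl⟩ := isMaximal_iff_eq_vanishingIdeal_singleton.1 hP
  have hTa : ∀ t, t * u ∈ J → eval a t = 0 := by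
    intro t ht
    have := (mem_vanishingIdeal_singleton_iff a t).1 (hle ht)
    simpa using this
  have hga : ∀ i, eval a (g i) = 0 := fun i =>
    hTa _ (Ideal.mul_mem_right _ _ (Ideal.subset_span ⟨i, rfl⟩))
  have key : ∀ (m : ℕ) (w : MvPolynomial (Fin N) ℂ), w ^ m ∈ J → ∃ s, eval a s ≠ 0 ∧ s * w ∈ J := by
    intro m
    induction m with
    | zero =>
      intro w hw
      refine ⟨1, by simp, ?_⟩
      rw [pow_zero] at hw
      rw [(Ideal.eq_top_iff_one J).2 hw]
      exact Submodule.mem_top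
    | succ m ih =>
      intro w hw
      rw [pow_succ'] at hw
      obtain ⟨s, hs, h | h⟩ := exists_eval_ne_zero_mul_mem hga (hlin a hga) hw
      · exact ⟨s, hs, h⟩
      · obtain ⟨s', hs', h'⟩ := ih (s * w) (by
          rcases m with _ | m
          · rw [pow_zero, mul_one] at h
            exact absurd (hTa s (Ideal.mul_mem_right _ _ h)) hs
          · rw [mul_pow, pow_succ, mul_assoc]
            exact Ideal.mul_mem_left _ _ h)
        exact ⟨s' * s, by rw [map_mul]; exact mul_ne_zero hs' hs, by rwa [mul_assoc]⟩
  obtain ⟨s, hs, hsu⟩ := key m u hm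
  exact hs (hTa s hsu)

end Translate

/-! ### General members are complete intersections -/

section CompleteIntersection

open RingTheory.Sequence

variable {n k : ℕ} {d : Fin k → ℕ}

theorem homogeneousComponent_aeval_of_linear {σ τ R : Type*} [CommSemiring R]
    {g : σ → MvPolynomial τ R} (hg : ∀ i, (g i).IsHomogeneous 1) (j : ℕ) (f : MvPolynomial σ R) :
    homogeneousComponent j (aeval g f) = aeval g (homogeneousComponent j f) := by
  induction f using MvPolynomial.induction_on' with
  | monomial m r =>
    have h1 : (monomial m r).IsHomogeneous m.degree := isHomogeneous_monomial r rfl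
    have h2 := h1.aeval g hg
    rw [one_mul] at h2
    rw [homogeneousComponent_of_mem ((mem_homogeneousSubmodule _ _).2 h1),
      homogeneousComponent_of_mem ((mem_homogeneousSubmodule _ _).2 h2)]
    split_ifs <;> simp
  | add p q hp hq => simp only [map_add, hp, hq]

theorem translate_dehomR_zero (c : Fin (n + 1)) (a : Fin n → ℂ) (f : MvPolynomial (Fin (n + 1)) ℂ) :
    translate a (dehomR c 0 f) = dehomR c a f := by
  have h := translate_neg_translate (-a) (dehomR c a f)
  rw [neg_neg] at h
  rw [dehomR_zero_eq c a f]
  convert h using 2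
  simp only [translate, Pi.neg_apply, C_neg, sub_eq_add_neg]

theorem coeff_zero_dehomR (c : Fin (n + 1)) (a : Fin n → ℂ) (f : MvPolynomial (Fin (n + 1)) ℂ) :
    coeff 0 (dehomR c a f) = eval (Fin.insertNth (α := fun _ => ℂ) c 1 a) f := by
  rw [← translate_dehomR_zero, coeff_zero_translate, eval_dehomR]
  simp

theorem IsGeneral.linearIndependent {hk : 2 ≤ k} {φ : Par n d → ℂ} (h : IsGeneral hk φ)
    (c : Fin (n + 1)) (a : Fin n → ℂ) (h0 : ∀ i, coeff 0 (dehomR c a (form φ i)) = 0) :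
    LinearIndependent ℂ fun i => loc φ c a i 1 := by
  classical
  rw [Fintype.linearIndependent_iff]
  intro r hr i
  by_contra hi
  refine h.singular c ⟨a, r, Pi.single i (r i)⁻¹, h0, ?_, ?_⟩
  · rw [Finset.sum_eq_single i]
    · rw [Pi.single_eq_same, mul_inv_cancel₀ hi]
    · intro j _ hj
      rw [Pi.single_eq_of_ne hj, mul_zero]
    · simp
  · simpa only [smul_eq_C_mul] using hr

theorem eval_insertNth_div {f : MvPolynomial (Fin (n + 1)) ℂ} {e : ℕ} (hf : f.IsHomogeneous e)
    {y : Fin (n + 1) → ℂ} {c : Fin (n + 1)} (hc : y c ≠ 0) (h0 : eval y f = 0) :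
    eval (Fin.insertNth (α := fun _ => ℂ) c 1 fun m => y (c.succAbove m) / y c) f = 0 := by
  have h1 := aeval_smul_of_isHomogeneous hf (y c)
    (Fin.insertNth (α := fun _ => ℂ) c 1 fun m => y (c.succAbove m) / y c)
  have h2 : (fun i => y c * Fin.insertNth (α := fun _ => ℂ) c 1
      (fun m => y (c.succAbove m) / y c) i) = y := by
    funext i
    induction i using c.succAboveCases with
    | x => simp
    | p i => simp [mul_div_cancel₀ _ hc]
  rw [h2, aeval_eq_eval, aeval_eq_eval] at h1
  exact (mul_eq_zero.1 (h1.symm.trans h0)).resolve_left (pow_ne_zero _ hc)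

/-- Restricting the expansion on the cone at y to the directions with vanishing c-th coordinate
gives the chart expansion, up to a non-zero constant. Smoothness of the chart thus passes to the
cone off its vertex. -/
theorem aeval_translate_eq {f : MvPolynomial (Fin (n + 1)) ℂ} {e : ℕ} (hf : f.IsHomogeneous e)
    {y : Fin (n + 1) → ℂ} {c : Fin (n + 1)} (hc : y c ≠ 0) :
    aeval (Fin.insertNth (α := fun _ => MvPolynomial (Fin n) ℂ) c 0 fun m => C (y c) * X m)
      (translate y f) = C (y c ^ e) * dehomR c (fun m => y (c.succAbove m) / y c) f := by
  rw [dehomR, C_pow, ← aeval_smul_of_isHomogeneous hf, translate, ← AlgHom.comp_apply]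
  congr 1
  refine algHom_ext fun i => ?_
  induction i using c.succAboveCases with
  | x => simp [algebraMap_eq]
  | p i =>
    simp only [AlgHom.comp_apply, aeval_X, map_add, Fin.insertNth_apply_succAbove, mul_add,
      ← C_mul, mul_div_cancel₀ _ hc, aeval_C, algebraMap_eq]

theorem IsGeneral.linearIndependent_cone {hk : 2 ≤ k} {φ : Par n d → ℂ} (h : IsGeneral hk φ)
    {y : Fin (n + 1) → ℂ} (hy : y ≠ 0) (h0 : ∀ i, eval y (form φ i) = 0) :
    LinearIndependent ℂ fun i => homogeneousComponent 1 (translate y (form φ i)) := by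
  obtain ⟨c, hc⟩ := Function.ne_iff.1 hy
  rw [Pi.zero_apply] at hc
  have h1 := h.linearIndependent c (fun m => y (c.succAbove m) / y c) fun i => by
    rw [coeff_zero_dehomR]
    exact eval_insertNth_div (isHomogeneous_form φ i) hc (h0 i)
  have h2 : LinearIndependent ℂ fun i =>
      C (y c ^ d i) * loc φ c (fun m => y (c.succAbove m) / y c) i 1 := by
    rw [Fintype.linearIndependent_iff] at h1 ⊢
    intro t ht i
    have h3 := h1 (fun i => t i * y c ^ d i) (by
      simpa only [mul_smul, smul_eq_C_mul, mul_assoc, C_mul] using ht) i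
    exact (mul_eq_zero.1 h3).resolve_right (pow_ne_zero _ hc)
  let ρ : MvPolynomial (Fin (n + 1)) ℂ →ₐ[ℂ] MvPolynomial (Fin n) ℂ :=
    aeval (Fin.insertNth (α := fun _ => MvPolynomial (Fin n) ℂ) c 0 fun m => C (y c) * X m)
  refine LinearIndependent.of_comp ρ.toLinearMap ?_
  have hlin : ∀ b, (Fin.insertNth (α := fun _ => MvPolynomial (Fin n) ℂ) c 0
      (fun m => C (y c) * X m) b).IsHomogeneous 1 := by
    intro b
    induction b using c.succAboveCases with
    | x => rw [Fin.insertNth_apply_same]; exact isHomogeneous_zero _ _ _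
    | p b =>
      rw [Fin.insertNth_apply_succAbove]
      exact (isHomogeneous_X ℂ b).C_mul _
  have hρ : (ρ.toLinearMap ∘ fun i => homogeneousComponent 1 (translate y (form φ i))) =
      fun i => C (y c ^ d i) * loc φ c (fun m => y (c.succAbove m) / y c) i 1 := by
    funext i
    change ρ (homogeneousComponent 1 (translate y (form φ i))) = _
    rw [← homogeneousComponent_aeval_of_linear hlin,
      aeval_translate_eq (isHomogeneous_form φ i) hc,
      homogeneousComponent_C_mul, loc]
  rw [hρ]
  exact h2

theorem ofList_ofFn {A : Type*} [CommRing A] (g : Fin k → A) :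
    Ideal.ofList (List.ofFn g) = Ideal.span (Set.range g) := by
  simp [Ideal.ofList, Set.range, List.mem_ofFn]

theorem exists_sum_mul_eq_one {y : Fin n → ℂ} (hy : y ≠ 0) :
    ∃ z : Fin n → ℂ, ∑ m, z m * y m = 1 := by
  classical
  obtain ⟨c, hc⟩ := Function.ne_iff.1 hy
  refine ⟨Pi.single c (y c)⁻¹, ?_⟩
  rw [Finset.sum_eq_single c]
  · rw [Pi.single_eq_same, inv_mul_cancel₀ hc]
  · intro j _ hj
    rw [Pi.single_eq_of_ne hj, zero_mul]
  · simp

/-- A common zero of the forms and the first r coordinates would lie on the excluded coordinate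
subspace, so together they are a system of parameters at the origin. Homogeneity carries regularity
from the local ring to the polynomial ring. -/
theorem IsGeneral.isWeaklyRegular {hk : 2 ≤ k} {φ : Par n d → ℂ} (h : IsGeneral hk φ)
    (hd : ∀ i, 2 ≤ d i) {r : ℕ} (hr : r + k = n + 1) :
    IsWeaklyRegular (MvPolynomial (Fin (n + 1)) ℂ) (List.ofFn (form φ) ++
      List.ofFn fun m : Fin r => X (Fin.castLE (by omega : r ≤ n + 1) m)) := by
  have hX : ∀ f ∈ List.ofFn (form φ) ++
      List.ofFn fun m : Fin r => (X (Fin.castLE (by omega : r ≤ n + 1) m) :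
        MvPolynomial (Fin (n + 1)) ℂ), ∃ j, 1 ≤ j ∧ f.IsHomogeneous j := by
    intro f hf
    rcases List.mem_append.1 hf with hf | hf
    · obtain ⟨i, rfl⟩ := List.mem_ofFn.1 hf
      exact ⟨d i, by have := hd i; omega, isHomogeneous_form φ i⟩
    · obtain ⟨m, rfl⟩ := List.mem_ofFn.1 hf
      exact ⟨1, le_rfl, isHomogeneous_X _ _⟩
  refine isWeaklyRegular_of_localRingAtOrigin
    (fun f hf => (hX f hf).imp fun _ h => h.2) (isRegular_of_zeros ?_ ?_ ?_).1
  · rw [List.length_append, List.length_ofFn, List.length_ofFn]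
    omega
  · intro f hf
    obtain ⟨j, hj, hfj⟩ := hX f hf
    refine hfj.coeff_eq_zero ?_
    rw [map_zero]
    omega
  · intro y hy
    by_contra hne
    obtain ⟨z, hz⟩ := exists_sum_mul_eq_one hne
    refine h.subspace ⟨y, z, hz, fun m hm => ?_, fun i => ?_⟩
    · have := hy (X m) (List.mem_append_right _ (List.mem_ofFn.2 ⟨⟨m.1, by omega⟩, rfl⟩))
      rwa [eval_X] at this
    · exact hy _ (List.mem_append_left _ (List.mem_ofFn.2 ⟨i, rfl⟩))

/-- Since k + 1 ≤ n, two coordinates x, y form a regular sequence on the cone. Off x = y = 0 the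
cone is smooth, hence locally a domain, and homogeneity leaves no non-trivial idempotents. -/
theorem IsGeneral.isPrime {hk : 2 ≤ k} {φ : Par n d → ℂ} (h : IsGeneral hk φ)
    (hd : ∀ i, 2 ≤ d i) (hkn : k + 1 ≤ n) : (Ideal.span (Set.range (form φ))).IsPrime := by
  have hle : Ideal.span (Set.range (form φ)) ≤ originIdeal (n + 1) := by
    rw [Ideal.span_le]
    rintro _ ⟨i, rfl⟩
    refine mem_originIdeal.2 ((isHomogeneous_form φ i).coeff_eq_zero ?_)
    have := hd i
    rw [map_zero]
    omega
  have hhom : ∀ f ∈ Set.range (form φ), ∃ j, f.IsHomogeneous j := by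
    rintro _ ⟨i, rfl⟩
    exact ⟨_, isHomogeneous_form φ i⟩
  obtain ⟨r, hr⟩ : ∃ r, (r + 2) + k = n + 1 := ⟨n - 1 - k, by omega⟩
  have hreg := h.isWeaklyRegular hd hr
  rw [List.ofFn_succ, List.ofFn_succ] at hreg
  set x : MvPolynomial (Fin (n + 1)) ℂ := X (Fin.castLE (by omega : r + 2 ≤ n + 1) 0) with hx
  set y : MvPolynomial (Fin (n + 1)) ℂ :=
    X (Fin.castLE (by omega : r + 2 ≤ n + 1) (Fin.succ 0)) with hy
  refine isPrime_of_connected (x := x) (y := y)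
    (fun htop => Ideal.IsPrime.ne_top' (top_le_iff.1 (htop ▸ hle))) (fun u hu => ?_)
    (fun u hu => ?_) (fun w hw => ?_) fun Q hQ hIQ hxy u v huv => ?_
  · rw [← ofList_ofFn] at hu ⊢
    exact mul_mem_ofList_of_isWeaklyRegular hreg hu
  · have hI : Ideal.span (Set.range (form φ)) ⊔ Ideal.span {x} =
        Ideal.ofList (List.ofFn (form φ) ++ [x]) := by
      rw [Ideal.ofList_append, ofList_ofFn, Ideal.ofList_singleton]
    rw [hI] at hu ⊢
    refine mul_mem_ofList_of_isWeaklyRegular (r := y)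
      (L₂ := List.ofFn fun i : Fin r => X (Fin.castLE (by omega) i.succ.succ)) ?_ hu
    rwa [List.append_assoc, List.singleton_append]
  · have h0 := mem_originIdeal.1 (hle hw)
    by_cases hw0 : coeff 0 w = 0
    · left
      refine mem_span_of_mul_mem hhom (s := 1 - w) ?_ (by rwa [mul_comm])
      rw [coeff_sub, coeff_zero_one, hw0, sub_zero]
      exact one_ne_zero
    · exact Or.inr (mem_span_of_mul_mem hhom hw0 hw)
  -- If Q vanished only at the origin it would contain all the variables, in particular x and y.
  · have hzero : ∃ a ∈ zeroLocus ℂ Q, a ≠ 0 := by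
      by_contra! hcon
      have : ∀ m, (X m : MvPolynomial (Fin (n + 1)) ℂ) ∈ Q := by
        intro m
        rw [← IsPrime.vanishingIdeal_zeroLocus (K := ℂ) Q]
        intro a ha
        rw [hcon a ha]
        simp
      exact hxy.elim (fun h => h (this _)) fun h => h (this _)
    obtain ⟨a, haQ, ha⟩ := hzero
    have h0 : ∀ i, eval a (form φ i) = 0 := fun i => by
      have := haQ _ (hIQ (Ideal.subset_span ⟨i, rfl⟩))
      rwa [aeval_eq_eval] at this
    obtain ⟨s, hs, hsuv⟩ := exists_eval_ne_zero_mul_mem h0 (h.linearIndependent_cone ha h0) huv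
    refine ⟨s, fun hsQ => hs ?_, hsuv⟩
    have := haQ s hsQ
    rwa [aeval_eq_eval] at this

/-- The regular sequence bounds the dimension from above, and the height of the origin against k
equations bounds it from below. -/
theorem IsGeneral.ringKrullDim_quotient {hk : 2 ≤ k} {φ : Par n d → ℂ} (h : IsGeneral hk φ)
    (hd : ∀ i, 2 ≤ d i) (hkn : k ≤ n) :
    ringKrullDim (MvPolynomial (Fin (n + 1)) ℂ ⧸ Ideal.span (Set.range (form φ))) + (k : ℕ)
      = ((n + 1 : ℕ) : WithBot ℕ∞) := by
  obtain ⟨r, hr⟩ : ∃ r, r + k = n + 1 := ⟨n + 1 - k, by omega⟩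
  refine le_antisymm ?_ ?_
  · have h1 := ringKrullDim_quotient_ofList_add_length_le _
      ((isWeaklyRegular_append_iff _ _ _).1 (h.isWeaklyRegular hd hr)).1
    rw [ofList_ofFn, List.length_ofFn, MvPolynomial.ringKrullDim_of_isNoetherianRing,
      ringKrullDim_eq_zero_of_field, zero_add] at h1
    simpa using h1
  · have h1 := Ideal.height_le_ringKrullDim_quotient_add_encard (p := originIdeal (n + 1))
      (Set.range (form φ)) (by
        rintro _ ⟨i, rfl⟩
        refine mem_originIdeal.2 ((isHomogeneous_form φ i).coeff_eq_zero ?_)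
        have := hd i
        rw [map_zero]
        omega)
    have h2 : (Set.range (form φ)).encard ≤ (k : ℕ∞) := by
      rw [← Set.image_univ]
      refine (Set.encard_image_le _ _).trans ?_
      simp [Set.encard_univ]
    have h3 : ((n + 1 : ℕ) : WithBot ℕ∞) ≤ (originIdeal (n + 1)).height :=
      WithBot.coe_le_coe.2 le_height_originIdeal
    refine h3.trans (h1.trans ?_)
    gcongr
    exact WithBot.coe_le_coe.2 h2

theorem IsGeneral.isRadical_chart {hk : 2 ≤ k} {φ : Par n d → ℂ} (h : IsGeneral hk φ)
    (c : Fin (n + 1)) : (Ideal.span (Set.range fun i => dehomR c 0 (form φ i))).IsRadical := by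
  refine isRadical_of_linearIndependent fun a ha => ?_
  simp only [translate_dehomR_zero]
  refine h.linearIndependent c a fun i => ?_
  rw [← translate_dehomR_zero, coeff_zero_translate, ha]

theorem isCompleteIntersection_of_isGeneral {hk : 2 ≤ k} {F : ParamSpace n d}
    (h : IsGeneral hk (coeffs F)) (hd : ∀ i, 2 ≤ d i) (hkn : k + 1 ≤ n) :
    IsCompleteIntersection F := by
  have hF : eqns F = form (coeffs F) := funext fun i => (form_coeffs F i).symm
  refine ⟨?_, ?_, fun c => ?_⟩
  · rw [hF]
    have := h.isPrime hd hkn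
    rwa [this.radical]
  · rw [hF]
    exact h.ringKrullDim_quotient hd (by omega)
  · rw [hF]
    exact h.isRadical_chart c

end CompleteIntersection

/-! ### General members are regular -/

section Regular

variable {n k : ℕ} {d : Fin k → ℕ}

theorem q_eq_loc (F : ParamSpace n d) (x : PSpace n) (c : Fin (n + 1)) (i : Fin k) (j : ℕ) :
    q F x c i j = loc (coeffs F) c (affineCoords x c) i j := by
  rw [loc, form_coeffs]
  rfl

theorem coeff_zero_dehomR_of_mem_points {F : ParamSpace n d} {x : PSpace n} (hx : x ∈ points F)
    {c : Fin (n + 1)} (hc : x.rep c ≠ 0) (i : Fin k) :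
    coeff 0 (dehomR c (affineCoords x c) (form (coeffs F) i)) = 0 := by
  rw [coeff_zero_dehomR]
  exact eval_insertNth_div (isHomogeneous_form _ i) hc (by rw [form_coeffs]; exact hx i)

theorem IsGeneral.isSmoothPoint {hk : 2 ≤ k} {F : ParamSpace n d} (h : IsGeneral hk (coeffs F))
    {x : PSpace n} (hx : x ∈ points F) : IsSmoothPoint F x := by
  intro c hc
  simp only [q_eq_loc]
  exact h.linearIndependent c _ (coeff_zero_dehomR_of_mem_points hx hc)

theorem eval_linear (h y : Fin n → ℂ) :
    eval y (∑ m, C (h m) * X m : MvPolynomial (Fin n) ℂ) = ∑ m, h m * y m := by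
  simp

theorem coeff_zero_linear (h : Fin n → ℂ) :
    coeff 0 (∑ m, C (h m) * X m : MvPolynomial (Fin n) ℂ) = 0 := by
  simp [coeff_sum, coeff_C_mul]

theorem coeff_zero_loc (φ : Par n d → ℂ) (c : Fin (n + 1)) (a : Fin n → ℂ) (i : Fin k) {j : ℕ}
    (hj : 1 ≤ j) : coeff 0 (loc φ c a i j) = 0 := by
  refine (isHomogeneous_loc φ c a i j).coeff_eq_zero ?_
  rw [map_zero]
  omega

theorem one_le_of_mem_allIdx {e : Σ _ : Fin k, ℕ} (he : e ∈ allIdx d) : 1 ≤ e.2 :=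
  (Finset.mem_Icc.1 (Finset.mem_sigma.1 he).2).1

theorem IsGeneral.isRegularSmoothPoint {hk : 2 ≤ k} {F : ParamSpace n d}
    (h : IsGeneral hk (coeffs F)) (hd : ∀ i, 2 ≤ d i) (hsum : ∑ i, d i = n)
    {x : PSpace n} (hx : x ∈ points F) : IsRegularSmoothPoint hk F x := by
  refine ⟨h.isSmoothPoint hx, fun c hc => ?_⟩
  simp only [q_eq_loc]
  have hdeg := h.reg c
  rw [HasDegeneratePoint] at hdeg
  push Not at hdeg
  obtain ⟨g, hg⟩ := hdeg (affineCoords x c) (fun _ => 0) (fun _ => 0)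
    (coeff_zero_dehomR_of_mem_points hx hc) (fun _ t => t.elim0) fun t => t.elim0
  refine makesRegularSequence_of_zeros [∑ m, C (g m) * X m] ?_ ?_ ?_ fun y hQ hE => ?_
  · rw [Multiset.card_map, Finset.card_val, List.length_singleton, card_regIdx hk hd, hsum]
  · intro f hf
    obtain ⟨e, he, rfl⟩ := Multiset.mem_map.1 hf
    exact coeff_zero_loc _ _ _ _ (one_le_of_mem_allIdx (regIdx_subset hk he))
  · intro f hf
    rw [List.mem_singleton.1 hf, coeff_zero_linear]
  · by_contra hy
    obtain ⟨z, hz⟩ := exists_sum_mul_eq_one hy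
    have hgy := hE _ (List.mem_singleton_self _)
    rw [eval_linear] at hgy
    obtain ⟨e, he, hne⟩ := hg y z hz hgy fun t => t.elim0
    exact hne (hQ _ (Multiset.mem_map_of_mem _ he))

theorem IsGeneral.strongRegularAt {hk : 2 ≤ k} {F : ParamSpace n d}
    (h : IsGeneral hk (coeffs F)) (hd : ∀ i, 2 ≤ d i) (hsum : ∑ i, d i = n)
    {x : PSpace n} (hx : x ∈ points F) : StrongRegularAt hk F x := by
  refine ⟨h.isSmoothPoint hx, fun c hc l hl ⟨v, hv, hlv⟩ => ?_⟩
  simp only [q_eq_loc]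
  have hdeg := h.strong c
  rw [HasDegeneratePoint] at hdeg
  push Not at hdeg
  have hl' : ∀ y, eval y l = ∑ m, coeff (Finsupp.single m 1) l * y m := fun y => by
    conv_lhs => rw [eq_sum_of_isHomogeneous_one hl]
    exact eval_linear _ y
  -- The tangent vector on which l does not vanish, rescaled so that l takes the value 1, is the
  -- dual vector required for s = 1.
  obtain ⟨g, hg⟩ := hdeg (affineCoords x c) (fun _ m => coeff (Finsupp.single m 1) l)
    (fun _ m => (eval v l)⁻¹ * v m) (coeff_zero_dehomR_of_mem_points hx hc)
    (fun i _ => by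
      have h1 := aeval_smul_of_isHomogeneous (isHomogeneous_loc (coeffs F) c (affineCoords x c) i 1)
        (eval v l)⁻¹ v
      have h2 := hv i
      rw [q_eq_loc] at h2
      rwa [aeval_eq_eval, aeval_eq_eval, h2, mul_zero] at h1)
    (fun t t' => by
      rw [if_pos (Subsingleton.elim t t'), ← hl']
      have h1 := aeval_smul_of_isHomogeneous hl (eval v l)⁻¹ v
      rwa [aeval_eq_eval, aeval_eq_eval, pow_one, inv_mul_cancel₀ hlv] at h1)
  refine makesRegularSequence_of_zeros [∑ m, C (g m) * X m] ?_ ?_ ?_ fun y hQ hE => ?_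
  · rw [Multiset.card_cons, Multiset.card_map, Finset.card_val, List.length_singleton]
    have := card_strongIdx hk hd
    omega
  · intro f hf
    rcases Multiset.mem_cons.1 hf with rfl | hf
    · refine hl.coeff_eq_zero ?_
      rw [map_zero]
      exact zero_ne_one
    · obtain ⟨e, he, rfl⟩ := Multiset.mem_map.1 hf
      exact coeff_zero_loc _ _ _ _
        (one_le_of_mem_allIdx (regIdx_subset hk (strongIdx_subset hk he)))
  · intro f hf
    rw [List.mem_singleton.1 hf, coeff_zero_linear]
  · by_contra hy
    obtain ⟨z, hz⟩ := exists_sum_mul_eq_one hy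
    have hgy := hE _ (List.mem_singleton_self _)
    rw [eval_linear] at hgy
    obtain ⟨e, he, hne⟩ := hg y z hz hgy fun _ => by
      rw [← hl']
      exact hQ _ (Multiset.mem_cons_self _ _)
    exact hne (hQ _ (Multiset.mem_cons_of_mem (Multiset.mem_map_of_mem _ he)))

end Regular

end FanoCI

theorem proposition2p1 (k M : ℕ) (hk : 2 ≤ k) (hM : 4 * k + 1 ≤ M)
    (d : Fin k → ℕ) (hmono : Monotone d) (hd : ∀ i, 2 ≤ d i) (hsum : ∑ i, d i = M + k) :
    ∃ U : Set (FanoCI.ParamSpace (M + k) d),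
      U.Nonempty ∧ FanoCI.IsZariskiOpen U ∧ U ⊆ FanoCI.Freg hk d ∧
      ∀ F ∈ U, FanoCI.IsSmooth F ∧ ∀ x ∈ FanoCI.points F, FanoCI.StrongRegularAt hk F x := by
  obtain ⟨G, hG, hgen⟩ := FanoCI.exists_polynomial_isGeneral hk hM hmono hd hsum rfl
  obtain ⟨U, hne, hopen, hU⟩ := FanoCI.exists_isZariskiOpen G hG fun φ hφ => (hgen φ hφ).2
  have hUgen : ∀ F ∈ U, FanoCI.IsGeneral hk (FanoCI.coeffs F) := fun F hF => by
    obtain ⟨t, ht, htG⟩ := hU F hF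
    exact (hgen _ htG).1.of_scale ht
  -- Every point is smooth, so only the first alternative in `Freg` is used.
  refine ⟨U, hne, hopen, fun F hF => ⟨?_, fun x hx => Or.inl ?_⟩, fun F hF => ⟨fun x hx => ?_,
    fun x hx => ?_⟩⟩
  · exact FanoCI.isCompleteIntersection_of_isGeneral (hUgen F hF) hd (by omega)
  · exact (hUgen F hF).isRegularSmoothPoint hd hsum hx
  · exact (hUgen F hF).isSmoothPoint hx
  · exact (hUgen F hF).strongRegularAt hd hsum hx
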